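/- Let $(X,\omega)$ be a symplectic manifold of dimension $2n$ (smooth, Hausdorff, second countable, not necessarily connected, compact or not), and let $\Omega^k(X)$ be the space of smooth real-valued differential $k$-forms on $X$. The nondegenerate form $\omega$ identifies $TX$ with $T^*X$ by $v \mapsto i_v\omega$; let $\wedge^k\omega$ be the bilinear form on $\wedge^k T^*X$ with $(\wedge^k\omega)(i_{v_1}\omega\wedge\dots\wedge i_{v_k}\omega,\; i_{w_1}\omega\wedge\dots\wedge i_{w_k}\omega) = \det(\omega(v_i,w_j))_{i,j}$. The symplectic Hodge star operator $* \colon \Omega^k(X)\to\Omega^{2n-k}(X)$ is determined by $$\beta\wedge *\alpha = (\wedge^k\omega)(\beta,\alpha)\,\frac{\omega^n}{n!}\qquad\text{for all } \beta\in\Omega^k(X);$$ equivalently, if $(\omega^{\mu\nu})$ is the inverse of the matrix $(\omega_{\mu\nu})$, $\omega_{\mu\nu} = \omega(\partial_\mu,\partial_\nu)$, then in local coordinates $$*\alpha = \frac{1}{k!}\sum \omega^{\mu_1\nu_1}\cdots\omega^{\mu_k\nu_k}\,\alpha(\partial_{\mu_1},\dots,\partial_{\mu_k})\; i_{\partial_{\nu_k}}\cdots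 i_{\partial_{\nu_1}}\frac{\omega^n}{n!}.$$ Let $\delta = (-1)^{k+1} * d\, * \colon \Omega^k(X)\to\Omega^{k-1}(X)$ be the canonical homology operator. Then $$[[\alpha],[\beta]] := [\delta\alpha\cdot d\delta\beta],\qquad \alpha,\beta\in\Omega^1(X),$$ is a well-defined Lie bracket on the real vector space $\Omega^1(X)/\delta\Omega^2(X)$, and the Lie algebra so obtained is perfect: it equals its own commutator ideal. Moreover, every element of $\Omega^1(X)/\delta\Omega^2(X)$ is a sum of at most $2n(2n+1)$ commutators. -/

import Mathlib

open scoped Manifold Topology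

noncomputable section

namespace CanonicalHomology

/-! ### Exterior algebra of the model space -/

/-- The model vector space `ℝ²ⁿ`. -/
abbrev Model (n : ℕ) : Type := EuclideanSpace ℝ (Fin (2 * n))

/-- Alternating `k`-forms on the model vector space. -/
abbrev Cov (n k : ℕ) : Type := Model n [⋀^Fin k]→L[ℝ] ℝ

section Smooth

variable {E : Type*} [NormedAddCommGroup E] [NormedSpace ℝ E]

theorem contDiff_alternatizeUncurryFin (k : ℕ) (r : WithTop ℕ∞) :
    ContDiff ℝ r (ContinuousAlternatingMap.alternatizeUncurryFinCLM ℝ E ℝ (n := k)) :=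
  ContinuousLinearMap.contDiff _

theorem contDiff_curryLeft (k : ℕ) (r : WithTop ℕ∞) :
    ContDiff ℝ r (ContinuousAlternatingMap.curryLeftLI (𝕜 := ℝ) (E := E) (F := ℝ)
      (n := k)).toContinuousLinearMap :=
  ContinuousLinearMap.contDiff _

theorem contDiffOn_clm_comp {F G : Type*} [NormedAddCommGroup F] [NormedSpace ℝ F]
    [NormedAddCommGroup G] [NormedSpace ℝ G] {H : Type*} [NormedAddCommGroup H] [NormedSpace ℝ H]
    {r : WithTop ℕ∞} {s : Set H} {g : H → F →L[ℝ] G} {f : H → E →L[ℝ] F}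
    (hg : ContDiffOn ℝ r g s) (hf : ContDiffOn ℝ r f s) :
    ContDiffOn ℝ r (fun y => g y ∘L f y) s := hg.clm_comp hf

theorem contDiffOn_smulRight {F H : Type*} [NormedAddCommGroup F] [NormedSpace ℝ F]
    [NormedAddCommGroup H] [NormedSpace ℝ H] {r : WithTop ℕ∞} {s : Set H} {f : H → F}
    (hf : ContDiffOn ℝ r f s) :
    ContDiffOn ℝ r (fun y => (ContinuousLinearMap.smulRightL ℝ E F).flip (f y)) s := by
  have h : ContDiff ℝ r (ContinuousLinearMap.smulRightL ℝ E F).flip := ContinuousLinearMap.contDiff _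
  exact h.comp_contDiffOn hf

end Smooth

section Linear

variable {n k m : ℕ}

/-- The pullback `A^*α`. -/
def pull (A : Model n →L[ℝ] Model n) (α : Cov n k) : Cov n k := α.compContinuousLinearMap A

/-- The alternatization map as a continuous linear map between the spaces of forms. -/
def altCLM (n k : ℕ) : (Model n →L[ℝ] Cov n k) →L[ℝ] Cov n (k + 1) :=
  ContinuousAlternatingMap.alternatizeUncurryFinCLM ℝ (Model n) ℝ

/-- The map `α ↦ (v ↦ i_v α)`. -/
def curryCLM (n k : ℕ) : Cov n (k + 1) →L[ℝ] (Model n →L[ℝ] Cov n k) :=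
  (ContinuousAlternatingMap.curryLeftLI (𝕜 := ℝ) (E := Model n) (F := ℝ)).toContinuousLinearMap

/-- The interior product `α ↦ i_v α = α(v, ·, …, ·)`. -/
def intProd (v : Model n) : Cov n (k + 1) →L[ℝ] Cov n k :=
  (ContinuousLinearMap.apply ℝ (Cov n k) v) ∘L curryCLM n k

theorem intProd_apply (v : Model n) (α : Cov n (k + 1)) (w : Fin k → Model n) :
    intProd v α w = α (Fin.cons v w) := rfl

/-- The exterior product `ξ ∧ β` of a covector and a `k`-form. -/
def covectorWedge (ξ : Model n →L[ℝ] ℝ) (β : Cov n k) : Cov n (k + 1) :=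
  ContinuousAlternatingMap.alternatizeUncurryFin (ξ.smulRight β)

theorem covectorWedge_apply (ξ : Model n →L[ℝ] ℝ) (β : Cov n k) (v : Fin (k + 1) → Model n) :
    covectorWedge ξ β v = ∑ i : Fin (k + 1), (-1) ^ (i : ℕ) * (ξ (v i) * β (i.removeNth v)) := by
  simp [covectorWedge, ContinuousAlternatingMap.alternatizeUncurryFin_apply]

/-- A two-form as a bilinear map, `v ↦ i_v ω`. -/
def toBilin (ω : Cov n 2) : Model n →L[ℝ] Model n →L[ℝ] ℝ :=
  (ContinuousAlternatingMap.ofSubsingletonLIE (𝕜 := ℝ) (E := Model n) (F := ℝ)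
    (0 : Fin 1)).symm.toContinuousLinearEquiv.toContinuousLinearMap ∘L ω.curryLeft

theorem toBilin_apply (ω : Cov n 2) (v w : Model n) : toBilin ω v w = ω ![v, w] := by
  change ω _ = _
  congr 1
  ext i
  fin_cases i <;> rfl

theorem toBilin_pull (A : Model n →L[ℝ] Model n) (ω : Cov n 2) (v w : Model n) :
    toBilin (pull A ω) v w = toBilin ω (A v) (A w) := by
  rw [toBilin_apply, toBilin_apply]
  change ω _ = _
  congr 1
  ext i
  fin_cases i <;> rfl

/-- The exterior product `ω ∧ β` of a two-form and a `k`-form, as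
`½ ∑ᵢ eⁱ ∧ (i_{eᵢ} ω) ∧ β` for any basis `eᵢ` with dual basis `eⁱ`. Explicitly,
`(ω ∧ β)(v₀, …) = ½ ∑_{i ≠ j} ± ω(vᵢ, vⱼ) β(…)` with `vᵢ`, `vⱼ` omitted from the arguments
of `β`. -/
def twoWedge (ω : Cov n 2) (β : Cov n k) : Cov n (k + 2) :=
  (2⁻¹ : ℝ) • altCLM n (k + 1)
    ((altCLM n k ∘L (ContinuousLinearMap.smulRightL ℝ (Model n) (Cov n k)).flip β) ∘L toBilin ω)

theorem twoWedge_apply (ω : Cov n 2) (β : Cov n k) (v : Fin (k + 2) → Model n) :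
    twoWedge ω β v = 2⁻¹ * ∑ i : Fin (k + 2), (-1) ^ (i : ℕ) *
      covectorWedge (toBilin ω (v i)) β (i.removeNth v) := by
  simp [twoWedge, altCLM, ContinuousAlternatingMap.alternatizeUncurryFin_apply, covectorWedge_apply]

/-- The component of degree `p` of the exponential `e^ω = ∑ⱼ ωʲ / j!`: it is `ω^j / j!` for
`p = 2 j`, and `0` for odd `p`. -/
def expForm (ω : Cov n 2) : (p : ℕ) → Cov n p
  | 0 => ContinuousAlternatingMap.constOfIsEmpty ℝ (Model n) (Fin 0) 1
  | 1 => 0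
  | p + 2 => (2 / ((p : ℝ) + 2)) • twoWedge ω (expForm ω p)

/-- The standard basis vectors of the model space. -/
def stdVec (i : Fin (2 * n)) : Model n := EuclideanSpace.single i (1 : ℝ)

/-- The matrix `ω_{ij} = ω(eᵢ, eⱼ)`. -/
def formMatrix (ω : Cov n 2) : Matrix (Fin (2 * n)) (Fin (2 * n)) ℝ :=
  Matrix.of fun i j => ω ![stdVec i, stdVec j]

/-- Contraction of the polyvector part of a tensor with a `k`-form and of its form part with the
remaining indices of a `(m + k)`-form: for a matrix `P^{ij}`, this is
`(1/k!) ∑ P^{i₁j₁} ⋯ P^{i_k j_k} α(e_{i₁}, …, e_{i_k}) · i_{e_{j_k}} ⋯ i_{e_{j₁}} η`. -/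
def contraction (P : Matrix (Fin (2 * n)) (Fin (2 * n)) ℝ) :
    (k : ℕ) → Cov n k → Cov n (m + k) → Cov n m
  | 0, α, η => α ![] • η
  | k + 1, α, η => ((k : ℝ) + 1)⁻¹ • ∑ i, ∑ j,
      P i j • contraction P k (intProd (stdVec i) α) (intProd (stdVec j) η)

/-- The symplectic Hodge star `∗ : Λᵏ → Λᵐ`, `m + k = 2 n`, of a symplectic form `ω` on `ℝ²ⁿ`,
the contraction of
`(1/k!) ω^{i₁j₁} ⋯ ω^{i_k j_k} ∂_{i₁} ∧ ⋯ ∧ ∂_{i_k} ⊗ i_{∂_{j_k}} ⋯ i_{∂_{j₁}} ωⁿ/n!`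
with a `k`-form, where `(ω^{ij})` is the inverse of the matrix `(ω_{ij})`.
There is no such operator for other values of `m` and `k`; it is set to zero then. -/
def starCov (ω : Cov n 2) (k m : ℕ) (α : Cov n k) : Cov n m :=
  if m + k = 2 * n then contraction (formMatrix ω)⁻¹ k α (expForm ω (m + k)) else 0

/-! #### Linearity, naturality and smoothness of the star operator -/

theorem contraction_add_left (P : Matrix (Fin (2 * n)) (Fin (2 * n)) ℝ) :
    ∀ (k : ℕ) (α β : Cov n k) (η : Cov n (m + k)),
      contraction P k (α + β) η = contraction P k α η + contraction P k β η
  | 0, α, β, η => by simp [contraction, add_smul]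
  | k + 1, α, β, η => by
    simp only [contraction, map_add, contraction_add_left P k, smul_add, Finset.sum_add_distrib]

theorem contraction_smul_left (P : Matrix (Fin (2 * n)) (Fin (2 * n)) ℝ) :
    ∀ (k : ℕ) (c : ℝ) (α : Cov n k) (η : Cov n (m + k)),
      contraction P k (c • α) η = c • contraction P k α η
  | 0, c, α, η => by simp [contraction, mul_smul]
  | k + 1, c, α, η => by
    simp only [contraction, map_smul, contraction_smul_left P k, Finset.smul_sum]
    refine Finset.sum_congr rfl fun i _ => Finset.sum_congr rfl fun j _ => ?_
    simp only [smul_smul]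
    congr 1
    ring

theorem contraction_add_right (P : Matrix (Fin (2 * n)) (Fin (2 * n)) ℝ) :
    ∀ (k : ℕ) (α : Cov n k) (η θ : Cov n (m + k)),
      contraction P k α (η + θ) = contraction P k α η + contraction P k α θ
  | 0, α, η, θ => by simp [contraction]
  | k + 1, α, η, θ => by
    simp only [contraction]
    have h : ∀ j : Fin (2 * n), (intProd (stdVec j) (k := m + k) (η + θ)) =
      intProd (stdVec j) (k := m + k) η + intProd (stdVec j) (k := m + k) θ := fun j =>
        map_add _ _ _
    simp only [h, contraction_add_right P k, smul_add, Finset.sum_add_distrib]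

theorem contraction_smul_right (P : Matrix (Fin (2 * n)) (Fin (2 * n)) ℝ) :
    ∀ (k : ℕ) (c : ℝ) (α : Cov n k) (η : Cov n (m + k)),
      contraction P k α (c • η) = c • contraction P k α η
  | 0, c, α, η => by simp only [contraction, smul_comm c]
  | k + 1, c, α, η => by
    simp only [contraction]
    have h : ∀ j : Fin (2 * n), (intProd (stdVec j) (k := m + k) (c • η)) =
      c • intProd (stdVec j) (k := m + k) η := fun j => map_smul _ _ _
    simp only [h, contraction_smul_right P k, Finset.smul_sum]
    refine Finset.sum_congr rfl fun i _ => Finset.sum_congr rfl fun j _ => ?_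
    simp only [smul_smul]
    congr 1
    ring

theorem starCov_add (ω : Cov n 2) (k m : ℕ) (α β : Cov n k) :
    starCov ω k m (α + β) = starCov ω k m α + starCov ω k m β := by
  unfold starCov
  split_ifs
  · exact contraction_add_left _ _ _ _ _
  · simp

theorem starCov_smul (ω : Cov n 2) (k m : ℕ) (c : ℝ) (α : Cov n k) :
    starCov ω k m (c • α) = c • starCov ω k m α := by
  unfold starCov
  split_ifs
  · exact contraction_smul_left _ _ _ _ _
  · simp

theorem intProd_add (v w : Model n) (α : Cov n (k + 1)) :
    intProd (v + w) α = intProd v α + intProd w α := map_add α.curryLeft v w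

theorem intProd_smul (c : ℝ) (v : Model n) (α : Cov n (k + 1)) :
    intProd (c • v) α = c • intProd v α := map_smul α.curryLeft c v

theorem intProd_pull (A : Model n →L[ℝ] Model n) (v : Model n) (α : Cov n (k + 1)) :
    intProd v (pull A α) = pull A (intProd (A v) α) :=
  ContinuousAlternatingMap.curryLeft_compContinuousLinearMap α A v

theorem pull_add (A : Model n →L[ℝ] Model n) (α β : Cov n k) :
    pull A (α + β) = pull A α + pull A β := rfl

theorem pull_smul (A : Model n →L[ℝ] Model n) (c : ℝ) (α : Cov n k) :
    pull A (c • α) = c • pull A α := rfl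

theorem pull_zero (A : Model n →L[ℝ] Model n) : pull A (0 : Cov n k) = 0 := rfl

theorem pull_pull (A B : Model n →L[ℝ] Model n) (α : Cov n k) :
    pull A (pull B α) = pull (B ∘L A) α := rfl

theorem pull_id (α : Cov n k) : pull (ContinuousLinearMap.id ℝ (Model n)) α = α := rfl

theorem pull_sum (A : Model n →L[ℝ] Model n) {ι : Type*} (s : Finset ι) (f : ι → Cov n k) :
    pull A (∑ i ∈ s, f i) = ∑ i ∈ s, pull A (f i) :=
  map_sum (ContinuousAlternatingMap.compContinuousLinearMapCLM (ι := Fin k) (F := ℝ) A) f s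

theorem covectorWedge_pull (A : Model n →L[ℝ] Model n) (ξ : Model n →L[ℝ] ℝ) (β : Cov n k) :
    covectorWedge (ξ ∘L A) (pull A β) = pull A (covectorWedge ξ β) := by
  ext v
  change _ = covectorWedge ξ β (A ∘ v)
  rw [covectorWedge_apply, covectorWedge_apply]
  rfl

theorem twoWedge_pull (A : Model n →L[ℝ] Model n) (ω : Cov n 2) (β : Cov n k) :
    twoWedge (pull A ω) (pull A β) = pull A (twoWedge ω β) := by
  ext v
  change _ = twoWedge ω β (A ∘ v)
  rw [twoWedge_apply, twoWedge_apply]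
  refine congrArg _ (Finset.sum_congr rfl fun i _ => congrArg _ ?_)
  have h : toBilin (pull A ω) (v i) = toBilin ω (A (v i)) ∘L A :=
    ContinuousLinearMap.ext fun w => toBilin_pull A ω (v i) w
  rw [h, covectorWedge_pull]
  rfl

theorem expForm_pull (A : Model n →L[ℝ] Model n) (ω : Cov n 2) :
    ∀ p : ℕ, expForm (pull A ω) p = pull A (expForm ω p)
  | 0 => rfl
  | 1 => rfl
  | p + 2 => by
    rw [expForm, expForm, expForm_pull A ω p, twoWedge_pull, pull_smul]

/-- The matrix of a linear map in the standard basis. -/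
def mapMatrix (A : Model n →L[ℝ] Model n) : Matrix (Fin (2 * n)) (Fin (2 * n)) ℝ :=
  Matrix.of fun i j => A (stdVec j) i

theorem eq_sum_stdVec (v : Model n) : v = ∑ i, v i • stdVec i := by
  ext j
  simp [stdVec, Pi.single_apply]

theorem apply_stdVec (A : Model n →L[ℝ] Model n) (j : Fin (2 * n)) :
    A (stdVec j) = ∑ i, mapMatrix A i j • stdVec i := eq_sum_stdVec _

theorem mapMatrix_mul (A B : Model n →L[ℝ] Model n) :
    mapMatrix (A ∘L B) = mapMatrix A * mapMatrix B := by
  ext i j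
  simp only [mapMatrix, Matrix.mul_apply, Matrix.of_apply, ContinuousLinearMap.comp_apply]
  conv_lhs => rw [eq_sum_stdVec (B (stdVec j))]
  simp [mul_comm]

theorem mapMatrix_id : mapMatrix (ContinuousLinearMap.id ℝ (Model n)) = 1 := by
  ext i j
  simp [mapMatrix, stdVec, Matrix.one_apply]

theorem formMatrix_pull (A : Model n →L[ℝ] Model n) (ω : Cov n 2) :
    formMatrix (pull A ω) = (mapMatrix A).transpose * formMatrix ω * mapMatrix A := by
  ext i j
  simp only [formMatrix, Matrix.of_apply, ← toBilin_apply, toBilin_pull, Matrix.mul_apply,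
    Matrix.transpose_apply]
  rw [apply_stdVec A i, apply_stdVec A j]
  simp only [map_sum, map_smul, sum_apply, smul_apply,
    smul_eq_mul, Finset.sum_mul, Finset.mul_sum]
  refine Finset.sum_congr rfl fun a _ => Finset.sum_congr rfl fun b _ => ?_
  ring

/-- Change of basis in a contraction of a bilinear expression with a matrix. -/
theorem sum_change_basis {V : Type*} [AddCommGroup V] [Module ℝ V] (A : Model n →L[ℝ] Model n)
    (P : Matrix (Fin (2 * n)) (Fin (2 * n)) ℝ) (f : Model n → Model n → V)
    (h₁ : ∀ w, IsLinearMap ℝ fun v => f v w) (h₂ : ∀ v, IsLinearMap ℝ (f v)) :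
    ∑ i, ∑ j, P i j • f (A (stdVec i)) (A (stdVec j)) =
      ∑ i, ∑ j, (mapMatrix A * P * (mapMatrix A).transpose) i j • f (stdVec i) (stdVec j) := by
  have e : ∀ i j, f (A (stdVec i)) (A (stdVec j)) =
      ∑ a, ∑ b, (mapMatrix A a i * mapMatrix A b j) • f (stdVec a) (stdVec b) := by
    intro i j
    have e₁ : f (A (stdVec i)) (A (stdVec j)) =
        ∑ a, mapMatrix A a i • f (stdVec a) (A (stdVec j)) := by
      conv_lhs => rw [apply_stdVec A i]
      exact (map_sum (IsLinearMap.mk' _ (h₁ (A (stdVec j)))) _ _).trans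
        (Finset.sum_congr rfl fun a _ => (h₁ (A (stdVec j))).map_smul _ _)
    rw [e₁]
    refine Finset.sum_congr rfl fun a _ => ?_
    have e₂ : f (stdVec a) (A (stdVec j)) = ∑ b, mapMatrix A b j • f (stdVec a) (stdVec b) := by
      conv_lhs => rw [apply_stdVec A j]
      exact (map_sum (IsLinearMap.mk' _ (h₂ (stdVec a))) _ _).trans
        (Finset.sum_congr rfl fun b _ => (h₂ (stdVec a)).map_smul _ _)
    rw [e₂, Finset.smul_sum]
    simp only [smul_smul]
  simp only [e, Finset.smul_sum, smul_smul, Matrix.mul_apply, Matrix.transpose_apply,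
    Finset.sum_mul, Finset.sum_smul]
  calc _ = ∑ i, ∑ a, ∑ j, ∑ b, (P i j * (mapMatrix A a i * mapMatrix A b j)) •
        f (stdVec a) (stdVec b) := Finset.sum_congr rfl fun i _ => Finset.sum_comm
    _ = ∑ a, ∑ i, ∑ j, ∑ b, (P i j * (mapMatrix A a i * mapMatrix A b j)) •
        f (stdVec a) (stdVec b) := Finset.sum_comm
    _ = ∑ a, ∑ i, ∑ b, ∑ j, (P i j * (mapMatrix A a i * mapMatrix A b j)) •
        f (stdVec a) (stdVec b) := Finset.sum_congr rfl fun a _ => Finset.sum_congr rfl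
          fun i _ => Finset.sum_comm
    _ = ∑ a, ∑ b, ∑ i, ∑ j, (P i j * (mapMatrix A a i * mapMatrix A b j)) •
        f (stdVec a) (stdVec b) := Finset.sum_congr rfl fun a _ => Finset.sum_comm
    _ = _ := by
      refine Finset.sum_congr rfl fun a _ => Finset.sum_congr rfl fun b _ => ?_
      rw [Finset.sum_comm]
      refine Finset.sum_congr rfl fun j _ => Finset.sum_congr rfl fun i _ => ?_
      congr 1
      ring

theorem contraction_pull (A : Model n →L[ℝ] Model n)
    (P : Matrix (Fin (2 * n)) (Fin (2 * n)) ℝ) :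
    ∀ (k : ℕ) (α : Cov n k) (η : Cov n (m + k)),
      contraction P k (pull A α) (pull A η) =
        pull A (contraction (mapMatrix A * P * (mapMatrix A).transpose) k α η)
  | 0, α, η => by
    simp only [contraction, pull_smul]
    refine congrArg (fun c : ℝ => c • pull A η) ?_
    exact congrArg α (Subsingleton.elim _ _)
  | k + 1, α, η => by
    have h : ∀ j : Fin (2 * n), (intProd (stdVec j) (k := m + k) (pull A η)) =
      pull A (intProd (A (stdVec j)) (k := m + k) η) := fun j => intProd_pull A _ _
    simp only [contraction, intProd_pull, h, contraction_pull A P k, pull_smul, pull_sum]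
    congr 1
    have := sum_change_basis A P
      (fun v w => pull A (contraction (mapMatrix A * P * (mapMatrix A).transpose) k
        (intProd v α) (intProd w (k := m + k) η)))
      (fun w => ⟨fun v v' => by simp only [intProd_add, contraction_add_left, pull_add],
        fun c v => by simp only [intProd_smul, contraction_smul_left, pull_smul]⟩)
      (fun v => ⟨fun w w' => by
          rw [intProd_add (k := m + k), contraction_add_right, pull_add],
        fun c w => by rw [intProd_smul (k := m + k), contraction_smul_right, pull_smul]⟩)
    exact this

/-- Naturality of the star operator under linear isomorphisms. -/
theorem starCov_pull (A B : Model n →L[ℝ] Model n)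
    (hAB : A ∘L B = ContinuousLinearMap.id ℝ (Model n)) (ω : Cov n 2) (k m : ℕ) (α : Cov n k) :
    starCov (pull A ω) k m (pull A α) = pull A (starCov ω k m α) := by
  unfold starCov
  split_ifs
  · rw [expForm_pull, contraction_pull, formMatrix_pull]
    have hM : mapMatrix A * mapMatrix B = 1 := by rw [← mapMatrix_mul, hAB, mapMatrix_id]
    have hd : IsUnit (mapMatrix A).det := Matrix.isUnit_det_of_right_inverse hM
    have hd' : IsUnit (mapMatrix A).transpose.det := by rwa [Matrix.det_transpose]
    congr 2
    rw [Matrix.mul_inv_rev, Matrix.mul_inv_rev, ← mul_assoc, Matrix.mul_nonsing_inv _ hd, one_mul,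
      mul_assoc, Matrix.nonsing_inv_mul _ hd', mul_one]
  · rfl

/-- Nondegeneracy of a two-form on the model space. -/
def Nondeg (ω : Cov n 2) : Prop := ∀ v, (∀ w, ω ![v, w] = 0) → v = 0

theorem Nondeg.det_ne_zero {ω : Cov n 2} (h : Nondeg ω) : (formMatrix ω).det ≠ 0 := by
  intro h0
  obtain ⟨c, hc, hc0⟩ := Matrix.exists_vecMul_eq_zero_iff.2 h0
  refine hc ?_
  have hv : (∑ i, c i • stdVec i : Model n) = 0 := by
    refine h _ fun w => ?_
    rw [← toBilin_apply, eq_sum_stdVec w]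
    simp only [map_sum, map_smul, sum_apply, smul_apply,
      smul_eq_mul, Finset.mul_sum]
    refine Finset.sum_eq_zero fun j _ => ?_
    have := congrFun hc0 j
    simp only [Matrix.vecMul, dotProduct, formMatrix, Matrix.of_apply, Pi.zero_apply] at this
    simp only [toBilin_apply]
    rw [← Finset.mul_sum, this, mul_zero]
  funext i
  have := congrArg (fun v : Model n => v i) hv
  simpa [stdVec, Pi.single_apply] using this


/-! Smooth dependence of the star operator on the symplectic form and on its argument. -/

theorem contDiff_altCLM (r : WithTop ℕ∞) : ContDiff ℝ r (altCLM n k) :=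
  contDiff_alternatizeUncurryFin k r

theorem contDiff_curryCLM (r : WithTop ℕ∞) : ContDiff ℝ r (curryCLM n k) :=
  contDiff_curryLeft k r

theorem contDiffOn_intProd {r : WithTop ℕ∞} {s : Set (Model n)} (v : Model n)
    {f : Model n → Cov n (k + 1)} (hf : ContDiffOn ℝ r f s) :
    ContDiffOn ℝ r (fun y => intProd v (f y)) s :=
  (intProd v).contDiff.comp_contDiffOn hf

theorem contDiffOn_contraction {r : WithTop ℕ∞} {s : Set (Model n)}
    {P : Model n → Matrix (Fin (2 * n)) (Fin (2 * n)) ℝ}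
    (hP : ∀ i j, ContDiffOn ℝ r (fun y => P y i j) s) :
    ∀ (k : ℕ) {f : Model n → Cov n k} {g : Model n → Cov n (m + k)},
      ContDiffOn ℝ r f s → ContDiffOn ℝ r g s →
      ContDiffOn ℝ r (fun y => contraction (P y) k (f y) (g y)) s
  | 0, f, g, hf, hg => by
    have h : ContDiffOn ℝ r (fun y => f y ![]) s :=
      (ContinuousAlternatingMap.apply ℝ (Model n) ℝ (![] : Fin 0 → Model n)).contDiff.comp_contDiffOn hf
    exact h.smul hg
  | k + 1, f, g, hf, hg => by
    refine ContDiffOn.const_smul _ (ContDiffOn.sum fun i _ => ContDiffOn.sum fun j _ => ?_)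
    exact (hP i j).smul (contDiffOn_contraction hP k (contDiffOn_intProd _ hf)
      (contDiffOn_intProd _ hg))

theorem contDiffOn_toBilin {r : WithTop ℕ∞} {s : Set (Model n)} {f : Model n → Cov n 2}
    (hf : ContDiffOn ℝ r f s) : ContDiffOn ℝ r (fun y => toBilin (f y)) s := by
  have h : ContDiffOn ℝ r (fun y => (f y).curryLeft) s :=
    (contDiff_curryCLM r).comp_contDiffOn hf
  exact contDiffOn_const.clm_comp h

theorem contDiffOn_twoWedge {r : WithTop ℕ∞} {s : Set (Model n)} {f : Model n → Cov n 2}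
    {g : Model n → Cov n k} (hf : ContDiffOn ℝ r f s) (hg : ContDiffOn ℝ r g s) :
    ContDiffOn ℝ r (fun y => twoWedge (f y) (g y)) s := by
  refine ContDiffOn.const_smul _ ?_
  refine (contDiff_altCLM r).comp_contDiffOn ?_
  exact contDiffOn_clm_comp (contDiffOn_clm_comp contDiffOn_const (contDiffOn_smulRight hg))
    (contDiffOn_toBilin hf)

theorem contDiffOn_expForm {r : WithTop ℕ∞} {s : Set (Model n)} {f : Model n → Cov n 2}
    (hf : ContDiffOn ℝ r f s) : ∀ p : ℕ, ContDiffOn ℝ r (fun y => expForm (f y) p) s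
  | 0 => contDiffOn_const
  | 1 => contDiffOn_const
  | p + 2 => (contDiffOn_twoWedge hf (contDiffOn_expForm hf p)).const_smul _

theorem contDiffOn_det {r : WithTop ℕ∞} {s : Set (Model n)} {ι : Type*} [Fintype ι]
    [DecidableEq ι] {P : Model n → Matrix ι ι ℝ}
    (hP : ∀ i j, ContDiffOn ℝ r (fun y => P y i j) s) : ContDiffOn ℝ r (fun y => (P y).det) s := by
  simp only [Matrix.det_apply]
  exact ContDiffOn.sum fun σ _ => ContDiffOn.const_smul _ (contDiffOn_prod fun i _ => hP _ _)

theorem contDiffOn_inv {r : WithTop ℕ∞} {s : Set (Model n)} {ι : Type*} [Fintype ι]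
    [DecidableEq ι] {P : Model n → Matrix ι ι ℝ}
    (hP : ∀ i j, ContDiffOn ℝ r (fun y => P y i j) s) (h0 : ∀ y ∈ s, (P y).det ≠ 0) (i j : ι) :
    ContDiffOn ℝ r (fun y => (P y)⁻¹ i j) s := by
  simp only [Matrix.inv_def, Ring.inverse_eq_inv', Matrix.smul_apply, smul_eq_mul,
    Matrix.adjugate_apply]
  refine ((contDiffOn_det hP).inv h0).mul (contDiffOn_det fun a b => ?_)
  by_cases ha : a = j
  · subst ha
    simpa using contDiffOn_const
  · simpa [Matrix.updateRow_ne ha] using hP a b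

theorem contDiffOn_starCov {r : WithTop ℕ∞} {s : Set (Model n)} {f : Model n → Cov n 2}
    {g : Model n → Cov n k} (hf : ContDiffOn ℝ r f s) (h0 : ∀ y ∈ s, Nondeg (f y))
    (hg : ContDiffOn ℝ r g s) : ContDiffOn ℝ r (fun y => starCov (f y) k m (g y)) s := by
  unfold starCov
  split_ifs
  · refine contDiffOn_contraction (fun i j => ?_) k hg (contDiffOn_expForm hf _)
    refine contDiffOn_inv (fun a b => ?_) (fun y hy => (h0 y hy).det_ne_zero) i j
    exact (ContinuousAlternatingMap.apply ℝ (Model n) ℝ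
      ![stdVec a, stdVec b]).contDiff.comp_contDiffOn hf
  · exact contDiffOn_const

end Linear

/-! ### Differential forms on a manifold -/

section Manifold

variable {n k m : ℕ} {X : Type*} [TopologicalSpace X] [ChartedSpace (Model n) X]

/-- The derivative at `x` of the preferred chart around `c`. -/
def chartDeriv (c x : X) : Model n →L[ℝ] Model n :=
  mfderiv (𝓡 (2 * n)) (𝓡 (2 * n)) (chartAt (Model n) c) x

/-- The derivative at `y` of the inverse of the preferred chart around `c`. -/
def chartSymmDeriv (c : X) (y : Model n) : Model n →L[ℝ] Model n :=
  mfderiv (𝓡 (2 * n)) (𝓡 (2 * n)) (chartAt (Model n) c).symm y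

variable (n X) in
/-- A (not necessarily smooth) differential `k`-form: an alternating form on every tangent space
(recall that `TangentSpace (𝓡 (2 * n)) x` is by definition the model space `Model n`). -/
def RoughForm (k : ℕ) : Type _ := X → Cov n k

instance : AddCommGroup (RoughForm n X k) := inferInstanceAs (AddCommGroup (X → Cov n k))

instance : Module ℝ (RoughForm n X k) := inferInstanceAs (Module ℝ (X → Cov n k))

/-- The expression of a form in the preferred chart around `c`, that is, its pullback under the
inverse of this chart. -/
def localRep (c : X) (α : RoughForm n X k) (y : Model n) : Cov n k :=
  pull (chartSymmDeriv c y) (α ((chartAt (Model n) c).symm y))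

/-- Smoothness of differential forms: all expressions in charts are smooth. -/
def IsSmoothForm (α : RoughForm n X k) : Prop :=
  ∀ c : X, ContDiffOn ℝ ((⊤ : ℕ∞) : WithTop ℕ∞) (localRep c α) (chartAt (Model n) c).target

/-- The exterior derivative of a form, computed at `x` in the preferred chart around `x`. -/
def extDerivForm (α : RoughForm n X k) : RoughForm n X (k + 1) := fun x =>
  pull (chartDeriv x x) (extDeriv (localRep x α) (chartAt (Model n) x x))

theorem localRep_add (c : X) (α β : RoughForm n X k) :
    localRep c (α + β) = localRep c α + localRep c β := rfl

theorem localRep_smul (c : X) (r : ℝ) (α : RoughForm n X k) :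
    localRep c (r • α) = r • localRep c α := rfl

variable (n X) in
/-- The space `Ωᵏ(X)` of smooth differential `k`-forms. -/
def Form (k : ℕ) : Submodule ℝ (RoughForm n X k) where
  carrier := {α | IsSmoothForm α}
  add_mem' hα hβ c := (hα c).add (hβ c)
  zero_mem' _ := contDiffOn_const (c := (0 : Cov n k))
  smul_mem' r _ hα c := (hα c).const_smul r

theorem Form.differentiableAt (α : Form n X k) (x : X) :
    DifferentiableAt ℝ (localRep x α.1) (chartAt (Model n) x x) :=
  ((α.2 x).contDiffAt ((chartAt (Model n) x).open_target.mem_nhds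
    (mem_chart_target _ _))).differentiableAt (by simp)

variable [IsManifold (𝓡 (2 * n)) ((⊤ : ℕ∞) : WithTop ℕ∞) X]

theorem chart_mdifferentiable (c : X) :
    (chartAt (Model n) c).MDifferentiable (𝓡 (2 * n)) (𝓡 (2 * n)) :=
  haveI : IsManifold (𝓡 (2 * n)) 1 X :=
    IsManifold.of_le (n := ((⊤ : ℕ∞) : WithTop ℕ∞)) (by exact_mod_cast le_top)
  mdifferentiable_chart c

theorem chartDeriv_comp (c : X) {y : Model n} (hy : y ∈ (chartAt (Model n) c).target) :
    chartDeriv c ((chartAt (Model n) c).symm y) ∘L chartSymmDeriv c y =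
      ContinuousLinearMap.id ℝ (Model n) :=
  (chart_mdifferentiable c).comp_symm_deriv hy

theorem chartSymmDeriv_comp (c : X) {x : X} (hx : x ∈ (chartAt (Model n) c).source) :
    chartSymmDeriv c (chartAt (Model n) c x) ∘L chartDeriv c x =
      ContinuousLinearMap.id ℝ (Model n) :=
  (chart_mdifferentiable c).symm_comp_deriv hx

theorem contDiffAt_transition (c c' : X) {y : Model n} (hy : y ∈ (chartAt (Model n) c).target)
    (hy' : (chartAt (Model n) c).symm y ∈ (chartAt (Model n) c').source) :
    ContDiffAt ℝ ((⊤ : ℕ∞) : WithTop ℕ∞) (chartAt (Model n) c' ∘ (chartAt (Model n) c).symm) y := by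
  rw [← contMDiffAt_iff_contDiffAt]
  refine ContMDiffAt.comp (I' := 𝓡 (2 * n)) y ?_ ?_
  · exact contMDiffOn_chart.contMDiffAt ((chartAt (Model n) c').open_source.mem_nhds hy')
  · exact contMDiffOn_chart_symm.contMDiffAt ((chartAt (Model n) c).open_target.mem_nhds hy)

theorem fderiv_transition (c c' : X) {y : Model n} (hy : y ∈ (chartAt (Model n) c).target)
    (hy' : (chartAt (Model n) c).symm y ∈ (chartAt (Model n) c').source) :
    fderiv ℝ (chartAt (Model n) c' ∘ (chartAt (Model n) c).symm) y =
      chartDeriv c' ((chartAt (Model n) c).symm y) ∘L chartSymmDeriv c y := by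
  rw [← mfderiv_eq_fderiv]
  exact mfderiv_comp (I' := 𝓡 (2 * n)) y ((chart_mdifferentiable c').mdifferentiableAt hy')
    ((chart_mdifferentiable c).mdifferentiableAt_symm hy)

theorem localRep_transition (c c' : X) (α : RoughForm n X k) {y : Model n}
    (hy : y ∈ (chartAt (Model n) c).target)
    (hy' : (chartAt (Model n) c).symm y ∈ (chartAt (Model n) c').source) :
    localRep c α y = pull (fderiv ℝ (chartAt (Model n) c' ∘ (chartAt (Model n) c).symm) y)
      (localRep c' α (chartAt (Model n) c' ((chartAt (Model n) c).symm y))) := by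
  rw [fderiv_transition c c' hy hy', localRep, localRep, pull_pull,
    (chartAt (Model n) c').left_inv hy', ← ContinuousLinearMap.comp_assoc,
    chartSymmDeriv_comp c' hy', ContinuousLinearMap.id_comp]

/-- In every chart, the exterior derivative is that of the model space. -/
theorem localRep_extDerivForm {α : RoughForm n X k} (hα : IsSmoothForm α) (c : X) {y : Model n}
    (hy : y ∈ (chartAt (Model n) c).target) :
    localRep c (extDerivForm α) y = extDeriv (localRep c α) y := by
  set x := (chartAt (Model n) c).symm y with hx
  have hxs : x ∈ (chartAt (Model n) x).source := mem_chart_source _ _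
  have ht : chartAt (Model n) x x ∈ (chartAt (Model n) x).target := mem_chart_target _ _
  have hev : localRep c α =ᶠ[𝓝 y] fun z =>
      pull (fderiv ℝ (chartAt (Model n) x ∘ (chartAt (Model n) c).symm) z)
        (localRep x α ((chartAt (Model n) x ∘ (chartAt (Model n) c).symm) z)) := by
    have h₁ := (chartAt (Model n) c).open_target.mem_nhds hy
    have h₂ := ((chartAt (Model n) c).continuousAt_symm hy).preimage_mem_nhds
      ((chartAt (Model n) x).open_source.mem_nhds hxs)
    filter_upwards [h₁, h₂] with z hz hz'
    exact localRep_transition c x α hz hz'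
  have hd : DifferentiableAt ℝ (localRep x α)
      ((chartAt (Model n) x ∘ (chartAt (Model n) c).symm) y) :=
    ((hα x).contDiffAt ((chartAt (Model n) x).open_target.mem_nhds ht)).differentiableAt (by simp)
  rw [hev.extDeriv_eq]
  refine Eq.trans ?_ (extDeriv_pullback hd (contDiffAt_transition c x hy hxs) (by
    rw [minSmoothness_of_isRCLikeNormedField]
    exact WithTop.coe_le_coe.2 (le_top : (2 : ℕ∞) ≤ ⊤))).symm
  rw [fderiv_transition c x hy hxs]
  rfl

theorem IsSmoothForm.extDerivForm {α : RoughForm n X k} (hα : IsSmoothForm α) :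
    IsSmoothForm (extDerivForm α) := by
  intro c
  refine ContDiffOn.congr ?_ fun y hy => localRep_extDerivForm hα c hy
  refine (contDiff_altCLM _).comp_contDiffOn ?_
  exact (hα c).fderiv_of_isOpen (chartAt (Model n) c).open_target (by simp)


/-- The exterior derivative `d : Ωᵏ(X) → Ωᵏ⁺¹(X)`. -/
def d : Form n X k →ₗ[ℝ] Form n X (k + 1) where
  toFun α := ⟨extDerivForm α.1, IsSmoothForm.extDerivForm α.2⟩
  map_add' α β := by
    refine Subtype.ext (funext fun x => ?_)
    change pull _ (extDeriv (localRep x α.1 + localRep x β.1) _) = _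
    rw [extDeriv_add (Form.differentiableAt α x) (Form.differentiableAt β x)]
    rfl
  map_smul' r α := by
    refine Subtype.ext (funext fun x => ?_)
    change pull _ (extDeriv (r • localRep x α.1) _) = _
    rw [extDeriv_smul]
    rfl

/-- The product `f α` of a function, that is, a `0`-form, and a `k`-form. -/
def mulForm (f : Form n X 0) (α : Form n X k) : Form n X k :=
  ⟨fun x => f.1 x ![] • α.1 x, fun c => by
    have h : ContDiffOn ℝ ((⊤ : ℕ∞) : WithTop ℕ∞) (fun y => localRep c f.1 y ![])
        (chartAt (Model n) c).target :=
      (ContinuousAlternatingMap.apply ℝ (Model n) ℝ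
        (![] : Fin 0 → Model n)).contDiff.comp_contDiffOn (f.2 c)
    refine (h.smul (α.2 c)).congr fun y _ => ?_
    have e : localRep c f.1 y ![] = f.1 ((chartAt (Model n) c).symm y) ![] :=
      congrArg (f.1 ((chartAt (Model n) c).symm y)) (Subsingleton.elim _ _)
    change f.1 ((chartAt (Model n) c).symm y) ![] • localRep c α.1 y =
      localRep c f.1 y ![] • localRep c α.1 y
    rw [e]⟩

variable (n X) in
/-- A symplectic form on `X`: a closed, nondegenerate smooth two-form. -/
structure SymplecticForm where
  form : Form n X 2
  closed : d form = 0
  nondeg : ∀ x, Nondeg (form.1 x)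

theorem SymplecticForm.nondeg_localRep (ω : SymplecticForm n X) (c : X) {y : Model n}
    (hy : y ∈ (chartAt (Model n) c).target) : Nondeg (localRep c ω.form.1 y) := by
  intro v hv
  have h₁ := chartDeriv_comp c hy
  have h₂ := chartSymmDeriv_comp c ((chartAt (Model n) c).map_target hy)
  rw [(chartAt (Model n) c).right_inv hy] at h₂
  have h0 : chartSymmDeriv c y v = 0 := by
    refine ω.nondeg ((chartAt (Model n) c).symm y) _ fun w => ?_
    have := hv (chartDeriv c ((chartAt (Model n) c).symm y) w)
    rw [← toBilin_apply, localRep, toBilin_pull, toBilin_apply] at this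
    rwa [← ContinuousLinearMap.comp_apply, h₂] at this
  have := congrArg (fun A : Model n →L[ℝ] Model n => A v) h₁
  simpa [h0] using this.symm

/-- The symplectic Hodge star operator `∗ : Ωᵏ(X) → Ωᵐ(X)`, where `m + k = 2 n`
(and zero for other `m` and `k`). -/
def star (ω : SymplecticForm n X) (k m : ℕ) : Form n X k →ₗ[ℝ] Form n X m where
  toFun α := ⟨fun x => starCov (ω.form.1 x) k m (α.1 x), fun c => by
    refine (contDiffOn_starCov (ω.form.2 c) (fun y hy => ω.nondeg_localRep c hy)
      (α.2 c)).congr fun y hy => ?_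
    have h₂ := chartSymmDeriv_comp c ((chartAt (Model n) c).map_target hy)
    rw [(chartAt (Model n) c).right_inv hy] at h₂
    exact (starCov_pull _ _ h₂ _ _ _ _).symm⟩
  map_add' α β := Subtype.ext (funext fun x => starCov_add _ _ _ _ _)
  map_smul' r α := Subtype.ext (funext fun x => starCov_smul _ _ _ _ _)

/-- The canonical homology operator `δ = (-1)^{p+1} ∗ d ∗ : Ωᵖ(X) → Ωᵖ⁻¹(X)`, with `p = k + 1`. -/
def δ (ω : SymplecticForm n X) (k : ℕ) : Form n X (k + 1) →ₗ[ℝ] Form n X k :=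
  (-1 : ℝ) ^ ((k + 1) + 1) •
    (star ω (2 * n - (k + 1) + 1) k ∘ₗ d ∘ₗ star ω (k + 1) (2 * n - (k + 1)))

/-- The space `Ω¹(X) / δ Ω²(X)`. -/
abbrev CanonicalQuotient (ω : SymplecticForm n X) : Type _ :=
  Form n X 1 ⧸ LinearMap.range (δ ω 1)

/-- The class of a one-form in `Ω¹(X) / δ Ω²(X)`. -/
def cls (ω : SymplecticForm n X) : Form n X 1 →ₗ[ℝ] CanonicalQuotient ω :=
  (LinearMap.range (δ ω 1)).mkQ

end Manifold

/-! ### Lie algebras given by a bilinear bracket -/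

section Lie

variable {V : Type*} [AddCommGroup V] [Module ℝ V] (B : V →ₗ[ℝ] V →ₗ[ℝ] V)
  (hself : ∀ a, B a a = 0) (hjacobi : ∀ a b c, B a (B b c) = B (B a b) c + B b (B a c))

/-- The Lie ring given by an alternating bilinear bracket with the Jacobi identity. -/
@[reducible]
def lieRingOfBracket : LieRing V where
  bracket a b := B a b
  add_lie a b c := by simp
  lie_add a b c := by simp
  lie_self := hself
  leibniz_lie := hjacobi

/-- The real Lie algebra given by an alternating bilinear bracket with the Jacobi identity. -/
@[reducible]
def lieAlgebraOfBracket : @LieAlgebra ℝ V _ (lieRingOfBracket B hself hjacobi) :=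
  letI := lieRingOfBracket B hself hjacobi
  { (inferInstance : Module ℝ V) with
    lie_smul := fun r a b => map_smul (B a) r b }

end Lie

end CanonicalHomology

end

/-! Write D = 2n for the dimension, X_g for the Hamiltonian field with i_{X_g}ω = dg, and {f, g} =
df(X_g). The bracket rests on δδ = 0 and on three formulas: δ(f dg) = {f, g}, δ(f dg ∧ dh) = {f, g}
dh - {f, h} dg - f d{g, h}, δ(hω) = -dh. Since δδ = 0, the expression [δα · dδβ] depends only on the
classes of α and β. By the third formula exact one-forms vanish in the quotient, so [f df] =
½[d(f²)] = 0 and [f dg] = -[g df]. The second formula then reads [f d{g, h}] = [{f, g} dh] + [g d{f,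
h}]. This is the Jacobi identity, because δ(δα · dδβ) = {δα, δβ} by the first formula
(`cls_jacobi`).

For perfectness, every one-form is written as a sum of products f dg, each of which is literally
equal to some δα · dδβ. Not every function is of the form δα: on a compact component such functions
have integral zero. But in a chart δ is a divergence up to a density, so mass can be moved, and a
function supported in a convex part of a chart can be contracted towards any point of it. Take a
locally finite covering by coordinate balls with a marked point in each. Then every function is δα +
v with v supported in any prescribed neighbourhood of the marked points (`exists_sub_eq_δ`).

Suppose that f vanishes on disjoint open sets V and V', each containing a family of marked points.
Choose χ vanishing on a smaller neighbourhood U of the first family and equal to 1 off V. Write f -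
v = δα with v supported in U, and χg - w = δβ with w supported in V'. Then δα · dδβ = f dg: on U
both sides vanish, since χg - w is zero there; off U we have v = 0, and near every point where f ≠ 0
the function χg - w is g (`exists_mulForm_d_eq`).

It remains to write α = ∑ f_i dg_i with each f_i vanishing near its own two families of marked
points. For N ≥ 2D a generic choice of N + 1 functions g_i has the property that any N of the
differentials span every cotangent space. This is a dimension count combined with Baire's theorem
(`exists_separating_functions`). The closed sets W_i on which f_i has to vanish are pairwise
disjoint, so near each point at most one term must be dropped. The remaining differentials provide
local coefficients, and the admissible coefficient vectors at a point form a convex set, so a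
partition of unity glues them (`exists_coefficients`). For D ≥ 2 one has D(D + 1) ≥ 2D + 1, which
gives the stated number of commutators. -/

noncomputable section

namespace CanonicalHomology

/-! ### Exterior algebra: interior products and products with covectors. -/

section ExteriorAlgebra

variable {n k m : ℕ}

/-- The coordinate functionals of the model space. -/
def coord (i : Fin (2 * n)) : Model n →L[ℝ] ℝ := EuclideanSpace.proj i

theorem coord_apply (i : Fin (2 * n)) (v : Model n) : coord i v = v i := rfl

theorem coord_stdVec (i j : Fin (2 * n)) : coord i (stdVec j) = if i = j then 1 else 0 := by
  simp [coord_apply, stdVec]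

theorem clm_eq_sum_stdVec {F : Type*} [NormedAddCommGroup F] [NormedSpace ℝ F]
    (L : Model n →L[ℝ] F) (v : Model n) : L v = ∑ i, v i • L (stdVec i) := by
  conv_lhs => rw [eq_sum_stdVec v]
  simp

/-- The constant `0`-form `c`. -/
def constForm (c : ℝ) : Cov n 0 := ContinuousAlternatingMap.constOfIsEmpty ℝ (Model n) (Fin 0) c

theorem constForm_apply (c : ℝ) (v : Fin 0 → Model n) : (constForm c : Cov n 0) v = c := rfl

theorem eq_constForm (α : Cov n 0) : α = constForm (α ![]) := by
  ext v
  exact congrArg α (Subsingleton.elim _ _)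

theorem constForm_eq_smul (c : ℝ) : (constForm c : Cov n 0) = c • constForm 1 := by
  ext v
  simp [constForm_apply]

theorem ext_intProd {α β : Cov n (k + 1)} (h : ∀ v, intProd v α = intProd v β) : α = β := by
  ext v
  rw [← Fin.cons_self_tail v, ← intProd_apply, ← intProd_apply, h]

theorem intProd_sum {ι : Type*} (s : Finset ι) (v : ι → Model n) (α : Cov n (k + 1)) :
    intProd (∑ i ∈ s, v i) α = ∑ i ∈ s, intProd (v i) α := map_sum α.curryLeft v s

theorem intProd_swap (v w : Model n) (α : Cov n (k + 2)) :
    intProd v (intProd w α) = -intProd w (intProd v α) := by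
  ext u
  have h := α.toAlternatingMap.map_swap (Fin.cons w (Fin.cons v u)) (i := 0) (j := 1) (by simp)
  simp only [intProd_apply, ContinuousAlternatingMap.neg_apply]
  change α.toAlternatingMap _ = -(α.toAlternatingMap _)
  rw [← neg_eq_iff_eq_neg, ← h]
  congr 1
  ext i
  refine Fin.cases ?_ (fun i => Fin.cases ?_ (fun i => ?_) i) i
  · simp
  · simp
  · have h1 : (i.succ.succ : Fin (k + 2)) ≠ 0 := by simp
    have h2 : (i.succ.succ : Fin (k + 2)) ≠ 1 := by
      intro h
      simp [Fin.ext_iff] at h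
    simp [Equiv.swap_apply_of_ne_of_ne h1 h2]

theorem altCLM_apply (L : Model n →L[ℝ] Cov n k) (v : Fin (k + 1) → Model n) :
    altCLM n k L v = ∑ i : Fin (k + 1), (-1) ^ (i : ℕ) • L (v i) (i.removeNth v) :=
  ContinuousAlternatingMap.alternatizeUncurryFin_apply _ _

theorem altCLM_curryCLM (α : Cov n (k + 1)) :
    altCLM n k (curryCLM n k α) = ((k : ℝ) + 1) • α := by
  refine (ContinuousAlternatingMap.alternatizeUncurryFin_curryLeft α).trans ?_
  ext v
  simp

/-- In the alternating sum the first term feeds `v` to `L` itself. The others, with signs shifted by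
one, form the alternatization of `i_v ∘ L`. For `L` of rank one this is the antiderivation rule
`intProd_covectorWedge`. -/
theorem intProd_altCLM (v : Model n) (L : Model n →L[ℝ] Cov n (k + 1)) :
    intProd v (altCLM n (k + 1) L) = L v - altCLM n k (intProd v ∘L L) := by
  ext w
  rw [intProd_apply, altCLM_apply, Fin.sum_univ_succ, ContinuousAlternatingMap.sub_apply,
    altCLM_apply, sub_eq_add_neg, ← Finset.sum_neg_distrib]
  refine congrArg₂ _ ?_ (Finset.sum_congr rfl fun i _ => ?_)
  · simp
  · simp only [ContinuousLinearMap.comp_apply, intProd_apply, Fin.cons_succ, Fin.val_succ, pow_succ]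
    have h : (i.succ.removeNth (Fin.cons v w : Fin (k + 2) → Model n)) =
        Fin.cons v (i.removeNth w) := by
      ext j
      refine Fin.cases ?_ (fun j => ?_) j
      · simp [Fin.removeNth]
      · simp [Fin.removeNth]
    rw [h]
    simp

theorem intProd_altCLM_zero (v : Model n) (L : Model n →L[ℝ] Cov n 0) :
    intProd v (altCLM n 0 L) = L v := by
  ext w
  rw [intProd_apply, altCLM_apply]
  simp

/-- The exterior product with a covector as a continuous linear map. -/
def wedgeCLM (ξ : Model n →L[ℝ] ℝ) : Cov n k →L[ℝ] Cov n (k + 1) :=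
  altCLM n k ∘L (ContinuousLinearMap.smulRightL ℝ (Model n) (Cov n k) ξ)

theorem covectorWedge_add_left (ξ ζ : Model n →L[ℝ] ℝ) (β : Cov n k) :
    covectorWedge (ξ + ζ) β = covectorWedge ξ β + covectorWedge ζ β :=
  map_add (altCLM n k ∘L (ContinuousLinearMap.smulRightL ℝ (Model n) (Cov n k)).flip β) ξ ζ

theorem covectorWedge_smul_left (c : ℝ) (ξ : Model n →L[ℝ] ℝ) (β : Cov n k) :
    covectorWedge (c • ξ) β = c • covectorWedge ξ β :=
  map_smul (altCLM n k ∘L (ContinuousLinearMap.smulRightL ℝ (Model n) (Cov n k)).flip β) c ξ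

theorem covectorWedge_neg_left (ξ : Model n →L[ℝ] ℝ) (β : Cov n k) :
    covectorWedge (-ξ) β = -covectorWedge ξ β :=
  map_neg (altCLM n k ∘L (ContinuousLinearMap.smulRightL ℝ (Model n) (Cov n k)).flip β) ξ

theorem covectorWedge_sum_left {ι : Type*} (s : Finset ι) (ξ : ι → Model n →L[ℝ] ℝ) (β : Cov n k) :
    covectorWedge (∑ i ∈ s, ξ i) β = ∑ i ∈ s, covectorWedge (ξ i) β :=
  map_sum (altCLM n k ∘L (ContinuousLinearMap.smulRightL ℝ (Model n) (Cov n k)).flip β) ξ s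

theorem covectorWedge_sub (ξ : Model n →L[ℝ] ℝ) (β γ : Cov n k) :
    covectorWedge ξ (β - γ) = covectorWedge ξ β - covectorWedge ξ γ := map_sub (wedgeCLM ξ) β γ

theorem covectorWedge_smul (c : ℝ) (ξ : Model n →L[ℝ] ℝ) (β : Cov n k) :
    covectorWedge ξ (c • β) = c • covectorWedge ξ β := map_smul (wedgeCLM ξ) c β

theorem covectorWedge_neg (ξ : Model n →L[ℝ] ℝ) (β : Cov n k) :
    covectorWedge ξ (-β) = -covectorWedge ξ β := map_neg (wedgeCLM ξ) β

theorem covectorWedge_zero (ξ : Model n →L[ℝ] ℝ) : covectorWedge ξ (0 : Cov n k) = 0 :=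
  map_zero (wedgeCLM ξ)

theorem covectorWedge_sum (ξ : Model n →L[ℝ] ℝ) {ι : Type*} (s : Finset ι) (β : ι → Cov n k) :
    covectorWedge ξ (∑ i ∈ s, β i) = ∑ i ∈ s, covectorWedge ξ (β i) := map_sum (wedgeCLM ξ) β s

theorem intProd_covectorWedge (v : Model n) (ξ : Model n →L[ℝ] ℝ) (β : Cov n (k + 1)) :
    intProd v (covectorWedge ξ β) = ξ v • β - covectorWedge ξ (intProd v β) := by
  refine (intProd_altCLM v (ξ.smulRight β)).trans ?_
  congr 1

theorem intProd_covectorWedge_zero (v : Model n) (ξ : Model n →L[ℝ] ℝ) (β : Cov n 0) :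
    intProd v (covectorWedge ξ β) = ξ v • β :=
  intProd_altCLM_zero v (ξ.smulRight β)

/-- `L` is the sum of the rank-one maps eⁱ ⊗ L(eᵢ). This turns `extDeriv` and `twoWedge` into finite
sums of products with covectors. -/
theorem altCLM_eq_sum (L : Model n →L[ℝ] Cov n k) :
    altCLM n k L = ∑ i, covectorWedge (coord i) (L (stdVec i)) := by
  have h : L = ∑ i, (coord i).smulRight (L (stdVec i)) := by
    ext1 v
    rw [clm_eq_sum_stdVec L v]
    simp [coord_apply]
  conv_lhs => rw [h, map_sum]
  rfl

/-- Euler's identity for alternating forms. -/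
theorem sum_covectorWedge_intProd (α : Cov n (k + 1)) :
    ∑ i, covectorWedge (coord i) (intProd (stdVec i) α) = ((k : ℝ) + 1) • α := by
  rw [← altCLM_curryCLM, altCLM_eq_sum]
  rfl

/-- Induction on the degree: contracting both sides with an arbitrary vector lowers the degree of
`β`. -/
theorem covectorWedge_self_swap : ∀ {k : ℕ} (ξ ζ : Model n →L[ℝ] ℝ) (β : Cov n k),
    covectorWedge ξ (covectorWedge ζ β) = -covectorWedge ζ (covectorWedge ξ β)
  | 0, ξ, ζ, β => ext_intProd fun v => by
    rw [map_neg, intProd_covectorWedge, intProd_covectorWedge, intProd_covectorWedge_zero,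
      intProd_covectorWedge_zero, covectorWedge_smul, covectorWedge_smul]
    abel
  | k + 1, ξ, ζ, β => ext_intProd fun v => by
    rw [map_neg, intProd_covectorWedge, intProd_covectorWedge, intProd_covectorWedge,
      intProd_covectorWedge, covectorWedge_sub, covectorWedge_sub, covectorWedge_smul,
      covectorWedge_smul, covectorWedge_self_swap ξ ζ (intProd v β)]
    abel

/-- The dual Euler identity. -/
theorem sum_intProd_covectorWedge (α : Cov n k) :
    ∑ i, intProd (stdVec i) (covectorWedge (coord i) α) = ((2 * n : ℝ) - k) • α := by
  cases k with
  | zero =>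
    simp only [intProd_covectorWedge_zero, coord_stdVec]
    rw [← Finset.sum_smul]
    simp
  | succ k =>
    simp only [intProd_covectorWedge, coord_stdVec, Finset.sum_sub_distrib,
      sum_covectorWedge_intProd]
    rw [← Finset.sum_smul, ← sub_smul]
    simp

theorem eq_zero_of_lt (h : 2 * n < k) (α : Cov n k) : α = 0 := by
  ext v
  refine α.toAlternatingMap.map_linearDependent v fun hv => ?_
  have := hv.fintype_card_le_finrank
  simp at this
  omega

/-- A form of degree `2n - 1` is determined by its products with covectors. -/
theorem eq_zero_of_covectorWedge_eq_zero (hk : k ≠ 2 * n) {α : Cov n k}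
    (h : ∀ ξ : Model n →L[ℝ] ℝ, covectorWedge ξ α = 0) : α = 0 := by
  have := sum_intProd_covectorWedge α
  simp only [h, map_zero, Finset.sum_const_zero] at this
  refine (smul_eq_zero.1 this.symm).resolve_left ?_
  -- The factor 2n - k of the dual Euler identity vanishes only in top degree.
  rw [← ne_eq, sub_ne_zero]
  exact_mod_cast hk.symm

theorem exists_eq_smul_of_top (hk : k = 2 * n) {η : Cov n k} (hη : η ≠ 0) (α : Cov n k) :
    ∃ c : ℝ, α = c • η := by
  subst hk
  set b := (EuclideanSpace.basisFun (Fin (2 * n)) ℝ).toBasis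
  have h₁ := AlternatingMap.eq_smul_basis_det b α.toAlternatingMap
  have h₂ := AlternatingMap.eq_smul_basis_det b η.toAlternatingMap
  have h0 : η.toAlternatingMap b ≠ 0 := fun h => hη <| by
    ext v
    have := congrArg (fun f => f v) h₂
    simpa [h] using this
  refine ⟨α.toAlternatingMap b / η.toAlternatingMap b, ?_⟩
  ext v
  have e₁ := congrArg (fun f => f v) h₁
  have e₂ := congrArg (fun f => f v) h₂
  simp only [AlternatingMap.smul_apply, smul_eq_mul] at e₁ e₂
  change α.toAlternatingMap v = _ * η.toAlternatingMap v
  rw [e₁, e₂]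
  field_simp

/-! ### Two-forms and the powers of a two-form -/

theorem toBilin_swap (ω : Cov n 2) (v w : Model n) : toBilin ω v w = -toBilin ω w v := by
  rw [toBilin_apply, toBilin_apply]
  exact congrArg (fun α : Cov n 0 => α ![]) (intProd_swap w v ω)

theorem intProd_two (ω : Cov n 2) (v : Model n) :
    intProd v ω = covectorWedge (toBilin ω v) (constForm 1) := by
  ext w
  rw [covectorWedge_apply, intProd_apply]
  simp only [Nat.reduceAdd, Finset.univ_unique, Fin.default_eq_zero, Finset.sum_singleton,
    toBilin_apply, constForm_apply, Fin.val_zero, pow_zero, one_mul, mul_one]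
  refine congrArg ω (funext fun i => ?_)
  fin_cases i <;> rfl

theorem twoWedge_eq_sum (ω : Cov n 2) (β : Cov n k) :
    twoWedge ω β = (2⁻¹ : ℝ) •
      ∑ i, covectorWedge (coord i) (covectorWedge (toBilin ω (stdVec i)) β) := by
  rw [twoWedge, altCLM_eq_sum]
  rfl

theorem covector_eq_sum (ξ : Model n →L[ℝ] ℝ) : ξ = ∑ i, ξ (stdVec i) • coord i := by
  ext v
  rw [clm_eq_sum_stdVec ξ v]
  simp [coord_apply, mul_comm]

theorem sum_toBilin_smul_coord (ω : Cov n 2) (v : Model n) :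
    ∑ i, toBilin ω (stdVec i) v • coord i = -toBilin ω v := by
  conv_rhs => rw [covector_eq_sum (toBilin ω v)]
  rw [← Finset.sum_neg_distrib]
  refine Finset.sum_congr rfl fun i _ => ?_
  rw [toBilin_swap]
  exact neg_smul (toBilin ω v (stdVec i)) (coord i)

/-- The term i_vω ∧ β arises twice, from contracting eⁱ and, by antisymmetry of ω, from contracting
the second covector. The factor ½ in `twoWedge` compensates. -/
theorem intProd_twoWedge (ω : Cov n 2) (v : Model n) (β : Cov n (k + 1)) :
    intProd v (twoWedge ω β) = covectorWedge (toBilin ω v) β + twoWedge ω (intProd v β) := by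
  simp only [twoWedge_eq_sum, map_smul, map_sum, intProd_covectorWedge, covectorWedge_sub,
    covectorWedge_smul, Finset.sum_sub_distrib, ← covectorWedge_smul_left]
  simp only [← covectorWedge_sum_left, sum_toBilin_smul_coord, coord_apply, ← map_smul,
    ← map_sum, ← eq_sum_stdVec, covectorWedge_neg_left]
  module

theorem intProd_twoWedge_zero (ω : Cov n 2) (v : Model n) (β : Cov n 0) :
    intProd v (twoWedge ω β) = covectorWedge (toBilin ω v) β := by
  simp only [twoWedge_eq_sum, map_smul, map_sum, intProd_covectorWedge,
    covectorWedge_smul, Finset.sum_sub_distrib, ← covectorWedge_smul_left,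
    intProd_covectorWedge_zero]
  simp only [← covectorWedge_sum_left, sum_toBilin_smul_coord, coord_apply, ← map_smul,
    ← map_sum, ← eq_sum_stdVec, covectorWedge_neg_left]
  module

theorem twoWedge_covectorWedge (ω : Cov n 2) (ξ : Model n →L[ℝ] ℝ) (β : Cov n k) :
    twoWedge ω (covectorWedge ξ β) = covectorWedge ξ (twoWedge ω β) := by
  simp only [twoWedge_eq_sum, covectorWedge_smul, covectorWedge_sum]
  congr 1
  refine Finset.sum_congr rfl fun i _ => ?_
  rw [covectorWedge_self_swap _ ξ β, covectorWedge_neg, covectorWedge_self_swap _ ξ, neg_neg]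

/-- This is i_v(ωʲ/j!) = i_vω ∧ ωʲ⁻¹/(j-1)!; the factor 2/(p + 2) in `expForm` is 1/j for p + 2 =
2j. With v = ξ♯ it says that contracting e^ω with ξ♯ is multiplying it by ξ, and all values of the
star operator below come from this. -/
theorem intProd_expForm (ω : Cov n 2) (v : Model n) : ∀ p : ℕ,
    intProd v (expForm ω (p + 2)) = covectorWedge (toBilin ω v) (expForm ω p)
  | 0 => by simp [expForm, intProd_twoWedge_zero]
  | 1 => by simp [expForm, covectorWedge_zero, twoWedge_eq_sum]
  | p + 2 => by
    have h0 : ((p : ℝ) + 2) ≠ 0 := by positivity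
    have h1 : ((p : ℝ) + 2 + 2) ≠ 0 := by positivity
    have h : twoWedge ω (expForm ω p) = (((p : ℝ) + 2) / 2) • expForm ω (p + 2) := by
      rw [expForm, smul_smul, div_mul_div_cancel₀ (by norm_num), div_self h0, one_smul]
    rw [expForm, map_smul, intProd_twoWedge, intProd_expForm ω v p, twoWedge_covectorWedge, h,
      covectorWedge_smul]
    push_cast
    match_scalars
    field_simp
    ring

end ExteriorAlgebra

/-! ### The symplectic star operator through the vectors dual to covectors. -/

section Star

variable {n k m : ℕ}

/-- The vector `ξ♯` dual to a covector with respect to a two-form: for nondegenerate `ω`, it is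
characterized by `i_{ξ♯} ω = ξ`. -/
def sharp (ω : Cov n 2) (ξ : Model n →L[ℝ] ℝ) : Model n :=
  ∑ i, ∑ j, ((formMatrix ω)⁻¹ i j * ξ (stdVec i)) • stdVec j

theorem toBilin_sharp {ω : Cov n 2} (h : Nondeg ω) (ξ : Model n →L[ℝ] ℝ) :
    toBilin ω (sharp ω ξ) = ξ := by
  have hM : (formMatrix ω)⁻¹ * formMatrix ω = 1 :=
    Matrix.nonsing_inv_mul _ (isUnit_iff_ne_zero.2 h.det_ne_zero)
  have key : ∀ k, toBilin ω (sharp ω ξ) (stdVec k) = ξ (stdVec k) := by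
    intro k
    simp only [sharp, map_sum, map_smul, sum_apply, smul_apply, smul_eq_mul]
    have e : ∀ i, ∑ j, (formMatrix ω)⁻¹ i j * ξ (stdVec i) * toBilin ω (stdVec j) (stdVec k) =
        ξ (stdVec i) * ((formMatrix ω)⁻¹ * formMatrix ω) i k := by
      intro i
      rw [Matrix.mul_apply, Finset.mul_sum]
      refine Finset.sum_congr rfl fun j _ => ?_
      rw [toBilin_apply, formMatrix, Matrix.of_apply]
      ring
    simp only [e, hM, Matrix.one_apply]
    simp
  ext v
  rw [clm_eq_sum_stdVec _ v, clm_eq_sum_stdVec ξ v]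
  simp only [key]

theorem Nondeg.toBilin_injective {ω : Cov n 2} (h : Nondeg ω) {v w : Model n}
    (hvw : toBilin ω v = toBilin ω w) : v = w := by
  rw [← sub_eq_zero]
  refine h _ fun u => ?_
  rw [← toBilin_apply, map_sub, hvw, sub_self]
  rfl

theorem sharp_toBilin {ω : Cov n 2} (h : Nondeg ω) (v : Model n) : sharp ω (toBilin ω v) = v :=
  h.toBilin_injective (toBilin_sharp h _)

theorem contraction_neg_right (P : Matrix (Fin (2 * n)) (Fin (2 * n)) ℝ) (k : ℕ) (α : Cov n k)
    (η : Cov n (m + k)) : contraction P k α (-η) = -contraction P k α η :=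
  map_neg (AddMonoidHom.mk' (fun η : Cov n (m + k) => contraction P k α η)
    (fun _ _ => contraction_add_right _ _ _ _ _)) η

/-- The contraction of a product with a covector. -/
theorem contraction_covectorWedge (ω : Cov n 2) (ξ : Model n →L[ℝ] ℝ) :
    ∀ (k : ℕ) (α : Cov n k) (η : Cov n (m + (k + 1))),
      contraction (formMatrix ω)⁻¹ (k + 1) (covectorWedge ξ α) η =
        contraction (formMatrix ω)⁻¹ k α (intProd (sharp ω ξ) (k := m + k) η)
  | 0, α, η => by
    have h : intProd (sharp ω ξ) (k := m + 0) η =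
        ∑ i, ∑ j, ((formMatrix ω)⁻¹ i j * ξ (stdVec i)) • intProd (stdVec j) (k := m + 0) η := by
      simp only [sharp, intProd_sum, intProd_smul]
    simp only [contraction, intProd_covectorWedge_zero, h]
    simp [Finset.smul_sum, smul_smul, mul_assoc, mul_comm, mul_left_comm]
  | k + 1, α, η => by
    have h : intProd (sharp ω ξ) (k := m + (k + 1)) η = ∑ i, ∑ j,
        ((formMatrix ω)⁻¹ i j * ξ (stdVec i)) • intProd (stdVec j) (k := m + (k + 1)) η := by
      simp only [sharp, intProd_sum, intProd_smul]
    have hadd : ∀ (s : Finset (Fin (2 * n))) (f : Fin (2 * n) → Cov n (m + (k + 1))),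
        contraction (formMatrix ω)⁻¹ (k + 1) α (∑ i ∈ s, f i) =
          ∑ i ∈ s, contraction (formMatrix ω)⁻¹ (k + 1) α (f i) := fun s f =>
      map_sum (AddMonoidHom.mk' (fun η : Cov n (m + (k + 1)) =>
        contraction (m := m) (formMatrix ω)⁻¹ (k + 1) α η)
        (fun a b => contraction_add_right _ _ _ _ _)) f s
    -- The antiderivation rule splits the recursion in two. Here the basis vector meets ξ, which
    -- assembles ξ♯.
    have e₁ : ∑ i, ∑ j, (formMatrix ω)⁻¹ i j • contraction (formMatrix ω)⁻¹ (k + 1)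
        (ξ (stdVec i) • α) (intProd (stdVec j) (k := m + (k + 1)) η) =
        contraction (formMatrix ω)⁻¹ (k + 1) α (intProd (sharp ω ξ) (k := m + (k + 1)) η) := by
      rw [h, hadd]
      refine Finset.sum_congr rfl fun i _ => ?_
      rw [hadd]
      refine Finset.sum_congr rfl fun j _ => ?_
      rw [contraction_smul_left, contraction_smul_right, smul_smul]
    -- Here it meets α: the induction hypothesis applies, and exchanging ξ♯ with e_j costs a sign.
    -- The total factor 1 + (k + 1) cancels the normalization 1/(k + 2).
    have e₂ : ∑ i, ∑ j, (formMatrix ω)⁻¹ i j • contraction (formMatrix ω)⁻¹ (k + 1)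
        (covectorWedge ξ (intProd (stdVec i) α)) (intProd (stdVec j) (k := m + (k + 1)) η) =
        -(((k : ℝ) + 1) • contraction (formMatrix ω)⁻¹ (k + 1) α
          (intProd (sharp ω ξ) (k := m + (k + 1)) η)) := by
      rw [contraction, smul_smul, mul_inv_cancel₀ (by positivity), one_smul,
        ← Finset.sum_neg_distrib]
      refine Finset.sum_congr rfl fun i _ => ?_
      rw [← Finset.sum_neg_distrib]
      refine Finset.sum_congr rfl fun j _ => ?_
      rw [contraction_covectorWedge ω ξ k]
      refine Eq.trans ?_ (smul_neg _ _)
      congr 1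
      have := intProd_swap (sharp ω ξ) (stdVec j) (k := m + k) η
      refine (congrArg (contraction (formMatrix ω)⁻¹ k (intProd (stdVec i) α)) this).trans ?_
      exact contraction_neg_right (m := m) (formMatrix ω)⁻¹ k (intProd (stdVec i) α)
        (intProd (stdVec j) (k := m + k) (intProd (sharp ω ξ) (k := m + (k + 1)) η))
    have hsub : ∀ (a b : Cov n (k + 1)) (θ : Cov n (m + (k + 1))),
        contraction (formMatrix ω)⁻¹ (k + 1) (a - b) θ =
        contraction (formMatrix ω)⁻¹ (k + 1) a θ - contraction (formMatrix ω)⁻¹ (k + 1) b θ :=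
      fun a b θ => map_sub (AddMonoidHom.mk' (fun α : Cov n (k + 1) =>
        contraction (m := m) (formMatrix ω)⁻¹ (k + 1) α θ)
        (fun a b => contraction_add_left _ _ _ _ _)) a b
    rw [contraction]
    simp only [intProd_covectorWedge, hsub, smul_sub, Finset.sum_sub_distrib]
    rw [← smul_sub, e₁, e₂]
    push_cast
    have h0 : ((k : ℝ) + 1 + 1) ≠ 0 := by positivity
    match_scalars
    field_simp
    ring

/-- Contraction of a form with the bivector dual to `ω`, up to normalization. -/
def lambdaOp (ω : Cov n 2) (η : Cov n (k + 2)) : Cov n k :=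
  ∑ i, intProd (stdVec i) (intProd (sharp ω (coord i)) η)

/-- Contraction with (eⁱ)♯ multiplies by eⁱ, so the sum is the one in the dual Euler identity. -/
theorem lambdaOp_expForm {ω : Cov n 2} (h : Nondeg ω) (p : ℕ) :
    lambdaOp ω (expForm ω (p + 2)) = ((2 * n : ℝ) - p) • expForm ω p := by
  simp only [lambdaOp, intProd_expForm, toBilin_sharp h, sum_intProd_covectorWedge]

theorem lambdaOp_intProd (ω : Cov n 2) (v : Model n) (η : Cov n (k + 3)) :
    lambdaOp ω (intProd v η) = intProd v (lambdaOp ω η) := by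
  simp only [lambdaOp, map_sum]
  refine Finset.sum_congr rfl fun i _ => ?_
  rw [intProd_swap _ v η, map_neg, intProd_swap _ v, neg_neg]

/-- Two applications of `contraction_covectorWedge`, where the covector i_{eᵢ}ω is turned back into
eᵢ by `sharp`. Contraction with a power of ω thus becomes an iterate of `lambdaOp`. -/
theorem contraction_twoWedge {ω : Cov n 2} (h : Nondeg ω) (k : ℕ) (α : Cov n k)
    (η : Cov n (m + (k + 2))) :
    contraction (formMatrix ω)⁻¹ (k + 2) (twoWedge ω α) η =
      (2⁻¹ : ℝ) • contraction (formMatrix ω)⁻¹ k α (lambdaOp ω (k := m + k) η) := by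
  have hadd : ∀ f : Fin (2 * n) → Cov n (k + 2),
      contraction (formMatrix ω)⁻¹ (k + 2) (∑ i, f i) η =
        ∑ i, contraction (formMatrix ω)⁻¹ (k + 2) (f i) η := fun f =>
    map_sum (AddMonoidHom.mk' (fun α : Cov n (k + 2) =>
      contraction (m := m) (formMatrix ω)⁻¹ (k + 2) α η)
      (fun a b => contraction_add_left _ _ _ _ _)) f _
  have hadd' : ∀ f : Fin (2 * n) → Cov n (m + k),
      contraction (formMatrix ω)⁻¹ k α (∑ i, f i) =
        ∑ i, contraction (formMatrix ω)⁻¹ k α (f i) := fun f =>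
    map_sum (AddMonoidHom.mk' (fun η : Cov n (m + k) =>
      contraction (m := m) (formMatrix ω)⁻¹ k α η)
      (fun a b => contraction_add_right _ _ _ _ _)) f _
  rw [twoWedge_eq_sum, contraction_smul_left, hadd, lambdaOp, hadd']
  congr 1
  refine Finset.sum_congr rfl fun i _ => ?_
  rw [contraction_covectorWedge ω (coord i) (k + 1), contraction_covectorWedge,
    sharp_toBilin h]

theorem contraction_expForm_succ {ω : Cov n 2} (h : Nondeg ω) (j : ℕ)
    (η : Cov n (m + (2 * j + 2))) :
    contraction (formMatrix ω)⁻¹ (2 * j + 2) (expForm ω (2 * j + 2)) η =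
      (2 * (j : ℝ) + 2)⁻¹ • contraction (formMatrix ω)⁻¹ (2 * j) (expForm ω (2 * j))
        (lambdaOp ω (k := m + 2 * j) η) := by
  rw [expForm, contraction_smul_left, contraction_twoWedge h, smul_smul]
  congr 1
  push_cast
  have h0 : (2 * (j : ℝ) + 2) ≠ 0 := by positivity
  field_simp

/-- Each step contributes (2n - 2j)/(2j + 2) = (n - j)/(j + 1), the ratio of successive binomial
coefficients. The case j = n is ∗(ωⁿ/n!) = 1. -/
theorem contraction_expForm_expForm {ω : Cov n 2} (h : Nondeg ω) : ∀ j : ℕ,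
    contraction (formMatrix ω)⁻¹ (2 * j) (expForm ω (2 * j)) (expForm ω (0 + 2 * j)) =
      (n.choose j : ℝ) • constForm 1
  | 0 => by
    change expForm ω 0 ![] • expForm ω 0 = _
    simp only [Nat.choose_zero_right, Nat.cast_one]
    rfl
  | j + 1 => by
    have := contraction_expForm_succ (m := 0) h j (expForm ω (0 + 2 * j + 2))
    refine this.trans ?_
    rw [lambdaOp_expForm h, contraction_smul_right, contraction_expForm_expForm h j, smul_smul,
      smul_smul]
    congr 1
    have hc : (n.choose (j + 1) : ℝ) * (j + 1) = n.choose j * ((n : ℝ) - j) := by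
      rcases le_or_gt j n with hj | hj
      · have := Nat.choose_succ_right_eq n j
        rw [← Nat.cast_sub hj]
        exact_mod_cast this
      · rw [Nat.choose_eq_zero_of_lt hj, Nat.choose_eq_zero_of_lt (by omega)]
        simp
    have h0 : (2 * (j : ℝ) + 2) ≠ 0 := by positivity
    push_cast
    field_simp
    linear_combination (-2) * hc

/-- `lambdaOp` commutes with interior products, so the recursion is the same. In dimension 2n + 2
with a remaining degree of 1 the ratio is again (n - j)/(j + 1), and j = n gives ∗ in degree 2n + 1.
-/
theorem contraction_expForm_intProd {ω : Cov (n + 1) 2} (h : Nondeg ω) (v : Model (n + 1)) :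
    ∀ j : ℕ, contraction (formMatrix ω)⁻¹ (2 * j) (expForm ω (2 * j))
      (intProd v (expForm ω (1 + 2 * j + 1))) =
      (n.choose j : ℝ) • covectorWedge (toBilin ω v) (constForm 1)
  | 0 => by
    change expForm ω 0 ![] • intProd v (expForm ω 2) = _
    rw [intProd_expForm]
    simp only [Nat.choose_zero_right, Nat.cast_one]
    rfl
  | j + 1 => by
    have := contraction_expForm_succ (m := 1) h j (intProd v (expForm ω (1 + 2 * j + 1 + 2)))
    refine this.trans ?_
    rw [lambdaOp_intProd, lambdaOp_expForm h, map_smul, contraction_smul_right,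
      contraction_expForm_intProd h v j, smul_smul, smul_smul]
    congr 1
    have hc : (n.choose (j + 1) : ℝ) * (j + 1) = n.choose j * ((n : ℝ) - j) := by
      rcases le_or_gt j n with hj | hj
      · have := Nat.choose_succ_right_eq n j
        rw [← Nat.cast_sub hj]
        exact_mod_cast this
      · rw [Nat.choose_eq_zero_of_lt hj, Nat.choose_eq_zero_of_lt (by omega)]
        simp
    have h0 : (2 * (j : ℝ) + 2) ≠ 0 := by positivity
    push_cast
    field_simp
    linear_combination (-2) * hc

/-! ### The star operator in degrees `1`, `2`, `2n - 1` and `2n` -/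

theorem starCov_one {ω : Cov (n + 1) 2} (ξ : Model (n + 1) →L[ℝ] ℝ) :
    starCov ω 1 (2 * n + 1) (covectorWedge ξ (constForm 1)) =
      intProd (sharp ω ξ) (expForm ω (2 * n + 2)) := by
  rw [starCov, if_pos (by ring)]
  refine (contraction_covectorWedge (m := 2 * n + 1) ω ξ 0 (constForm 1) _).trans ?_
  exact one_smul ℝ _

theorem starCov_two {ω : Cov (n + 1) 2} (ξ ζ : Model (n + 1) →L[ℝ] ℝ) :
    starCov ω 2 (2 * n) (covectorWedge ξ (covectorWedge ζ (constForm 1))) =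
      intProd (sharp ω ζ) (intProd (sharp ω ξ) (expForm ω (2 * n + 2))) := by
  rw [starCov, if_pos (by ring)]
  refine (contraction_covectorWedge (m := 2 * n) ω ξ 1 _ _).trans ?_
  refine (contraction_covectorWedge (m := 2 * n) ω ζ 0 (constForm 1) _).trans ?_
  exact one_smul ℝ _

/-- Contraction with ω is half of `lambdaOp`, whose factor on the top power is 2(n + 1) - 2n = 2.
Through this identity exact one-forms lie in the image of δ. -/
theorem starCov_self {ω : Cov (n + 1) 2} (h : Nondeg ω) :
    starCov ω 2 (2 * n) ω = expForm ω (2 * n) := by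
  have e : ω = twoWedge ω (constForm 1) := ext_intProd fun v => by
    rw [intProd_twoWedge_zero, intProd_two]
  rw [starCov, if_pos (by ring)]
  -- Only the argument becomes ω ∧ 1; the form that defines the star operator is left alone.
  conv_lhs => 
    arg 3
    rw [e]
  refine (contraction_twoWedge (m := 2 * n) h 0 (constForm 1) _).trans ?_
  have := lambdaOp_expForm h (2 * n)
  refine (congrArg (fun θ => (2⁻¹ : ℝ) • (1 : ℝ) • θ) this).trans ?_
  rw [one_smul, smul_smul]
  push_cast
  match_scalars
  ring

theorem starCov_top {ω : Cov (n + 1) 2} (h : Nondeg ω) :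
    starCov ω (2 * n + 2) 0 (expForm ω (2 * n + 2)) = constForm 1 := by
  rw [starCov, if_pos (by ring)]
  refine (contraction_expForm_expForm h (n + 1)).trans ?_
  simp

theorem starCov_intProd_top {ω : Cov (n + 1) 2} (h : Nondeg ω) (v : Model (n + 1)) :
    starCov ω (2 * n + 1) 1 (intProd v (expForm ω (2 * n + 2))) = intProd v ω := by
  rw [starCov, if_pos (by ring), intProd_expForm]
  refine (contraction_covectorWedge (m := 1) ω (toBilin ω v) (2 * n) _ _).trans ?_
  rw [sharp_toBilin h]
  refine (contraction_expForm_intProd h v n).trans ?_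
  rw [Nat.choose_self, Nat.cast_one, one_smul, intProd_two]

theorem expForm_top_ne_zero {ω : Cov (n + 1) 2} (h : Nondeg ω) : expForm ω (2 * n + 2) ≠ 0 := by
  intro h0
  have h1 := starCov_top h
  rw [h0] at h1
  have h2 := starCov_smul ω (2 * n + 2) 0 0 0
  rw [zero_smul, zero_smul, h1] at h2
  have := congrArg (fun α : Cov (n + 1) 0 => α ![]) h2
  simp [constForm_apply] at this

/-- The product ξ ∧ η exceeds the top degree, so the antiderivation rule applied to it leaves just
these two terms. -/
theorem covectorWedge_intProd_of_top (hk : k + 1 = 2 * n) (ξ : Model n →L[ℝ] ℝ) (v : Model n)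
    (η : Cov n (k + 1)) : covectorWedge ξ (intProd v η) = ξ v • η := by
  have := intProd_covectorWedge v ξ η
  rw [eq_zero_of_lt (by omega) (covectorWedge ξ η), map_zero] at this
  exact (sub_eq_zero.1 this.symm).symm

/-- The components of `v` are the coefficients of eⁱ ∧ ζ with respect to the volume form; products
with covectors detect forms in this degree. -/
theorem exists_eq_intProd_top {ω : Cov (n + 1) 2} (h : Nondeg ω) (ζ : Cov (n + 1) (2 * n + 1)) :
    ∃ v, ζ = intProd v (expForm ω (2 * n + 2)) := by
  choose c hc using fun i => exists_eq_smul_of_top (k := 2 * n + 2) (by ring)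
    (expForm_top_ne_zero h) (covectorWedge (coord i) ζ)
  refine ⟨∑ i, c i • stdVec i, ?_⟩
  rw [← sub_eq_zero]
  refine eq_zero_of_covectorWedge_eq_zero (by omega) fun ξ => ?_
  rw [covectorWedge_sub, covectorWedge_intProd_of_top (by ring), covector_eq_sum ξ,
    covectorWedge_sum_left, sub_eq_zero]
  simp only [covectorWedge_smul_left, hc, smul_smul, ← Finset.sum_smul]
  congr 1
  simp [coord_apply, stdVec, mul_comm]

theorem starCov_starCov {ω : Cov (n + 1) 2} (h : Nondeg ω) (ζ : Cov (n + 1) (2 * n + 1)) :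
    starCov ω 1 (2 * n + 1) (starCov ω (2 * n + 1) 1 ζ) = ζ := by
  obtain ⟨v, rfl⟩ := exists_eq_intProd_top h ζ
  rw [starCov_intProd_top h, intProd_two, starCov_one, sharp_toBilin h]

end Star

/-! ### Exterior calculus and Hamiltonian fields on open sets of the model space. -/

section LocalCalculus

variable {n k m : ℕ}

/-- The smoothness exponent `C^∞`. -/
abbrev smoothExp : WithTop ℕ∞ := ((⊤ : ℕ∞) : WithTop ℕ∞)

theorem extDeriv_eq_sum (β : Model n → Cov n k) (y : Model n) :
    extDeriv β y = ∑ i, covectorWedge (coord i) (fderiv ℝ β y (stdVec i)) :=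
  altCLM_eq_sum (fderiv ℝ β y)

theorem extDeriv_smul_fun {f : Model n → ℝ} {β : Model n → Cov n k} {y : Model n}
    (hf : DifferentiableAt ℝ f y) (hβ : DifferentiableAt ℝ β y) :
    extDeriv (fun z => f z • β z) y =
      covectorWedge (fderiv ℝ f y) (β y) + f y • extDeriv β y := by
  change altCLM n k (fderiv ℝ (fun z => f z • β z) y) = _
  rw [fderiv_fun_smul hf hβ, map_add, map_smul]
  exact add_comm _ _

theorem extDeriv_covectorWedge_const (ξ : Model n →L[ℝ] ℝ) {β : Model n → Cov n k} {y : Model n}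
    (hβ : DifferentiableAt ℝ β y) :
    extDeriv (fun z => covectorWedge ξ (β z)) y = -covectorWedge ξ (extDeriv β y) := by
  have h : fderiv ℝ (fun z => covectorWedge ξ (β z)) y = wedgeCLM ξ ∘L fderiv ℝ β y :=
    (wedgeCLM ξ).hasFDerivAt.comp y hβ.hasFDerivAt |>.fderiv
  rw [extDeriv_eq_sum, extDeriv_eq_sum, h, covectorWedge_sum, ← Finset.sum_neg_distrib]
  refine Finset.sum_congr rfl fun i _ => ?_
  exact covectorWedge_self_swap _ _ _

theorem extDeriv_sum {ι : Type*} {s : Finset ι} {β : ι → Model n → Cov n k} {y : Model n}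
    (hβ : ∀ i ∈ s, DifferentiableAt ℝ (β i) y) :
    extDeriv (fun z => ∑ i ∈ s, β i z) y = ∑ i ∈ s, extDeriv (β i) y := by
  change altCLM n k (fderiv ℝ (fun z => ∑ i ∈ s, β i z) y) = _
  rw [fderiv_fun_sum hβ, map_sum]
  rfl

theorem twoWedge_eq_sum_sum (ω : Cov n 2) (β : Cov n k) :
    twoWedge ω β = (2⁻¹ : ℝ) • ∑ i, ∑ j, ω ![stdVec i, stdVec j] •
      covectorWedge (coord i) (covectorWedge (coord j) β) := by
  rw [twoWedge_eq_sum]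
  congr 1
  refine Finset.sum_congr rfl fun i _ => ?_
  rw [covector_eq_sum (toBilin ω (stdVec i)), covectorWedge_sum_left, covectorWedge_sum]
  refine Finset.sum_congr rfl fun j _ => ?_
  rw [covectorWedge_smul_left, covectorWedge_smul, toBilin_apply]

/-- Adding the three cyclic relabelings of the sum S gives 3S = 0. With a = ∂_l ω_{ij} the
hypothesis is the closedness of ω. -/
theorem sum_cyclic_eq_zero {ι V : Type*} [Fintype ι] [AddCommGroup V] [Module ℝ V]
    (a : ι → ι → ι → ℝ) (w : ι → ι → ι → V) (ha : ∀ i j k, a i j k + a j k i + a k i j = 0)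
    (hw : ∀ i j k, w i j k = w j k i) : ∑ i, ∑ j, ∑ k, a i j k • w i j k = 0 := by
  set S := ∑ i, ∑ j, ∑ k, a i j k • w i j k with hS
  have h₁ : S = ∑ i, ∑ j, ∑ k, a j k i • w i j k := by
    rw [hS]
    calc _ = ∑ j, ∑ k, ∑ i, a j k i • w i j k := by
          refine Finset.sum_congr rfl fun j _ => Finset.sum_congr rfl fun k _ =>
            Finset.sum_congr rfl fun i _ => ?_
          rw [hw i j k]
      _ = ∑ j, ∑ i, ∑ k, a j k i • w i j k := Finset.sum_congr rfl fun j _ => Finset.sum_comm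
      _ = _ := Finset.sum_comm
  have h₂ : S = ∑ i, ∑ j, ∑ k, a k i j • w i j k := by
    rw [hS]
    calc _ = ∑ k, ∑ i, ∑ j, a k i j • w i j k := by
          refine Finset.sum_congr rfl fun k _ => Finset.sum_congr rfl fun i _ =>
            Finset.sum_congr rfl fun j _ => ?_
          rw [hw k i j]
      _ = ∑ i, ∑ k, ∑ j, a k i j • w i j k := Finset.sum_comm
      _ = _ := Finset.sum_congr rfl fun i _ => Finset.sum_comm
  have h : S + S + S = 0 := by
    conv_lhs => 
      arg 2
      rw [h₂]
    conv_lhs => 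
      arg 1
      arg 2
      rw [h₁]
    rw [hS]
    simp only [← Finset.sum_add_distrib, ← add_smul, ha, zero_smul, Finset.sum_const_zero]
  have h3 : (3 : ℝ) • S = 0 := by
    rw [← h]
    module
  exact (smul_eq_zero.1 h3).resolve_left (by norm_num)

theorem hasFDerivAt_form_apply {β : Model n → Cov n k} {y : Model n}
    (hβ : DifferentiableAt ℝ β y) (v : Fin k → Model n) :
    HasFDerivAt (fun z => β z v) (ContinuousAlternatingMap.apply ℝ (Model n) ℝ v ∘L fderiv ℝ β y)
      y :=
  (ContinuousAlternatingMap.apply ℝ (Model n) ℝ v).hasFDerivAt.comp y hβ.hasFDerivAt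

/-- By the Leibniz rule only the terms ∂_l ω_{ij} eˡ ∧ eⁱ ∧ eʲ ∧ β have to vanish in the sum. The
product of covectors is invariant under cyclic permutations, and closedness kills the cyclic sum of
the coefficients. -/
theorem extDeriv_twoWedge {ω : Model n → Cov n 2} {β : Model n → Cov n k} {y : Model n}
    (hω : DifferentiableAt ℝ ω y) (hβ : DifferentiableAt ℝ β y) (hd : extDeriv ω y = 0) :
    extDeriv (fun z => twoWedge (ω z) (β z)) y = twoWedge (ω y) (extDeriv β y) := by
  have hwβ : ∀ ξ : Model n →L[ℝ] ℝ, ∀ {k : ℕ} {γ : Model n → Cov n k}, DifferentiableAt ℝ γ y →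
      DifferentiableAt ℝ (fun z => covectorWedge ξ (γ z)) y := fun ξ k γ hγ =>
    (wedgeCLM ξ).differentiableAt.comp y hγ
  have hc : ∀ i j, DifferentiableAt ℝ (fun z => ω z ![stdVec i, stdVec j]) y := fun i j =>
    (hasFDerivAt_form_apply hω _).differentiableAt
  have hterm : ∀ i j, DifferentiableAt ℝ (fun z => ω z ![stdVec i, stdVec j] •
      covectorWedge (coord i) (covectorWedge (coord j) (β z))) y := fun i j =>
    (hc i j).smul (hwβ _ (hwβ _ hβ))
  simp only [twoWedge_eq_sum_sum]
  have e : extDeriv (fun z => (2⁻¹ : ℝ) • ∑ i, ∑ j, ω z ![stdVec i, stdVec j] •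
      covectorWedge (coord i) (covectorWedge (coord j) (β z))) y =
      (2⁻¹ : ℝ) • extDeriv (fun z => ∑ i, ∑ j, ω z ![stdVec i, stdVec j] •
      covectorWedge (coord i) (covectorWedge (coord j) (β z))) y := extDeriv_smul _ _
  rw [e, extDeriv_sum fun i _ => DifferentiableAt.fun_sum fun j _ => hterm i j]
  congr 1
  have e₂ : ∀ i, extDeriv (fun z => ∑ j, ω z ![stdVec i, stdVec j] •
      covectorWedge (coord i) (covectorWedge (coord j) (β z))) y =
      ∑ j, (covectorWedge (fderiv ℝ (fun z => ω z ![stdVec i, stdVec j]) y)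
        (covectorWedge (coord i) (covectorWedge (coord j) (β y))) +
        ω y ![stdVec i, stdVec j] •
          covectorWedge (coord i) (covectorWedge (coord j) (extDeriv β y))) := by
    intro i
    rw [extDeriv_sum fun j _ => hterm i j]
    refine Finset.sum_congr rfl fun j _ => ?_
    rw [extDeriv_smul_fun (hc i j) (hwβ _ (hwβ _ hβ)),
      extDeriv_covectorWedge_const _ (hwβ _ hβ), extDeriv_covectorWedge_const _ hβ,
      covectorWedge_neg, neg_neg]
  simp only [e₂, Finset.sum_add_distrib]
  rw [add_eq_right]
  have hexp : ∀ i j, covectorWedge (fderiv ℝ (fun z => ω z ![stdVec i, stdVec j]) y)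
        (covectorWedge (coord i) (covectorWedge (coord j) (β y))) =
      ∑ l, (fderiv ℝ ω y (stdVec l) ![stdVec i, stdVec j]) • covectorWedge (coord l)
        (covectorWedge (coord i) (covectorWedge (coord j) (β y))) := by
    intro i j
    rw [(hasFDerivAt_form_apply hω _).fderiv]
    conv_lhs => rw [covector_eq_sum (ContinuousAlternatingMap.apply ℝ (Model n) ℝ
      ![stdVec i, stdVec j] ∘L fderiv ℝ ω y)]
    rw [covectorWedge_sum_left]
    refine Finset.sum_congr rfl fun l _ => ?_
    rw [covectorWedge_smul_left]
    rfl
  simp only [hexp]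
  refine sum_cyclic_eq_zero (fun i j l => fderiv ℝ ω y (stdVec l) ![stdVec i, stdVec j])
    (fun i j l => covectorWedge (coord l)
        (covectorWedge (coord i) (covectorWedge (coord j) (β y)))) ?_ ?_
  · intro i j l
    have h := congrArg (fun α : Cov n 3 => α ![stdVec l, stdVec i, stdVec j]) hd
    have h2 : ∀ (α : Cov n 2) (v w : Model n), α ![v, w] = -α ![w, v] := fun α v w => by
      rw [← toBilin_apply, toBilin_swap, toBilin_apply]
    change altCLM n 2 (fderiv ℝ ω y) _ = 0 at h
    rw [altCLM_apply, Fin.sum_univ_three] at h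
    have r0 : (0 : Fin 3).removeNth ![stdVec l, stdVec i, stdVec j] = ![stdVec i, stdVec j] := by
      ext a
      fin_cases a <;> rfl
    have r1 : (1 : Fin 3).removeNth ![stdVec l, stdVec i, stdVec j] = ![stdVec l, stdVec j] := by
      ext a
      fin_cases a <;> rfl
    have r2 : (2 : Fin 3).removeNth ![stdVec l, stdVec i, stdVec j] = ![stdVec l, stdVec i] := by
      ext a
      fin_cases a <;> rfl
    rw [r0, r1, r2] at h
    simp at h
    rw [h2 _ (stdVec l) (stdVec j)] at h
    linarith
  · intro i j l
    rw [covectorWedge_self_swap (coord l) (coord i), covectorWedge_self_swap (coord l) (coord j),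
      covectorWedge_neg, neg_neg]

theorem differentiableAt_of_contDiffOn {F : Type*} [NormedAddCommGroup F] [NormedSpace ℝ F]
    {f : Model n → F} {U : Set (Model n)} (hU : IsOpen U) (hf : ContDiffOn ℝ smoothExp f U)
    {y : Model n} (hy : y ∈ U) : DifferentiableAt ℝ f y :=
  (hf.contDiffAt (hU.mem_nhds hy)).differentiableAt (by simp)

theorem contDiffOn_fderiv {F : Type*} [NormedAddCommGroup F] [NormedSpace ℝ F]
    {f : Model n → F} {U : Set (Model n)} (hU : IsOpen U) (hf : ContDiffOn ℝ smoothExp f U) :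
    ContDiffOn ℝ smoothExp (fderiv ℝ f) U := hf.fderiv_of_isOpen hU (by simp)

theorem contDiffOn_extDeriv {β : Model n → Cov n k} {U : Set (Model n)} (hU : IsOpen U)
    (hβ : ContDiffOn ℝ smoothExp β U) : ContDiffOn ℝ smoothExp (extDeriv β) U :=
  (contDiff_altCLM _).comp_contDiffOn (contDiffOn_fderiv hU hβ)

theorem extDeriv_extDeriv_of_contDiffOn {β : Model n → Cov n k} {U : Set (Model n)}
    (hU : IsOpen U) (hβ : ContDiffOn ℝ smoothExp β U) {y : Model n} (hy : y ∈ U) :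
    extDeriv (extDeriv β) y = 0 :=
  extDeriv_extDeriv_apply (hβ.contDiffAt (hU.mem_nhds hy)) (by
    rw [minSmoothness_of_isRCLikeNormedField]
    exact WithTop.coe_le_coe.2 (le_top : (2 : ℕ∞) ≤ ⊤))

theorem extDeriv_congr_of_eqOn {β γ : Model n → Cov n k} {U : Set (Model n)}
    (hU : IsOpen U) (h : Set.EqOn β γ U) {y : Model n} (hy : y ∈ U) :
    extDeriv β y = extDeriv γ y :=
  (h.eventuallyEq_of_mem (hU.mem_nhds hy)).extDeriv_eq

/-- The `0`-form of a function and its differential. -/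
theorem extDeriv_zero_form {G : Model n → Cov n 0} {y : Model n} (hG : DifferentiableAt ℝ G y) :
    extDeriv G y = covectorWedge (fderiv ℝ (fun z => G z ![]) y) (constForm 1) := by
  rw [extDeriv_eq_sum, covector_eq_sum (fderiv ℝ (fun z => G z ![]) y), covectorWedge_sum_left]
  refine Finset.sum_congr rfl fun i _ => ?_
  rw [covectorWedge_smul_left, ← covectorWedge_smul, ← constForm_eq_smul,
    (hasFDerivAt_form_apply hG _).fderiv]
  congr 1
  exact eq_constForm _

/-- Symplectic data on an open subset of the model space. -/
structure LocalSymplectic (ω : Model n → Cov n 2) (U : Set (Model n)) : Prop where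
  isOpen : IsOpen U
  smooth : ContDiffOn ℝ smoothExp ω U
  closed : ∀ y ∈ U, extDeriv ω y = 0
  nondeg : ∀ y ∈ U, Nondeg (ω y)

namespace LocalSymplectic

variable {ω : Model n → Cov n 2} {U : Set (Model n)}

theorem differentiableAt (hω : LocalSymplectic ω U) {y : Model n} (hy : y ∈ U) :
    DifferentiableAt ℝ ω y :=
  differentiableAt_of_contDiffOn hω.isOpen hω.smooth hy

theorem contDiffOn_expForm (hω : LocalSymplectic ω U) (p : ℕ) :
    ContDiffOn ℝ smoothExp (fun y => expForm (ω y) p) U :=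
  CanonicalHomology.contDiffOn_expForm hω.smooth p

theorem contDiffOn_inv_formMatrix (hω : LocalSymplectic ω U) (i j : Fin (2 * n)) :
    ContDiffOn ℝ smoothExp (fun y => (formMatrix (ω y))⁻¹ i j) U := by
  refine contDiffOn_inv (fun a b => ?_) (fun y hy => (hω.nondeg y hy).det_ne_zero) i j
  exact (ContinuousAlternatingMap.apply ℝ (Model n) ℝ
    ![stdVec a, stdVec b]).contDiff.comp_contDiffOn hω.smooth

theorem contDiffOn_sharp (hω : LocalSymplectic ω U) {ξ : Model n → Model n →L[ℝ] ℝ}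
    (hξ : ContDiffOn ℝ smoothExp ξ U) :
    ContDiffOn ℝ smoothExp (fun y => sharp (ω y) (ξ y)) U := by
  refine ContDiffOn.sum fun i _ => ContDiffOn.sum fun j _ => ?_
  exact ((hω.contDiffOn_inv_formMatrix i j).mul (hξ.clm_apply contDiffOn_const)).smul
    contDiffOn_const

theorem extDeriv_expForm (hω : LocalSymplectic ω U) {y : Model n} (hy : y ∈ U) :
    ∀ p : ℕ, extDeriv (fun y => expForm (ω y) p) y = 0
  | 0 => by
    change altCLM n 0 (fderiv ℝ (fun _ => constForm 1) y) = 0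
    rw [fderiv_fun_const]
    exact map_zero _
  | 1 => by
    change altCLM n 1 (fderiv ℝ (fun _ => 0) y) = 0
    rw [fderiv_fun_const]
    exact map_zero _
  | p + 2 => by
    have h : extDeriv (fun y => expForm (ω y) (p + 2)) y = (2 / ((p : ℝ) + 2)) •
      extDeriv (fun y => twoWedge (ω y) (expForm (ω y) p)) y := extDeriv_smul _ _
    rw [h, extDeriv_twoWedge (hω.differentiableAt hy)
      (differentiableAt_of_contDiffOn hω.isOpen (hω.contDiffOn_expForm p) hy) (hω.closed y hy),
      extDeriv_expForm hω hy p, twoWedge_eq_sum]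
    simp [covectorWedge_zero]

theorem extDeriv_smul_expForm (hω : LocalSymplectic ω U) {g : Model n → ℝ}
    (hg : ContDiffOn ℝ smoothExp g U) {y : Model n} (hy : y ∈ U) (p : ℕ) :
    extDeriv (fun y => g y • expForm (ω y) p) y =
      covectorWedge (fderiv ℝ g y) (expForm (ω y) p) := by
  rw [extDeriv_smul_fun (differentiableAt_of_contDiffOn hω.isOpen hg hy)
    (differentiableAt_of_contDiffOn hω.isOpen (hω.contDiffOn_expForm p) hy),
    hω.extDeriv_expForm hy, smul_zero, add_zero]

/-- The Hamiltonian vector field of a function. -/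
def _root_.CanonicalHomology.hamVec (ω : Model n → Cov n 2) (g : Model n → ℝ) (y : Model n) :
    Model n := sharp (ω y) (fderiv ℝ g y)

/-- The Poisson bracket `dg(X_h)`. -/
def _root_.CanonicalHomology.poisson (ω : Model n → Cov n 2) (g h : Model n → ℝ) (y : Model n) :
    ℝ := fderiv ℝ g y (hamVec ω h y)

theorem contDiffOn_hamVec (hω : LocalSymplectic ω U) {g : Model n → ℝ}
    (hg : ContDiffOn ℝ smoothExp g U) : ContDiffOn ℝ smoothExp (hamVec ω g) U :=
  hω.contDiffOn_sharp (contDiffOn_fderiv hω.isOpen hg)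

theorem contDiffOn_poisson (hω : LocalSymplectic ω U) {g h : Model n → ℝ}
    (hg : ContDiffOn ℝ smoothExp g U) (hh : ContDiffOn ℝ smoothExp h U) :
    ContDiffOn ℝ smoothExp (poisson ω g h) U :=
  (contDiffOn_fderiv hω.isOpen hg).clm_apply (hω.contDiffOn_hamVec hh)

/-- Both sides are dg ∧ ωʲ/j!, the left one by the choice of the Hamiltonian field and the right one
because ωʲ is closed. For odd degrees both vanish. -/
theorem intProd_hamVec_expForm (hω : LocalSymplectic ω U) {g : Model n → ℝ}
    (hg : ContDiffOn ℝ smoothExp g U) {y : Model n} (hy : y ∈ U) (p : ℕ) :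
    intProd (hamVec ω g y) (expForm (ω y) (p + 2)) =
      extDeriv (fun y => g y • expForm (ω y) p) y := by
  rw [intProd_expForm, hamVec, toBilin_sharp (hω.nondeg y hy), hω.extDeriv_smul_expForm hg hy]

theorem contDiffOn_intProd_field {V : Model n → Model n} {η : Model n → Cov n (k + 1)}
    (hV : ContDiffOn ℝ smoothExp V U) (hη : ContDiffOn ℝ smoothExp η U) :
    ContDiffOn ℝ smoothExp (fun y => intProd (V y) (η y)) U :=
  ((contDiff_curryCLM _).comp_contDiffOn hη).clm_apply hV

theorem extDeriv_intProd_hamVec (hω : LocalSymplectic ω U) {g : Model n → ℝ}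
    (hg : ContDiffOn ℝ smoothExp g U) {y : Model n} (hy : y ∈ U) (p : ℕ) :
    extDeriv (fun y => intProd (hamVec ω g y) (expForm (ω y) (p + 2))) y = 0 := by
  rw [extDeriv_congr_of_eqOn hω.isOpen (fun z hz => hω.intProd_hamVec_expForm hg hz p) hy]
  exact extDeriv_extDeriv_of_contDiffOn hω.isOpen (hg.smul (hω.contDiffOn_expForm p)) hy

/-- Contracting dg ∧ ωʲ/j! with X_h gives {g, h} ωʲ/j! minus the exact form dg ∧ dh ∧ ωʲ⁻¹/(j-1)!.
The differential of the former is again a Hamiltonian contraction. In the two lowest degrees the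
second term is absent. -/
theorem extDeriv_intProd_intProd (hω : LocalSymplectic ω U) {g h : Model n → ℝ}
    (hg : ContDiffOn ℝ smoothExp g U) (hh : ContDiffOn ℝ smoothExp h U) {y : Model n}
    (hy : y ∈ U) : ∀ p : ℕ,
    extDeriv (fun y => intProd (hamVec ω h y) (intProd (hamVec ω g y) (expForm (ω y) (p + 2)))) y =
      intProd (hamVec ω (poisson ω g h) y) (expForm (ω y) (p + 2))
  | 0 => by
    rw [hω.intProd_hamVec_expForm (hω.contDiffOn_poisson hg hh) hy]
    refine extDeriv_congr_of_eqOn hω.isOpen (fun z hz => ?_) hy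
    change intProd (hamVec ω h z) (intProd (hamVec ω g z) (expForm (ω z) 2)) = _
    rw [intProd_expForm, intProd_covectorWedge_zero, hamVec, hamVec,
      toBilin_sharp (hω.nondeg z hz)]
    rfl
  | 1 => by
    rw [hω.intProd_hamVec_expForm (hω.contDiffOn_poisson hg hh) hy]
    refine extDeriv_congr_of_eqOn hω.isOpen (fun z hz => ?_) hy
    change intProd (hamVec ω h z) (intProd (hamVec ω g z) (expForm (ω z) 3)) = _
    rw [intProd_expForm, intProd_covectorWedge, hamVec, hamVec,
      toBilin_sharp (hω.nondeg z hz)]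
    simp [expForm, covectorWedge_zero]
  | p + 2 => by
    -- γ = dh ∧ ωʲ⁻¹/(j-1)! is closed, hence dg ∧ γ = d(gγ).
    set γ : Model n → Cov n (p + 1) := extDeriv (fun y => h y • expForm (ω y) p) with hγ
    have hhs : ContDiffOn ℝ smoothExp (fun y => h y • expForm (ω y) p) U :=
      hh.smul (hω.contDiffOn_expForm p)
    have hγs : ContDiffOn ℝ smoothExp γ U :=
      contDiffOn_extDeriv hω.isOpen (hh.smul (hω.contDiffOn_expForm p))
    have e : Set.EqOn (fun y => intProd (hamVec ω h y)
        (intProd (hamVec ω g y) (expForm (ω y) (p + 2 + 2))))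
        (fun y => poisson ω g h y • expForm (ω y) (p + 2) +
          (-1 : ℝ) • extDeriv (fun y => g y • γ y) y) U := by
      intro z hz
      have h₁ : extDeriv (fun y => g y • γ y) z = covectorWedge (fderiv ℝ g z) (γ z) := by
        rw [extDeriv_smul_fun (differentiableAt_of_contDiffOn hω.isOpen hg hz)
          (differentiableAt_of_contDiffOn hω.isOpen hγs hz), hγ,
          extDeriv_extDeriv_of_contDiffOn hω.isOpen hhs hz,
          smul_zero, add_zero]
      change intProd (hamVec ω h z) (intProd (hamVec ω g z) (expForm (ω z) (p + 2 + 2))) =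
        poisson ω g h z • expForm (ω z) (p + 2) + (-1 : ℝ) • extDeriv (fun y => g y • γ y) z
      rw [intProd_expForm _ (hamVec ω g z), intProd_covectorWedge, h₁, hγ,
        ← hω.intProd_hamVec_expForm hh hz, hamVec, hamVec, toBilin_sharp (hω.nondeg z hz)]
      simp only [neg_smul, one_smul, sub_eq_add_neg]
      rfl
    have s₁ : ContDiffOn ℝ smoothExp (fun y => poisson ω g h y • expForm (ω y) (p + 2)) U :=
      (hω.contDiffOn_poisson hg hh).smul (hω.contDiffOn_expForm _)
    have s₂ : ContDiffOn ℝ smoothExp (fun y => extDeriv (fun y => g y • γ y) y) U :=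
      contDiffOn_extDeriv hω.isOpen (hg.smul hγs)
    have s₃ : DifferentiableAt ℝ (fun y => (-1 : ℝ) • extDeriv (fun y => g y • γ y) y) y :=
      (differentiableAt_of_contDiffOn hω.isOpen s₂ hy).const_smul (-1 : ℝ)
    rw [extDeriv_congr_of_eqOn hω.isOpen e hy,
      hω.intProd_hamVec_expForm (hω.contDiffOn_poisson hg hh) hy,
      extDeriv_fun_add (differentiableAt_of_contDiffOn hω.isOpen s₁ hy) s₃, add_eq_left]
    refine (extDeriv_smul (-1 : ℝ) (fun y => extDeriv (fun y => g y • γ y) y)).trans ?_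
    exact (congrArg (fun θ => (-1 : ℝ) • θ) (extDeriv_extDeriv_of_contDiffOn hω.isOpen
      (β := fun y => g y • γ y) (hg.smul hγs) hy)).trans (smul_zero _)

end LocalSymplectic

/-! ### The canonical homology operator on an open subset of the model space -/

/-- The one-form with value `ξ`. -/
abbrev oneForm (ξ : Model n →L[ℝ] ℝ) : Cov n 1 := covectorWedge ξ (constForm 1)

namespace LocalSymplectic

variable {ω : Model (n + 1) → Cov (n + 1) 2} {U : Set (Model (n + 1))}

/-- The local form of δ(f dg) = {f, g}: ∗(f dg) is f times the closed form i_{X_g}vol, and df ∧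
i_{X_g}vol = df(X_g) vol. -/
theorem starCov_extDeriv_starCov_one (hω : LocalSymplectic ω U) {f g : Model (n + 1) → ℝ}
    (hf : ContDiffOn ℝ smoothExp f U) (hg : ContDiffOn ℝ smoothExp g U) {y : Model (n + 1)}
    (hy : y ∈ U) :
    starCov (ω y) (2 * n + 2) 0 (extDeriv
      (fun z => starCov (ω z) 1 (2 * n + 1) (f z • oneForm (fderiv ℝ g z))) y) =
      constForm (poisson ω f g y) := by
  have e : ∀ z, starCov (ω z) 1 (2 * n + 1) (f z • oneForm (fderiv ℝ g z)) =
      f z • intProd (hamVec ω g z) (expForm (ω z) (2 * n + 2)) := fun z => by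
    rw [starCov_smul, starCov_one, hamVec]
  have hs : ContDiffOn ℝ smoothExp
      (fun z => intProd (hamVec ω g z) (expForm (ω z) (2 * n + 2))) U :=
    contDiffOn_intProd_field (hω.contDiffOn_hamVec hg) (hω.contDiffOn_expForm _)
  simp only [e]
  rw [extDeriv_smul_fun (differentiableAt_of_contDiffOn hω.isOpen hf hy)
    (differentiableAt_of_contDiffOn hω.isOpen hs hy), hω.extDeriv_intProd_hamVec hg hy, smul_zero,
    add_zero, covectorWedge_intProd_of_top (by ring), starCov_smul,
    starCov_top (hω.nondeg y hy), ← constForm_eq_smul]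
  rfl

/-- The local form of the second formula for δ, up to its sign. Here ∗(f dg ∧ dh) = f i_{X_h}
i_{X_g} vol; differentiating f gives the first two terms, and `extDeriv_intProd_intProd` gives the
third. -/
theorem starCov_extDeriv_starCov_two (hω : LocalSymplectic ω U) {f g h : Model (n + 1) → ℝ}
    (hf : ContDiffOn ℝ smoothExp f U) (hg : ContDiffOn ℝ smoothExp g U)
    (hh : ContDiffOn ℝ smoothExp h U) {y : Model (n + 1)} (hy : y ∈ U) :
    starCov (ω y) (2 * n + 1) 1 (extDeriv (fun z => starCov (ω z) 2 (2 * n)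
      (f z • covectorWedge (fderiv ℝ g z) (oneForm (fderiv ℝ h z)))) y) =
      poisson ω f h y • oneForm (fderiv ℝ g y) - poisson ω f g y • oneForm (fderiv ℝ h y) +
        f y • oneForm (fderiv ℝ (poisson ω g h) y) := by
  have e : ∀ z, starCov (ω z) 2 (2 * n)
      (f z • covectorWedge (fderiv ℝ g z) (oneForm (fderiv ℝ h z))) =
      f z • intProd (hamVec ω h z) (intProd (hamVec ω g z) (expForm (ω z) (2 * n + 2))) :=
    fun z => by rw [starCov_smul, starCov_two, hamVec, hamVec]
  have hs : ContDiffOn ℝ smoothExp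
      (fun z => intProd (hamVec ω h z) (intProd (hamVec ω g z) (expForm (ω z) (2 * n + 2)))) U :=
    contDiffOn_intProd_field (hω.contDiffOn_hamVec hh)
      (contDiffOn_intProd_field (hω.contDiffOn_hamVec hg) (hω.contDiffOn_expForm _))
  -- Contract the identity df ∧ i_{X_g}vol = {f, g} vol with X_h.
  have key : covectorWedge (fderiv ℝ f y) (intProd (hamVec ω h y)
      (intProd (hamVec ω g y) (expForm (ω y) (2 * n + 2)))) =
      poisson ω f h y • intProd (hamVec ω g y) (expForm (ω y) (2 * n + 2)) -
        poisson ω f g y • intProd (hamVec ω h y) (expForm (ω y) (2 * n + 2)) := by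
    have := intProd_covectorWedge (hamVec ω h y) (fderiv ℝ f y)
      (intProd (hamVec ω g y) (expForm (ω y) (2 * n + 2)))
    rw [covectorWedge_intProd_of_top (by ring), map_smul] at this
    exact (sub_eq_of_eq_add ((eq_sub_iff_add_eq.1 this).symm.trans (add_comm _ _))).symm
  have hstar : ∀ g : Model (n + 1) → ℝ, starCov (ω y) (2 * n + 1) 1
      (intProd (hamVec ω g y) (expForm (ω y) (2 * n + 2))) = oneForm (fderiv ℝ g y) := by
    intro g
    rw [starCov_intProd_top (hω.nondeg y hy), intProd_two, hamVec,
      toBilin_sharp (hω.nondeg y hy)]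
  simp only [e]
  rw [extDeriv_smul_fun (differentiableAt_of_contDiffOn hω.isOpen hf hy)
    (differentiableAt_of_contDiffOn hω.isOpen hs hy), hω.extDeriv_intProd_intProd hg hh hy, key,
    starCov_add, starCov_smul, hstar]
  have hsub : ∀ a b : Cov (n + 1) (2 * n + 1), starCov (ω y) (2 * n + 1) 1 (a - b) =
      starCov (ω y) (2 * n + 1) 1 a - starCov (ω y) (2 * n + 1) 1 b := fun a b =>
    map_sub (AddMonoidHom.mk' (fun a => starCov (ω y) (2 * n + 1) 1 a)
      (fun a b => starCov_add _ _ _ a b)) a b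
  rw [hsub, starCov_smul, starCov_smul, hstar, hstar]

/-- In dimension 2n + 2, ∗(hω) = hωⁿ/n! has differential i_{X_h}vol, which ∗ sends to i_{X_h}ω = dh.
-/
theorem starCov_extDeriv_starCov_smul_self (hω : LocalSymplectic ω U) {h : Model (n + 1) → ℝ}
    (hh : ContDiffOn ℝ smoothExp h U) {y : Model (n + 1)} (hy : y ∈ U) :
    starCov (ω y) (2 * n + 1) 1 (extDeriv (fun z => starCov (ω z) 2 (2 * n) (h z • ω z)) y) =
      oneForm (fderiv ℝ h y) := by
  have e : Set.EqOn (fun z => starCov (ω z) 2 (2 * n) (h z • ω z))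
      (fun z => h z • expForm (ω z) (2 * n)) U := fun z hz => by
    change starCov (ω z) 2 (2 * n) (h z • ω z) = _
    rw [starCov_smul, starCov_self (hω.nondeg z hz)]
  rw [extDeriv_congr_of_eqOn hω.isOpen e hy, ← hω.intProd_hamVec_expForm hh hy,
    starCov_intProd_top (hω.nondeg y hy), intProd_two, hamVec, toBilin_sharp (hω.nondeg y hy)]

end LocalSymplectic

end LocalCalculus

/-! ### Global forms and their expressions in charts. -/

section Global

variable {n k m : ℕ} {X : Type*} [TopologicalSpace X] [ChartedSpace (Model n) X]

/-- The expression of a `0`-form, considered as a function, in the preferred chart around `c`. -/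
def localFn (c : X) (f : RoughForm n X 0) (y : Model n) : ℝ := localRep c f y ![]

theorem localFn_eq (c : X) (f : RoughForm n X 0) (y : Model n) :
    localFn c f y = f ((chartAt (Model n) c).symm y) ![] :=
  congrArg (f ((chartAt (Model n) c).symm y)) (Subsingleton.elim _ _)

theorem contDiffOn_localFn (c : X) (f : Form n X 0) :
    ContDiffOn ℝ smoothExp (localFn c f.1) (chartAt (Model n) c).target :=
  (ContinuousAlternatingMap.apply ℝ (Model n) ℝ (![] : Fin 0 → Model n)).contDiff.comp_contDiffOn
    (f.2 c)

theorem localRep_mulForm [IsManifold (𝓡 (2 * n)) ((⊤ : ℕ∞) : WithTop ℕ∞) X] (c : X)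
    (f : Form n X 0) (α : Form n X k) (y : Model n) :
    localRep c (mulForm f α).1 y = localFn c f.1 y • localRep c α.1 y := by
  rw [localFn_eq]
  rfl

variable [IsManifold (𝓡 (2 * n)) ((⊤ : ℕ∞) : WithTop ℕ∞) X]

theorem eq_pull_localRep (c : X) (α : RoughForm n X k) {x : X}
    (hx : x ∈ (chartAt (Model n) c).source) :
    α x = pull (chartDeriv c x) (localRep c α (chartAt (Model n) c x)) := by
  rw [localRep, pull_pull, chartSymmDeriv_comp c hx, pull_id, (chartAt (Model n) c).left_inv hx]

theorem Form.ext_localRep {α β : Form n X k}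
    (h : ∀ c : X, ∀ y ∈ (chartAt (Model n) c).target, localRep c α.1 y = localRep c β.1 y) :
    α = β := by
  refine Subtype.ext (funext fun x => ?_)
  rw [eq_pull_localRep x α.1 (mem_chart_source _ x), eq_pull_localRep x β.1 (mem_chart_source _ x),
    h x _ (mem_chart_target _ x)]

theorem localRep_d (α : Form n X k) (c : X) {y : Model n} (hy : y ∈ (chartAt (Model n) c).target) :
    localRep c (d α).1 y = extDeriv (localRep c α.1) y :=
  localRep_extDerivForm α.2 c hy

theorem localRep_d_zero (f : Form n X 0) (c : X) {y : Model n}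
    (hy : y ∈ (chartAt (Model n) c).target) :
    localRep c (d f).1 y = oneForm (fderiv ℝ (localFn c f.1) y) := by
  rw [localRep_d f c hy]
  exact extDeriv_zero_form
    (differentiableAt_of_contDiffOn (chartAt (Model n) c).open_target (f.2 c) hy)

theorem localRep_star (ω : SymplecticForm n X) (c : X) (α : Form n X k) {y : Model n}
    (hy : y ∈ (chartAt (Model n) c).target) :
    localRep c (star ω k m α).1 y =
      starCov (localRep c ω.form.1 y) k m (localRep c α.1 y) := by
  have h₂ := chartSymmDeriv_comp c ((chartAt (Model n) c).map_target hy)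
  rw [(chartAt (Model n) c).right_inv hy] at h₂
  exact (starCov_pull _ _ h₂ _ _ _ _).symm

theorem SymplecticForm.localSymplectic (ω : SymplecticForm n X) (c : X) :
    LocalSymplectic (localRep c ω.form.1) (chartAt (Model n) c).target where
  isOpen := (chartAt (Model n) c).open_target
  smooth := ω.form.2 c
  closed y hy := by
    rw [← localRep_d ω.form c hy, ω.closed]
    rfl
  nondeg y hy := ω.nondeg_localRep c hy

theorem mulForm_add_left (f g : Form n X 0) (α : Form n X k) :
    mulForm (f + g) α = mulForm f α + mulForm g α :=
  Subtype.ext (funext fun x => add_smul (f.1 x ![]) (g.1 x ![]) (α.1 x))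

theorem mulForm_smul_left (r : ℝ) (f : Form n X 0) (α : Form n X k) :
    mulForm (r • f) α = r • mulForm f α :=
  Subtype.ext (funext fun x => mul_smul r (f.1 x ![]) (α.1 x))

theorem mulForm_add_right (f : Form n X 0) (α β : Form n X k) :
    mulForm f (α + β) = mulForm f α + mulForm f β :=
  Subtype.ext (funext fun x => smul_add (f.1 x ![]) (α.1 x) (β.1 x))

theorem mulForm_smul_right (r : ℝ) (f : Form n X 0) (α : Form n X k) :
    mulForm f (r • α) = r • mulForm f α :=
  Subtype.ext (funext fun x => smul_comm (f.1 x ![]) r (α.1 x))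

/-- The product of a function and a form as a bilinear map. -/
def mulFormₗ : Form n X 0 →ₗ[ℝ] Form n X k →ₗ[ℝ] Form n X k :=
  LinearMap.mk₂ ℝ mulForm mulForm_add_left mulForm_smul_left mulForm_add_right mulForm_smul_right

theorem d_mulForm_zero (f g : Form n X 0) :
    d (mulForm f g) = mulForm f (d g) + mulForm g (d f) := by
  refine Form.ext_localRep fun c y hy => ?_
  have hO := (chartAt (Model n) c).open_target
  have hl : localFn c (mulForm f g).1 = fun y => localFn c f.1 y * localFn c g.1 y := by
    funext z
    simp only [localFn, localRep_mulForm]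
    rfl
  change _ = localRep c (mulForm f (d g)).1 y + localRep c (mulForm g (d f)).1 y
  rw [localRep_d_zero _ c hy, localRep_mulForm, localRep_mulForm, localRep_d_zero _ c hy,
    localRep_d_zero _ c hy, hl,
    fderiv_fun_mul (differentiableAt_of_contDiffOn hO (contDiffOn_localFn c f) hy)
      (differentiableAt_of_contDiffOn hO (contDiffOn_localFn c g) hy)]
  simp only [oneForm, covectorWedge_add_left, covectorWedge_smul_left]

end Global

/-! ### The homology operator on X and the Lie bracket on the quotient. -/

section Homology

variable {n : ℕ} {X : Type*} [TopologicalSpace X] [ChartedSpace (Model (n + 1)) X]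
  [IsManifold (𝓡 (2 * (n + 1))) ((⊤ : ℕ∞) : WithTop ℕ∞) X] (ω : SymplecticForm (n + 1) X)

theorem localRep_δ_zero (α : Form (n + 1) X 1) (c : X) {y : Model (n + 1)}
    (hy : y ∈ (chartAt (Model (n + 1)) c).target) :
    localRep c (δ ω 0 α).1 y = starCov (localRep c ω.form.1 y) (2 * n + 2) 0 (extDeriv
      (fun z => starCov (localRep c ω.form.1 z) 1 (2 * n + 1) (localRep c α.1 z)) y) := by
  have h : δ ω 0 α = star ω (2 * n + 2) 0 (d (star ω 1 (2 * n + 1) α)) := by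
    have : ((-1 : ℝ) ^ ((0 + 1) + 1)) • star ω (2 * n + 2) 0 (d (star ω 1 (2 * n + 1) α)) =
        star ω (2 * n + 2) 0 (d (star ω 1 (2 * n + 1) α)) := by norm_num
    exact this
  rw [h, localRep_star ω c _ hy, localRep_d _ c hy]
  congr 1
  exact extDeriv_congr_of_eqOn (chartAt (Model (n + 1)) c).open_target
    (fun z hz => localRep_star ω c _ hz) hy

theorem localRep_δ_one (α : Form (n + 1) X 2) (c : X) {y : Model (n + 1)}
    (hy : y ∈ (chartAt (Model (n + 1)) c).target) :
    localRep c (δ ω 1 α).1 y = -starCov (localRep c ω.form.1 y) (2 * n + 1) 1 (extDeriv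
      (fun z => starCov (localRep c ω.form.1 z) 2 (2 * n) (localRep c α.1 z)) y) := by
  have h : δ ω 1 α = -star ω (2 * n + 1) 1 (d (star ω 2 (2 * n) α)) := by
    have : ((-1 : ℝ) ^ ((1 + 1) + 1)) • star ω (2 * n + 1) 1 (d (star ω 2 (2 * n) α)) =
        -star ω (2 * n + 1) 1 (d (star ω 2 (2 * n) α)) := by
      rw [show ((-1 : ℝ) ^ ((1 + 1) + 1)) = -1 by norm_num]
      exact neg_one_smul ℝ _
    exact this
  have h' : localRep c (-star ω (2 * n + 1) 1 (d (star ω 2 (2 * n) α))).1 y =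
      -localRep c (star ω (2 * n + 1) 1 (d (star ω 2 (2 * n) α))).1 y := rfl
  rw [h, h', localRep_star ω c _ hy, localRep_d _ c hy]
  congr 2
  exact extDeriv_congr_of_eqOn (chartAt (Model (n + 1)) c).open_target
    (fun z hz => localRep_star ω c _ hz) hy

/-- Up to sign the composition is ∗d(∗∗)d∗, where ∗∗ = 1 in degree 2n + 1, one below the top, and dd
= 0. -/
theorem δ_δ (γ : Form (n + 1) X 2) : δ ω 0 (δ ω 1 γ) = 0 := by
  have h₁ : δ ω 0 (δ ω 1 γ) = ((-1 : ℝ) ^ ((0 + 1) + 1)) •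
      star ω (2 * n + 2) 0 (d (star ω 1 (2 * n + 1) (δ ω 1 γ))) := rfl
  have h₂ : δ ω 1 γ = ((-1 : ℝ) ^ ((1 + 1) + 1)) •
      star ω (2 * n + 1) 1 (d (star ω 2 (2 * n) γ)) := rfl
  have h₃ : star ω 1 (2 * n + 1) (star ω (2 * n + 1) 1 (d (star ω 2 (2 * n) γ))) =
      d (star ω 2 (2 * n) γ) :=
    Subtype.ext (funext fun x => starCov_starCov (ω.nondeg x) _)
  have h₄ : d (d (star ω 2 (2 * n) γ)) = 0 := Form.ext_localRep fun c y hy => by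
    rw [localRep_d _ c hy, extDeriv_congr_of_eqOn (chartAt (Model (n + 1)) c).open_target
      (fun z hz => localRep_d _ c hz) hy]
    exact extDeriv_extDeriv_of_contDiffOn (chartAt (Model (n + 1)) c).open_target
      ((star ω 2 (2 * n) γ).2 c) hy
  rw [h₁, h₂, map_smul, h₃, map_smul, h₄, smul_zero, map_zero, smul_zero]

/-- The Poisson bracket of functions. -/
def bracket (f g : Form (n + 1) X 0) : Form (n + 1) X 0 := δ ω 0 (mulForm f (d g))

theorem localRep_bracket (f g : Form (n + 1) X 0) (c : X) {y : Model (n + 1)}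
    (hy : y ∈ (chartAt (Model (n + 1)) c).target) :
    localRep c (bracket ω f g).1 y =
      constForm (poisson (localRep c ω.form.1) (localFn c f.1) (localFn c g.1) y) := by
  rw [bracket, localRep_δ_zero ω _ c hy,
    ← (ω.localSymplectic c).starCov_extDeriv_starCov_one (contDiffOn_localFn c f)
    (contDiffOn_localFn c g) hy]
  congr 1
  refine extDeriv_congr_of_eqOn (chartAt (Model (n + 1)) c).open_target (fun z hz => ?_) hy
  change starCov _ _ _ (localRep c (mulForm f (d g)).1 z) = _
  rw [localRep_mulForm, localRep_d_zero g c hz]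

theorem localFn_bracket (f g : Form (n + 1) X 0) (c : X) {y : Model (n + 1)}
    (hy : y ∈ (chartAt (Model (n + 1)) c).target) :
    localFn c (bracket ω f g).1 y =
      poisson (localRep c ω.form.1) (localFn c f.1) (localFn c g.1) y := by
  rw [localFn, localRep_bracket ω f g c hy, constForm_apply]

/-- The canonical homology operator on `f dg ∧ dh`. -/
theorem δ_mulForm_d_mulForm_d (f g h : Form (n + 1) X 0) :
    δ ω 1 (mulForm f (d (mulForm g (d h)))) =
      -(mulForm (bracket ω f h) (d g) - mulForm (bracket ω f g) (d h) +
        mulForm f (d (bracket ω g h))) := by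
  refine Form.ext_localRep fun c y hy => ?_
  have hO := (chartAt (Model (n + 1)) c).open_target
  change _ = -(localRep c (mulForm (bracket ω f h) (d g)).1 y -
    localRep c (mulForm (bracket ω f g) (d h)).1 y + localRep c (mulForm f (d (bracket ω g h))).1 y)
  have hb : fderiv ℝ (localFn c (bracket ω g h).1) y =
      fderiv ℝ (poisson (localRep c ω.form.1) (localFn c g.1) (localFn c h.1)) y :=
    Filter.EventuallyEq.fderiv_eq (Filter.eventuallyEq_of_mem (hO.mem_nhds hy)
      fun z hz => localFn_bracket ω g h c hz)
  rw [localRep_δ_one ω _ c hy, localRep_mulForm, localRep_mulForm, localRep_mulForm,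
    localRep_d_zero _ c hy, localRep_d_zero _ c hy, localRep_d_zero _ c hy,
    localFn_bracket ω _ _ c hy, localFn_bracket ω _ _ c hy, hb,
    ← (ω.localSymplectic c).starCov_extDeriv_starCov_two (contDiffOn_localFn c f)
    (contDiffOn_localFn c g) (contDiffOn_localFn c h) hy]
  congr 2
  refine extDeriv_congr_of_eqOn hO (fun z hz => ?_) hy
  change starCov _ _ _ (localRep c (mulForm f (d (mulForm g (d h)))).1 z) = _
  -- The product dg ∧ dh is encoded as d(g dh), which equals it because ddh = 0.
  have e : Set.EqOn (localRep c (mulForm g (d h)).1)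
      (fun y => localFn c g.1 y • extDeriv (localRep c h.1) y) (chartAt (Model (n + 1)) c).target :=
    fun w hw => by rw [localRep_mulForm, localRep_d h c hw]
  rw [localRep_mulForm, localRep_d _ c hz, extDeriv_congr_of_eqOn hO e hz,
    extDeriv_smul_fun (differentiableAt_of_contDiffOn hO (contDiffOn_localFn c g) hz)
    (differentiableAt_of_contDiffOn hO (contDiffOn_extDeriv hO (h.2 c)) hz),
    extDeriv_extDeriv_of_contDiffOn hO (h.2 c) hz, smul_zero, add_zero, ← localRep_d h c hz,
    localRep_d_zero h c hz]

/-- Every exact one-form is in the image of the canonical homology operator. -/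
theorem δ_mulForm_form (h : Form (n + 1) X 0) : δ ω 1 (mulForm h ω.form) = -d h := by
  refine Form.ext_localRep fun c y hy => ?_
  have hO := (chartAt (Model (n + 1)) c).open_target
  change _ = -localRep c (d h).1 y
  rw [localRep_δ_one ω _ c hy, localRep_d_zero _ c hy,
    ← (ω.localSymplectic c).starCov_extDeriv_starCov_smul_self (contDiffOn_localFn c h) hy]
  congr 2
  refine extDeriv_congr_of_eqOn hO (fun z hz => ?_) hy
  change starCov _ _ _ (localRep c (mulForm h ω.form).1 z) = _
  rw [localRep_mulForm]

theorem cls_δ (γ : Form (n + 1) X 2) : cls ω (δ ω 1 γ) = 0 :=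
  (Submodule.Quotient.mk_eq_zero _).2 ⟨γ, rfl⟩

theorem cls_d (h : Form (n + 1) X 0) : cls ω (d h) = 0 := by
  rw [← neg_eq_zero, ← map_neg, ← δ_mulForm_form, cls_δ]

theorem cls_mulForm_d_swap (f g : Form (n + 1) X 0) :
    cls ω (mulForm f (d g)) = -cls ω (mulForm g (d f)) := by
  rw [eq_neg_iff_add_eq_zero, ← map_add, ← d_mulForm_zero, cls_d]

theorem cls_mulForm_d_self (f : Form (n + 1) X 0) : cls ω (mulForm f (d f)) = 0 := by
  have h : (2 : ℝ) • cls ω (mulForm f (d f)) = 0 := by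
    rw [two_smul, ← map_add, ← d_mulForm_zero, cls_d]
  exact (smul_eq_zero.1 h).resolve_left two_ne_zero

/-- The class of δ(f dg ∧ dh) is zero, and antisymmetry rewrites -[{f, h} dg] as [g d{f, h}]. -/
theorem cls_jacobi (f g h : Form (n + 1) X 0) :
    cls ω (mulForm f (d (bracket ω g h))) =
      cls ω (mulForm (bracket ω f g) (d h)) + cls ω (mulForm g (d (bracket ω f h))) := by
  have := cls_δ ω (mulForm f (d (mulForm g (d h))))
  rw [δ_mulForm_d_mulForm_d, map_neg, neg_eq_zero, map_add, map_sub] at this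
  rw [cls_mulForm_d_swap ω g, ← sub_eq_zero, ← this]
  abel

/-- The bilinear map `(α, β) ↦ [δα · dδβ]`. -/
def preBracket : Form (n + 1) X 1 →ₗ[ℝ] Form (n + 1) X 1 →ₗ[ℝ] CanonicalQuotient ω :=
  ((mulFormₗ (n := n + 1) (X := X) (k := 1)).compl₁₂ (δ ω 0) (d ∘ₗ δ ω 0)).compr₂ (cls ω)

theorem preBracket_apply (α β : Form (n + 1) X 1) :
    preBracket ω α β = cls ω (mulForm (δ ω 0 α) (d (δ ω 0 β))) := rfl

/-- The bracket of `Ω¹(X) / δΩ²(X)`. -/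
def quotBracket : CanonicalQuotient ω →ₗ[ℝ] CanonicalQuotient ω →ₗ[ℝ] CanonicalQuotient ω :=
  (LinearMap.range (δ ω 1)).liftQ
    (LinearMap.flip ((LinearMap.range (δ ω 1)).liftQ (preBracket ω).flip (by
      rintro _ ⟨γ, rfl⟩
      refine LinearMap.ext fun α => ?_
      rw [LinearMap.flip_apply, preBracket_apply, δ_δ, map_zero]
      exact (congrArg (cls ω) (map_zero (mulFormₗ (δ ω 0 α)))).trans (map_zero _)))) (by
    rintro _ ⟨γ, rfl⟩
    refine LinearMap.ext fun a => ?_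
    obtain ⟨β, rfl⟩ := (LinearMap.range (δ ω 1)).mkQ_surjective a
    change preBracket ω (δ ω 1 γ) β = 0
    rw [preBracket_apply, δ_δ]
    exact (congrArg (cls ω) (LinearMap.congr_fun (map_zero mulFormₗ) _)).trans (map_zero _))

theorem quotBracket_cls (α β : Form (n + 1) X 1) :
    quotBracket ω (cls ω α) (cls ω β) = cls ω (mulForm (δ ω 0 α) (d (δ ω 0 β))) := rfl

theorem cls_surjective : Function.Surjective (cls ω) := (LinearMap.range (δ ω 1)).mkQ_surjective

theorem quotBracket_self (a : CanonicalQuotient ω) : quotBracket ω a a = 0 := by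
  obtain ⟨α, rfl⟩ := cls_surjective ω a
  rw [quotBracket_cls, cls_mulForm_d_self]

theorem quotBracket_jacobi (a b c : CanonicalQuotient ω) :
    quotBracket ω a (quotBracket ω b c) =
      quotBracket ω (quotBracket ω a b) c + quotBracket ω b (quotBracket ω a c) := by
  obtain ⟨α, rfl⟩ := cls_surjective ω a
  obtain ⟨β, rfl⟩ := cls_surjective ω b
  obtain ⟨γ, rfl⟩ := cls_surjective ω c
  simp only [quotBracket_cls]
  -- By definition `bracket` of δα and δβ is δ(δα · dδβ), that is, δ of a representative of the
  -- inner commutator.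
  exact cls_jacobi ω (δ ω 0 α) (δ ω 0 β) (δ ω 0 γ)

end Homology

/-! ### Smoothness of integrals depending on a parameter. -/

section ParametricIntegral

variable {E : Type} [NormedAddCommGroup E] [NormedSpace ℝ E] [FiniteDimensional ℝ E]

theorem hasFDerivAt_parametric_intervalIntegral {F : Type} [NormedAddCommGroup F] [NormedSpace ℝ F]
    {G : E × ℝ → F} (hG : ContDiff ℝ smoothExp G) (a b : ℝ) (x : E) :
    HasFDerivAt (fun x => ∫ t in a..b, G (x, t))
      (∫ t in a..b, fderiv ℝ G (x, t) ∘L ContinuousLinearMap.inl ℝ E ℝ) x := by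
  have hG' : Continuous fun p : E × ℝ => fderiv ℝ G p ∘L ContinuousLinearMap.inl ℝ E ℝ :=
    (hG.continuous_fderiv (by simp)).clm_comp continuous_const
  have hc : ∀ z : E, Continuous fun t : ℝ => (z, t) := fun z => by fun_prop
  have hK : IsCompact (Metric.closedBall x 1 ×ˢ Set.uIcc a b) :=
    (isCompact_closedBall x 1).prod isCompact_uIcc
  -- The dominating constant comes from compactness of a unit ball times the interval.
  obtain ⟨C, hC⟩ := hK.exists_bound_of_continuousOn hG'.continuousOn
  refine intervalIntegral.hasFDerivAt_integral_of_dominated_of_fderiv_le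
    (F' := fun x t => fderiv ℝ G (x, t) ∘L ContinuousLinearMap.inl ℝ E ℝ) (bound := fun _ => C)
    (Metric.ball_mem_nhds x one_pos) (Filter.Eventually.of_forall fun z =>
      (hG.continuous.comp (hc z)).aestronglyMeasurable)
    ((hG.continuous.comp (hc x)).intervalIntegrable _ _)
    (hG'.comp (hc x)).aestronglyMeasurable
    (Filter.Eventually.of_forall fun t ht z hz => hC (z, t) ⟨Metric.ball_subset_closedBall hz,
      Set.uIoc_subset_uIcc ht⟩) intervalIntegrable_const
    (Filter.Eventually.of_forall fun t ht z hz => ?_)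
  have h₁ : HasFDerivAt (fun x : E => (x, t)) (ContinuousLinearMap.inl ℝ E ℝ) z :=
    hasFDerivAt_prodMk_left z t
  exact (hG.differentiable (by simp) (z, t)).hasFDerivAt.comp z h₁

/-- The derivative is an integral of the same kind with values in E →L[ℝ] F, so the induction has to
run over all target spaces at once. -/
theorem contDiff_parametric_intervalIntegral_nat (a b : ℝ) (r : ℕ) : ∀ {F : Type}
    [NormedAddCommGroup F] [NormedSpace ℝ F] {G : E × ℝ → F}, ContDiff ℝ smoothExp G →
    ContDiff ℝ r (fun x => ∫ t in a..b, G (x, t)) := by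
  induction r with
  | zero =>
    intro F _ _ G hG
    refine contDiff_zero.2 ?_
    exact intervalIntegral.continuous_parametric_intervalIntegral_of_continuous'
      (f := fun x t => G (x, t)) (by simpa [Function.uncurry_def] using hG.continuous) a b
  | succ r ih =>
    intro F _ _ G hG
    refine contDiff_succ_iff_hasFDerivAt.2 ⟨_, ih
      (G := fun p => fderiv ℝ G p ∘L ContinuousLinearMap.inl ℝ E ℝ) ?_, fun x =>
        hasFDerivAt_parametric_intervalIntegral hG a b x⟩
    exact (hG.fderiv_right (by simp)).clm_comp contDiff_const

theorem contDiff_parametric_intervalIntegral {F : Type} [NormedAddCommGroup F] [NormedSpace ℝ F]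
    {G : E × ℝ → F} (hG : ContDiff ℝ smoothExp G) (a b : ℝ) :
    ContDiff ℝ smoothExp (fun x => ∫ t in a..b, G (x, t)) :=
  contDiff_infty.2 fun r => contDiff_parametric_intervalIntegral_nat a b r hG

end ParametricIntegral

/-! ### Contraction towards a point changes a function by a divergence. -/

section Divergence

variable {n : ℕ}

/-- The divergence of a vector field on the model space. -/
def divergence (Y : Model n → Model n) (y : Model n) : ℝ :=
  ∑ i, coord i (fderiv ℝ Y y (stdVec i))

/-- Contracting a function towards a point changes it by a divergence. -/
theorem exists_divergence_eq_sub {C : Set (Model (n + 1))} (hC : Convex ℝ C) (hCc : IsCompact C)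
    {w : Model (n + 1) → ℝ} (hw : ContDiff ℝ smoothExp w) (hwC : ∀ y ∉ C, w y = 0)
    {p : Model (n + 1)} (hp : p ∈ C) {N : Set (Model (n + 1))} (hN : N ∈ 𝓝 p) :
    ∃ (v : Model (n + 1) → ℝ) (Y : Model (n + 1) → Model (n + 1)),
      ContDiff ℝ smoothExp v ∧ ContDiff ℝ smoothExp Y ∧ (∀ y ∉ C, Y y = 0) ∧
      (∀ y, y ∉ C ∩ N → v y = 0) ∧ ∀ y, w y - v y = divergence Y y := by
  obtain ⟨ε, hε, hεN⟩ := Metric.mem_nhds_iff.1 hN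
  obtain ⟨R, hR⟩ := hCc.isBounded.subset_ball p
  -- Contracting by T ≥ 1 brings the ball of radius R around p, which contains C, into the ball of
  -- radius ε.
  set T : ℝ := 1 + |R| / ε with hT
  have hT1 : 1 ≤ T := by
    have : 0 ≤ |R| / ε := by positivity
    linarith
  have hT0 : 0 < T := by linarith
  have hRT : R / T < ε := by
    rw [div_lt_iff₀ hT0, hT, mul_add, mul_one, mul_div_cancel₀ _ hε.ne']
    linarith [le_abs_self R]
  -- In dimension D = 2n + 2 the rescaled function t^D w(p + t(y - p)) carries the same mass for all
  -- t > 0. Its t-derivative is the divergence of G(y, t)(y - p), to be integrated from 1 to T.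
  set G : Model (n + 1) × ℝ → ℝ := fun q => q.2 ^ (2 * n + 1) * w (p + q.2 • (q.1 - p)) with hG
  have hGs : ContDiff ℝ smoothExp G := by
    refine (contDiff_snd.pow _).mul (hw.comp ?_)
    exact contDiff_const.add (contDiff_snd.smul (contDiff_fst.sub contDiff_const))
  set h : Model (n + 1) → ℝ := fun x => ∫ t in (1 : ℝ)..T, G (x, t) with hh
  have hhs : ContDiff ℝ smoothExp h := contDiff_parametric_intervalIntegral hGs 1 T
  -- If w does not vanish at q = p + t(y - p), then q ∈ C and y lies on the segment from p to q.
  -- Convexity gives y ∈ C, and the distance to p has been divided by t.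
  have hmem : ∀ t : ℝ, 1 ≤ t → ∀ y, w (p + t • (y - p)) ≠ 0 →
      y ∈ C ∧ y ∈ Metric.ball p (R / t) := by
    intro t ht y hy
    have ht0 : 0 < t := by linarith
    have hq : p + t • (y - p) ∈ C := by
      by_contra hq
      exact hy (hwC _ hq)
    have e : y = p + t⁻¹ • (p + t • (y - p) - p) := by
      rw [add_sub_cancel_left, smul_smul, inv_mul_cancel₀ ht0.ne', one_smul, add_sub_cancel]
    constructor
    · have := hC.add_smul_sub_mem hp hq (t := t⁻¹) ⟨by positivity, inv_le_one_of_one_le₀ ht⟩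
      rwa [← e] at this
    · have := hR hq
      rw [Metric.mem_ball, dist_eq_norm, add_sub_cancel_left, norm_smul, Real.norm_eq_abs,
        abs_of_pos ht0] at this
      rw [Metric.mem_ball, dist_eq_norm, lt_div_iff₀ ht0, mul_comm]
      exact this
  refine ⟨fun y => T ^ (2 * n + 2) * w (p + T • (y - p)), fun y => -(h y • (y - p)), ?_, ?_, ?_,
    ?_, ?_⟩
  · exact contDiff_const.mul (hw.comp (contDiff_const.add
      ((contDiff_id.sub contDiff_const).const_smul T)))
  · exact (hhs.smul (contDiff_id.sub contDiff_const)).neg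
  · intro y hy
    have : h y = 0 := by
      rw [hh]
      refine (intervalIntegral.integral_congr (g := fun _ => 0) fun t ht => ?_).trans (by simp)
      rw [Set.uIcc_of_le hT1] at ht
      by_contra h0
      exact hy (hmem t ht.1 y fun h0' => h0 (by simp [hG, h0'])).1
    simp [this]
  · intro y hy
    by_contra h0
    have := hmem T hT1 y fun h0' => h0 (by simp [h0'])
    exact hy ⟨this.1, hεN (Metric.ball_subset_ball hRT.le this.2)⟩
  · intro y
    have hd : HasFDerivAt (fun y => -(h y • (y - p)))
        (-(h y • ContinuousLinearMap.id ℝ (Model (n + 1)) + (fderiv ℝ h y).smulRight (y - p))) y :=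
      (((hhs.differentiable (by simp) y).hasFDerivAt).smul ((hasFDerivAt_id y).sub_const p)).neg
    have hdiv : divergence (fun y => -(h y • (y - p))) y =
        -((2 * n + 2 : ℝ) * h y + fderiv ℝ h y (y - p)) := by
      rw [divergence, hd.fderiv]
      conv_rhs => rw [clm_eq_sum_stdVec (fderiv ℝ h y) (y - p)]
      have hone : ∀ i : Fin (2 * (n + 1)), (stdVec i : Model (n + 1)) i = 1 := fun i => by
        simp [stdVec]
      simp only [coord_apply, neg_apply, add_apply, smul_apply, PiLp.neg_apply, PiLp.add_apply,
        PiLp.smul_apply, ContinuousLinearMap.smulRight_apply, ContinuousLinearMap.id_apply,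
        smul_eq_mul, Finset.sum_neg_distrib, Finset.sum_add_distrib, hone, mul_one,
        Finset.sum_const, Finset.card_univ, Fintype.card_fin, nsmul_eq_mul]
      push_cast
      congr 1
      congr 1
      · ring
      · exact Finset.sum_congr rfl fun i _ => mul_comm _ _
    have hline : ∀ t : ℝ, HasDerivAt (fun t : ℝ => p + t • (y - p)) (y - p) t := fun t => by
      simpa using ((hasDerivAt_id t).smul_const (y - p)).const_add p
    -- The right-hand side is D·G plus the derivative of G along y - p, which is the divergence of
    -- G(y, t)(y - p) in y.
    have hder : ∀ t : ℝ, HasDerivAt (fun t : ℝ => t ^ (2 * n + 2) * w (p + t • (y - p)))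
        ((2 * n + 2 : ℝ) * G (y, t) + (fderiv ℝ G (y, t) ∘L
          ContinuousLinearMap.inl ℝ (Model (n + 1)) ℝ) (y - p)) t := by
      intro t
      have h₁ : HasDerivAt (fun t : ℝ => w (p + t • (y - p)))
          (fderiv ℝ w (p + t • (y - p)) (y - p)) t :=
        (hw.differentiable (by simp) _).hasFDerivAt.comp_hasDerivAt t (hline t)
      have h₂ : HasFDerivAt (fun x => G (x, t)) (fderiv ℝ G (y, t) ∘L
          ContinuousLinearMap.inl ℝ (Model (n + 1)) ℝ) y := by
        have h₁ : HasFDerivAt (fun x : Model (n + 1) => (x, t))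
          (ContinuousLinearMap.inl ℝ (Model (n + 1)) ℝ) y := hasFDerivAt_prodMk_left y t
        exact (hGs.differentiable (by simp) (y, t)).hasFDerivAt.comp y h₁
      have h₃ : HasFDerivAt (fun x : Model (n + 1) => p + t • (x - p))
          (t • ContinuousLinearMap.id ℝ (Model (n + 1))) y :=
        (((hasFDerivAt_id y).sub_const p).const_smul t).const_add p
      have h₅ : HasFDerivAt (fun x : Model (n + 1) => w (p + t • (x - p)))
          (fderiv ℝ w (p + t • (y - p)) ∘L (t • ContinuousLinearMap.id ℝ (Model (n + 1)))) y :=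
        (hw.differentiable (by simp) (p + t • (y - p))).hasFDerivAt.comp y h₃
      have h₄ : HasFDerivAt (fun x => G (x, t)) (t ^ (2 * n + 1) •
          (fderiv ℝ w (p + t • (y - p)) ∘L (t • ContinuousLinearMap.id ℝ (Model (n + 1))))) y :=
        h₅.const_mul (t ^ (2 * n + 1))
      rw [h₂.unique h₄]
      refine ((hasDerivAt_pow (2 * n + 2) t).fun_mul h₁).congr_deriv (Eq.symm ?_)
      change (2 * n + 2 : ℝ) * (t ^ (2 * n + 1) * w (p + t • (y - p))) +
        t ^ (2 * n + 1) * fderiv ℝ w (p + t • (y - p)) (t • (y - p)) = _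
      rw [map_smul, smul_eq_mul, show 2 * n + 2 - 1 = 2 * n + 1 from rfl]
      push_cast
      ring
    have hcont : Continuous fun t : ℝ => (2 * n + 2 : ℝ) * G (y, t) + (fderiv ℝ G (y, t) ∘L
          ContinuousLinearMap.inl ℝ (Model (n + 1)) ℝ) (y - p) := by
      have hc : Continuous fun t : ℝ => (y, t) := by fun_prop
      refine (continuous_const.mul (hGs.continuous.comp hc)).add ?_
      exact ((((hGs.continuous_fderiv (by simp)).comp hc).clm_comp continuous_const)).clm_apply
        continuous_const
    have hc : Continuous fun t : ℝ => (y, t) := by fun_prop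
    have hcf : Continuous fun t : ℝ => fderiv ℝ G (y, t) ∘L
          ContinuousLinearMap.inl ℝ (Model (n + 1)) ℝ :=
      ((hGs.continuous_fderiv (by simp)).comp hc).clm_comp continuous_const
    have hint := intervalIntegral.integral_eq_sub_of_hasDerivAt (a := 1) (b := T)
      (fun t _ => hder t) (hcont.intervalIntegrable _ _)
    have i₁ : IntervalIntegrable (fun t => (2 * n + 2 : ℝ) * G (y, t)) MeasureTheory.volume 1 T :=
      (continuous_const.mul (hGs.continuous.comp hc)).intervalIntegrable _ _
    have i₂ : IntervalIntegrable (fun t => (fderiv ℝ G (y, t) ∘L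
          ContinuousLinearMap.inl ℝ (Model (n + 1)) ℝ) (y - p)) MeasureTheory.volume 1 T :=
      (hcf.clm_apply continuous_const).intervalIntegrable _ _
    rw [intervalIntegral.integral_add i₁ i₂,
      intervalIntegral.integral_const_mul] at hint
    have hfd : fderiv ℝ h y (y - p) = ∫ t in (1 : ℝ)..T, (fderiv ℝ G (y, t) ∘L
          ContinuousLinearMap.inl ℝ (Model (n + 1)) ℝ) (y - p) := by
      rw [(hasFDerivAt_parametric_intervalIntegral hGs 1 T y).fderiv]
      exact ContinuousLinearMap.intervalIntegral_apply (hcf.intervalIntegrable _ _) _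
    rw [hdiv, hfd]
    change _ = -((2 * n + 2 : ℝ) * (∫ t in (1 : ℝ)..T, G (y, t)) + _)
    rw [hint]
    simp

end Divergence

/-! ### In a chart, δ is a divergence up to the volume density. -/

section LocalDivergence

variable {n : ℕ} {ω : Model (n + 1) → Cov (n + 1) 2} {U : Set (Model (n + 1))}

theorem extDeriv_intProd_const {n k : ℕ} (hk : k + 1 = 2 * n) (Θ : Cov n (k + 1))
    {Y : Model n → Model n} {y : Model n} (hY : DifferentiableAt ℝ Y y) :
    extDeriv (fun z => intProd (Y z) Θ) y = divergence Y y • Θ := by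
  have h : fderiv ℝ (fun z => intProd (Y z) Θ) y = curryCLM n k Θ ∘L fderiv ℝ Y y :=
    ((curryCLM n k Θ).hasFDerivAt.comp y hY.hasFDerivAt).fderiv
  rw [extDeriv_eq_sum, h, divergence, Finset.sum_smul]
  refine Finset.sum_congr rfl fun i _ => ?_
  exact covectorWedge_intProd_of_top hk (coord i) (fderiv ℝ Y y (stdVec i)) Θ

/-- A density for the volume form of a symplectic form on an open subset of the model space. -/
theorem LocalSymplectic.exists_density (hω : LocalSymplectic ω U) :
    ∃ (Θ : Cov (n + 1) (2 * n + 2)) (ρ : Model (n + 1) → ℝ), ContDiffOn ℝ smoothExp ρ U ∧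
      ∀ y ∈ U, ρ y ≠ 0 ∧ expForm (ω y) (2 * n + 2) = ρ y • Θ := by
  rcases U.eq_empty_or_nonempty with rfl | ⟨y₀, hy₀⟩
  · exact ⟨0, 0, contDiffOn_empty, by simp⟩
  set Θ := expForm (ω y₀) (2 * n + 2) with hΘ
  have hΘ0 : Θ ≠ 0 := expForm_top_ne_zero (hω.nondeg y₀ hy₀)
  obtain ⟨v, hv⟩ : ∃ v, Θ v ≠ 0 := by
    by_contra! h
    exact hΘ0 (by ext v; exact h v)
  refine ⟨Θ, fun y => expForm (ω y) (2 * n + 2) v / Θ v, ?_, fun y hy => ?_⟩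
  · exact ((ContinuousAlternatingMap.apply ℝ (Model (n + 1)) ℝ v).contDiff.comp_contDiffOn
      (hω.contDiffOn_expForm _)).div_const _
  · obtain ⟨c, hc⟩ := exists_eq_smul_of_top (k := 2 * n + 2) (by ring) hΘ0
      (expForm (ω y) (2 * n + 2))
    have hcv : expForm (ω y) (2 * n + 2) v / Θ v = c := by
      rw [hc, ContinuousAlternatingMap.smul_apply, smul_eq_mul, mul_div_cancel_right₀ _ hv]
    simp only [hcv]
    refine ⟨?_, hc⟩
    rintro rfl
    rw [zero_smul] at hc
    exact expForm_top_ne_zero (hω.nondeg y hy) hc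

/-- The star of i_Zω is i_Z vol. For vol = ρΘ with Θ constant and Z = ρ⁻¹Y this is i_YΘ, whose
differential is div(Y) Θ = ρ⁻¹ div(Y) vol. -/
theorem LocalSymplectic.starCov_extDeriv_starCov_intProd (hω : LocalSymplectic ω U)
    {Θ : Cov (n + 1) (2 * n + 2)} {ρ : Model (n + 1) → ℝ}
    (hρ : ∀ y ∈ U, ρ y ≠ 0 ∧ expForm (ω y) (2 * n + 2) = ρ y • Θ)
    {Y : Model (n + 1) → Model (n + 1)} (hY : ContDiffOn ℝ smoothExp Y U) {y : Model (n + 1)}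
    (hy : y ∈ U) :
    starCov (ω y) (2 * n + 2) 0 (extDeriv
      (fun z => starCov (ω z) 1 (2 * n + 1) (intProd ((ρ z)⁻¹ • Y z) (ω z))) y) =
      constForm ((ρ y)⁻¹ * divergence Y y) := by
  have e : Set.EqOn (fun z => starCov (ω z) 1 (2 * n + 1) (intProd ((ρ z)⁻¹ • Y z) (ω z)))
      (fun z => intProd (Y z) Θ) U := fun z hz => by
    change starCov (ω z) 1 (2 * n + 1) (intProd ((ρ z)⁻¹ • Y z) (ω z)) = _
    rw [intProd_two, starCov_one, sharp_toBilin (hω.nondeg z hz), (hρ z hz).2, intProd_smul,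
      map_smul, smul_smul, inv_mul_cancel₀ (hρ z hz).1, one_smul]
  have hΘ : Θ = (ρ y)⁻¹ • expForm (ω y) (2 * n + 2) := by
    rw [(hρ y hy).2, smul_smul, inv_mul_cancel₀ (hρ y hy).1, one_smul]
  rw [extDeriv_congr_of_eqOn hω.isOpen e hy, extDeriv_intProd_const (by ring) Θ
    (differentiableAt_of_contDiffOn hω.isOpen hY hy), hΘ, smul_smul, starCov_smul,
    starCov_top (hω.nondeg y hy), ← constForm_eq_smul, mul_comm]

end LocalDivergence

/-! ### Smooth functions as 0-forms; locality of smoothness and of d. -/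

section Functions

variable {n k : ℕ} {X : Type*} [TopologicalSpace X] [ChartedSpace (Model n) X]

/-- The function given by a `0`-form. -/
def formFn (f : Form n X 0) (x : X) : ℝ := f.1 x ![]

/-- Evaluation of forms at a point. -/
def evalAt (x : X) : Form n X k →ₗ[ℝ] Cov n k where
  toFun α := α.1 x
  map_add' _ _ := rfl
  map_smul' _ _ := rfl

theorem eq_constForm_formFn (f : Form n X 0) (x : X) : f.1 x = constForm (formFn f x) :=
  eq_constForm _

variable [IsManifold (𝓡 (2 * n)) ((⊤ : ℕ∞) : WithTop ℕ∞) X]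

theorem contDiffOn_comp_chart_symm {F : Type*} [NormedAddCommGroup F] [NormedSpace ℝ F] {f : X → F}
    (hf : ContMDiff (𝓡 (2 * n)) 𝓘(ℝ, F) smoothExp f) (c : X) :
    ContDiffOn ℝ smoothExp (fun y => f ((chartAt (Model n) c).symm y))
      (chartAt (Model n) c).target := by
  rw [← contMDiffOn_iff_contDiffOn]
  exact hf.comp_contMDiffOn contMDiffOn_chart_symm

theorem contMDiffAt_comp_chart {F : Type*} [NormedAddCommGroup F] [NormedSpace ℝ F] {c x : X}
    (hx : x ∈ (chartAt (Model n) c).source) {u : Model n → F}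
    (hu : ContDiffAt ℝ smoothExp u (chartAt (Model n) c x)) :
    ContMDiffAt (𝓡 (2 * n)) 𝓘(ℝ, F) smoothExp (fun x => u (chartAt (Model n) c x)) x :=
  ContMDiffAt.comp (I' := 𝓡 (2 * n)) x hu.contMDiffAt
    (contMDiffOn_chart.contMDiffAt ((chartAt (Model n) c).open_source.mem_nhds hx))

/-- A smooth function as a `0`-form. -/
def ofFn (f : X → ℝ) (hf : ContMDiff (𝓡 (2 * n)) 𝓘(ℝ, ℝ) smoothExp f) : Form n X 0 :=
  ⟨fun x => constForm (f x), fun c => by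
    refine ((contDiffOn_comp_chart_symm hf c).smul
      (contDiffOn_const (c := (constForm 1 : Cov n 0)))).congr fun y _ => ?_
    exact constForm_eq_smul _⟩

theorem contMDiff_formFn (f : Form n X 0) : ContMDiff (𝓡 (2 * n)) 𝓘(ℝ, ℝ) smoothExp (formFn f) := by
  intro x
  have h := contMDiffAt_comp_chart (mem_chart_source (Model n) x)
    ((contDiffOn_localFn x f).contDiffAt ((chartAt (Model n) x).open_target.mem_nhds
      (mem_chart_target _ x)))
  refine h.congr_of_eventuallyEq ?_
  filter_upwards [(chartAt (Model n) x).open_source.mem_nhds (mem_chart_source _ x)] with z hz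
  rw [localFn_eq, (chartAt (Model n) x).left_inv hz, formFn]

theorem isSmoothForm_of_contDiffAt {α : RoughForm n X k}
    (h : ∀ c : X, ∀ y ∈ (chartAt (Model n) c).target, ContDiffAt ℝ smoothExp (localRep c α) y) :
    IsSmoothForm α := fun c y hy => (h c y hy).contDiffWithinAt

theorem localRep_eventuallyEq {α β : RoughForm n X k} {c : X} {y : Model n}
    (hy : y ∈ (chartAt (Model n) c).target)
    (h : ∀ᶠ z in 𝓝 ((chartAt (Model n) c).symm y), α z = β z) :
    localRep c α =ᶠ[𝓝 y] localRep c β := by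
  filter_upwards [((chartAt (Model n) c).continuousAt_symm hy).eventually h] with z hz
  rw [localRep, localRep, hz]

theorem isSmoothForm_of_eventuallyEq {α : RoughForm n X k}
    (h : ∀ x, ∃ β : Form n X k, ∀ᶠ z in 𝓝 x, α z = β.1 z) : IsSmoothForm α := by
  refine isSmoothForm_of_contDiffAt fun c y hy => ?_
  obtain ⟨β, hβ⟩ := h ((chartAt (Model n) c).symm y)
  exact ((β.2 c).contDiffAt ((chartAt (Model n) c).open_target.mem_nhds hy)).congr_of_eventuallyEq
    (localRep_eventuallyEq hy hβ)

theorem d_congr {α β : Form n X k} {x : X} (h : ∀ᶠ z in 𝓝 x, α.1 z = β.1 z) :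
    (d α).1 x = (d β).1 x := by
  have hx := mem_chart_source (Model n) x
  rw [eq_pull_localRep x (d α).1 hx, eq_pull_localRep x (d β).1 hx,
    localRep_d _ x (mem_chart_target _ x), localRep_d _ x (mem_chart_target _ x)]
  congr 1
  refine Filter.EventuallyEq.extDeriv_eq (localRep_eventuallyEq (mem_chart_target _ x) ?_)
  rwa [(chartAt (Model n) x).left_inv hx]

end Functions

/-! ### Locally finite sums of forms. -/

section Sums

variable {n k : ℕ} {X : Type*} [TopologicalSpace X] [ChartedSpace (Model n) X] {ι : Type*}

theorem exists_finset_eventually_eq_zero {S : ι → Set X} (hS : LocallyFinite S)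
    {α : ι → Form n X k} (hα : ∀ i, ∀ x ∉ S i, (α i).1 x = 0) (x : X) :
    ∃ s : Finset ι, ∀ᶠ z in 𝓝 x, ∀ i ∉ s, (α i).1 z = 0 := by
  obtain ⟨U, hU, hfin⟩ := hS x
  refine ⟨hfin.toFinset, ?_⟩
  filter_upwards [hU] with z hz i hi
  refine hα i z fun hzS => hi ?_
  exact hfin.mem_toFinset.2 ⟨z, hzS, hz⟩

theorem finsum_eq_evalAt_sum {α : ι → Form n X k} {s : Finset ι} {x : X}
    (h : ∀ i ∉ s, (α i).1 x = 0) : ∑ᶠ i, (α i).1 x = (∑ i ∈ s, α i : Form n X k).1 x := by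
  rw [finsum_eq_sum_of_support_subset (s := s) _ fun i hi => by
    by_contra his
    exact hi (h i his)]
  exact (map_sum (evalAt x) α s).symm

variable [IsManifold (𝓡 (2 * n)) ((⊤ : ℕ∞) : WithTop ℕ∞) X]

/-- The sum of a locally finite family of forms. -/
def sumForm {S : ι → Set X} (hS : LocallyFinite S) (α : ι → Form n X k)
    (hα : ∀ i, ∀ x ∉ S i, (α i).1 x = 0) : Form n X k :=
  ⟨fun x => ∑ᶠ i, (α i).1 x, isSmoothForm_of_eventuallyEq fun x => by
    obtain ⟨s, hs⟩ := exists_finset_eventually_eq_zero hS hα x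
    exact ⟨∑ i ∈ s, α i, hs.mono fun z hz => finsum_eq_evalAt_sum hz⟩⟩

end Sums

/-! ### Extension by zero from a chart. -/

section Extension

variable {n : ℕ} {X : Type*} [TopologicalSpace X] [ChartedSpace (Model n) X]

variable (n) in
/-- The identification of covectors with alternating one-forms. -/
def oneFormCLM : (Model n →L[ℝ] ℝ) →L[ℝ] Cov n 1 :=
  altCLM n 0 ∘L (ContinuousLinearMap.smulRightL ℝ (Model n) (Cov n 0)).flip (constForm 1)

theorem oneFormCLM_apply (ξ : Model n →L[ℝ] ℝ) : oneFormCLM n ξ = oneForm ξ := rfl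

theorem pull_oneForm (A : Model n →L[ℝ] Model n) (ξ : Model n →L[ℝ] ℝ) :
    pull A (oneForm ξ) = oneForm (ξ ∘L A) := (covectorWedge_pull A ξ (constForm 1)).symm

open Classical in
/-- The extension by zero of a one-form on a chart. -/
def extendOneForm (c : X) (ξ : Model n → Model n →L[ℝ] ℝ) : RoughForm n X 1 := fun x =>
  if x ∈ (chartAt (Model n) c).source then
    oneForm (ξ (chartAt (Model n) c x) ∘L chartDeriv c x) else 0

open Classical in
/-- The extension by zero of a function on a chart. -/
def extendFn (c : X) (u : Model n → ℝ) (x : X) : ℝ :=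
  if x ∈ (chartAt (Model n) c).source then u (chartAt (Model n) c x) else 0

theorem extendFn_of_mem {c x : X} (u : Model n → ℝ) (hx : x ∈ (chartAt (Model n) c).source) :
    extendFn c u x = u (chartAt (Model n) c x) := if_pos hx

theorem extendOneForm_of_mem {c x : X} (ξ : Model n → Model n →L[ℝ] ℝ)
    (hx : x ∈ (chartAt (Model n) c).source) :
    extendOneForm c ξ x = oneForm (ξ (chartAt (Model n) c x) ∘L chartDeriv c x) := if_pos hx

theorem extendFn_eq_zero {c x : X} {u : Model n → ℝ} {K : Set (Model n)} (hu : ∀ y ∉ K, u y = 0)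
    (hx : x ∉ (chartAt (Model n) c).symm '' K) : extendFn c u x = 0 := by
  by_cases hxs : x ∈ (chartAt (Model n) c).source
  · rw [extendFn_of_mem _ hxs]
    exact hu _ fun h => hx ⟨_, h, (chartAt (Model n) c).left_inv hxs⟩
  · exact if_neg hxs

theorem extendOneForm_eq_zero {c x : X} {ξ : Model n → Model n →L[ℝ] ℝ} {K : Set (Model n)}
    (hξ : ∀ y ∉ K, ξ y = 0) (hx : x ∉ (chartAt (Model n) c).symm '' K) :
    extendOneForm c ξ x = 0 := by
  by_cases hxs : x ∈ (chartAt (Model n) c).source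
  · rw [extendOneForm_of_mem _ hxs,
      hξ _ fun h => hx ⟨_, h, (chartAt (Model n) c).left_inv hxs⟩, ContinuousLinearMap.zero_comp]
    exact map_zero (oneFormCLM n)
  · exact if_neg hxs

/-- The Hausdorff property enters here: an extension by zero vanishes on the open complement of this
set, hence is smooth at points outside the chart. -/
theorem isClosed_chart_symm_image [T2Space X] {c : X} {K : Set (Model n)} (hK : IsCompact K)
    (hKt : K ⊆ (chartAt (Model n) c).target) : IsClosed ((chartAt (Model n) c).symm '' K) :=
  (hK.image_of_continuousOn ((chartAt (Model n) c).continuousOn_symm.mono hKt)).isClosed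

theorem chart_symm_image_subset {c : X} {K : Set (Model n)}
    (hKt : K ⊆ (chartAt (Model n) c).target) :
    (chartAt (Model n) c).symm '' K ⊆ (chartAt (Model n) c).source := by
  rintro _ ⟨y, hy, rfl⟩
  exact (chartAt (Model n) c).map_target (hKt hy)

variable [IsManifold (𝓡 (2 * n)) ((⊤ : ℕ∞) : WithTop ℕ∞) X]

theorem localRep_extendOneForm (c : X) (ξ : Model n → Model n →L[ℝ] ℝ) {y : Model n}
    (hy : y ∈ (chartAt (Model n) c).target) :
    localRep c (extendOneForm c ξ) y = oneForm (ξ y) := by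
  rw [localRep, extendOneForm_of_mem _ ((chartAt (Model n) c).map_target hy),
    (chartAt (Model n) c).right_inv hy, pull_oneForm, ContinuousLinearMap.comp_assoc,
    chartDeriv_comp c hy, ContinuousLinearMap.comp_id]

variable [T2Space X]

theorem contMDiff_extendFn {c : X} {u : Model n → ℝ} {K : Set (Model n)} (hK : IsCompact K)
    (hKt : K ⊆ (chartAt (Model n) c).target)
    (hu : ContDiffOn ℝ smoothExp u (chartAt (Model n) c).target) (huK : ∀ y ∉ K, u y = 0) :
    ContMDiff (𝓡 (2 * n)) 𝓘(ℝ, ℝ) smoothExp (extendFn c u) := by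
  intro x
  by_cases hx : x ∈ (chartAt (Model n) c).source
  · refine (contMDiffAt_comp_chart hx (hu.contDiffAt ((chartAt (Model n) c).open_target.mem_nhds
      ((chartAt (Model n) c).map_source hx)))).congr_of_eventuallyEq ?_
    filter_upwards [(chartAt (Model n) c).open_source.mem_nhds hx] with z hz
    exact extendFn_of_mem u hz
  · refine (contMDiffAt_const (c := (0 : ℝ))).congr_of_eventuallyEq ?_
    filter_upwards [(isClosed_chart_symm_image hK hKt).isOpen_compl.mem_nhds
      fun h => hx (chart_symm_image_subset hKt h)] with z hz
    exact extendFn_eq_zero huK hz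

theorem isSmoothForm_extendOneForm {c : X} {ξ : Model n → Model n →L[ℝ] ℝ} {K : Set (Model n)}
    (hK : IsCompact K) (hKt : K ⊆ (chartAt (Model n) c).target)
    (hξ : ContDiffOn ℝ smoothExp ξ (chartAt (Model n) c).target) (hξK : ∀ y ∉ K, ξ y = 0) :
    IsSmoothForm (extendOneForm c ξ) := by
  refine isSmoothForm_of_contDiffAt fun c' y hy => ?_
  -- Inside the chart around c the expression is a pullback under a transition map; outside it the
  -- form vanishes nearby.
  by_cases hx : (chartAt (Model n) c').symm y ∈ (chartAt (Model n) c).source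
  · set T := chartAt (Model n) c ∘ (chartAt (Model n) c').symm with hT
    have hTs : ContDiffAt ℝ smoothExp T y := contDiffAt_transition c' c hy hx
    have h₁ : ContDiffAt ℝ smoothExp (fun z => oneFormCLM n (ξ (T z) ∘L fderiv ℝ T z)) y := by
      refine (oneFormCLM n).contDiff.contDiffAt.comp y (ContDiffAt.clm_comp ?_ ?_)
      · refine ContDiffAt.comp y (hξ.contDiffAt ((chartAt (Model n) c).open_target.mem_nhds ?_)) hTs
        exact (chartAt (Model n) c).map_source hx
      · exact hTs.fderiv_right (by simp)
    refine h₁.congr_of_eventuallyEq ?_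
    filter_upwards [(chartAt (Model n) c').open_target.mem_nhds hy,
      ((chartAt (Model n) c').continuousAt_symm hy).preimage_mem_nhds
        ((chartAt (Model n) c).open_source.mem_nhds hx)] with z hz hz'
    rw [localRep_transition c' c _ hz hz',
      localRep_extendOneForm c ξ ((chartAt (Model n) c).map_source hz'), pull_oneForm]
    rfl
  · refine (contDiffAt_const (c := (0 : Cov n 1))).congr_of_eventuallyEq
      (localRep_eventuallyEq (β := 0) hy ?_)
    filter_upwards [(isClosed_chart_symm_image hK hKt).isOpen_compl.mem_nhds
      fun h => hx (chart_symm_image_subset hKt h)] with z hz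
    exact extendOneForm_eq_zero hξK hz

end Extension

/-! ### Locality of δ and locally finite sums. -/

section Homology

variable {n : ℕ} {X : Type*} [TopologicalSpace X] [ChartedSpace (Model (n + 1)) X]
  [IsManifold (𝓡 (2 * (n + 1))) ((⊤ : ℕ∞) : WithTop ℕ∞) X] (ω : SymplecticForm (n + 1) X)

theorem δ_zero_congr {α β : Form (n + 1) X 1} {x : X} (h : ∀ᶠ z in 𝓝 x, α.1 z = β.1 z) :
    (δ ω 0 α).1 x = (δ ω 0 β).1 x := by
  have hx := mem_chart_source (Model (n + 1)) x
  have ht := mem_chart_target (Model (n + 1)) x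
  rw [eq_pull_localRep x (δ ω 0 α).1 hx, eq_pull_localRep x (δ ω 0 β).1 hx,
    localRep_δ_zero ω _ x ht, localRep_δ_zero ω _ x ht]
  congr 2
  refine Filter.EventuallyEq.extDeriv_eq ?_
  have h' : ∀ᶠ z in 𝓝 ((chartAt (Model (n + 1)) x).symm (chartAt (Model (n + 1)) x x)),
      α.1 z = β.1 z := by rwa [(chartAt (Model (n + 1)) x).left_inv hx]
  filter_upwards [localRep_eventuallyEq ht h'] with z hz
  rw [hz]

theorem δ_sumForm {ι : Type*} {S : ι → Set X} (hS : LocallyFinite S) (α : ι → Form (n + 1) X 1)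
    (hα : ∀ i, ∀ x ∉ S i, (α i).1 x = 0) (x : X) :
    (δ ω 0 (sumForm hS α hα)).1 x = ∑ᶠ i, (δ ω 0 (α i)).1 x := by
  obtain ⟨s, hs⟩ := exists_finset_eventually_eq_zero hS hα x
  have h₁ : ∀ i ∉ s, (δ ω 0 (α i)).1 x = 0 := fun i hi => by
    rw [δ_zero_congr ω (β := 0) (hs.mono fun z hz => hz i hi), map_zero]
    rfl
  rw [δ_zero_congr ω (β := ∑ i ∈ s, α i) (hs.mono fun z hz => finsum_eq_evalAt_sum hz),
    finsum_eq_evalAt_sum h₁, map_sum]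

end Homology

/-! ### Moving the support of a function within one chart. -/

section Localization

variable {n : ℕ} {X : Type*} [TopologicalSpace X] [ChartedSpace (Model (n + 1)) X]
  [IsManifold (𝓡 (2 * (n + 1))) ((⊤ : ℕ∞) : WithTop ℕ∞) X] [T2Space X]
  (ω : SymplecticForm (n + 1) X)

theorem pull_constForm {n : ℕ} (A : Model n →L[ℝ] Model n) (r : ℝ) :
    pull A (constForm r) = constForm r := rfl

/-- Up to the image of the canonical homology operator, a function supported in a convex subset
of a chart can be moved to a neighbourhood of any point of this set. -/
theorem exists_sub_eq_δ_of_chart {c : X} {C : Set (Model (n + 1))} (hC : Convex ℝ C)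
    (hCc : IsCompact C) (hCt : C ⊆ (chartAt (Model (n + 1)) c).target) (u : Form (n + 1) X 0)
    (hu : ∀ x ∉ (chartAt (Model (n + 1)) c).symm '' C, formFn u x = 0) {p : Model (n + 1)}
    (hp : p ∈ C) {N : Set X} (hN : N ∈ 𝓝 ((chartAt (Model (n + 1)) c).symm p)) :
    ∃ (v : Form (n + 1) X 0) (α : Form (n + 1) X 1),
      (∀ x ∉ (chartAt (Model (n + 1)) c).symm '' C, α.1 x = 0) ∧
      (∀ x ∉ (chartAt (Model (n + 1)) c).symm '' C, v.1 x = 0) ∧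
      (∀ x ∉ N, v.1 x = 0) ∧ u - v = δ ω 0 α := by
  classical
  set φ := chartAt (Model (n + 1)) c with hφ
  have hl := ω.localSymplectic c
  obtain ⟨Θ, ρ, hρs, hρ⟩ := hl.exists_density
  -- The density of u · vol with respect to the constant form Θ: this is what is moved by a
  -- divergence, not u itself.
  set w : Model (n + 1) → ℝ := fun y => if y ∈ φ.target then ρ y * localFn c u.1 y else 0 with hw
  have hwt : ∀ y ∈ φ.target, w y = ρ y * localFn c u.1 y := fun y hy => if_pos hy
  have hwC : ∀ y ∉ C, w y = 0 := by
    intro y hy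
    by_cases hyt : y ∈ φ.target
    · rw [hwt y hyt, localFn_eq, show u.1 (φ.symm y) ![] = 0 from hu _ ?_, mul_zero]
      rintro ⟨z, hz, hzy⟩
      exact hy (φ.symm.injOn (hCt hz) hyt hzy ▸ hz)
    · exact if_neg hyt
  have hws : ContDiff ℝ smoothExp w := by
    refine contDiff_iff_contDiffAt.2 fun y => ?_
    by_cases hy : y ∈ φ.target
    · refine (((hρs.mul (contDiffOn_localFn c u)).contDiffAt
        (φ.open_target.mem_nhds hy))).congr_of_eventuallyEq ?_
      filter_upwards [φ.open_target.mem_nhds hy] with z hz using hwt z hz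
    · refine (contDiffAt_const (c := (0 : ℝ))).congr_of_eventuallyEq ?_
      filter_upwards [hCc.isClosed.isOpen_compl.mem_nhds fun h => hy (hCt h)] with z hz using
        hwC z hz
  obtain ⟨v, Y, hv, hY, hYC, hvC, hdiv⟩ := exists_divergence_eq_sub hC hCc hws hwC hp
    ((φ.continuousAt_symm (hCt hp)).preimage_mem_nhds hN)
  have hρi : ContDiffOn ℝ smoothExp (fun y => (ρ y)⁻¹) φ.target :=
    hρs.inv fun y hy => (hρ y hy).1
  have hvC' : ∀ y ∉ C, (ρ y)⁻¹ * v y = 0 := fun y hy => by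
    rw [hvC y fun h => hy h.1, mul_zero]
  -- The one-form i_Zω with Z = ρ⁻¹Y; its image under δ is ρ⁻¹ div Y, the difference of the two
  -- functions.
  set ξ : Model (n + 1) → Model (n + 1) →L[ℝ] ℝ :=
    fun y => toBilin (localRep c ω.form.1 y) ((ρ y)⁻¹ • Y y) with hξ
  have hξC : ∀ y ∉ C, ξ y = 0 := fun y hy => by
    simp only [hξ, hYC y hy, smul_zero, map_zero]
  have hξs : ContDiffOn ℝ smoothExp ξ φ.target :=
    (contDiffOn_toBilin (ω.form.2 c)).clm_apply (hρi.smul hY.contDiffOn)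
  refine ⟨ofFn (extendFn c fun y => (ρ y)⁻¹ * v y)
    (contMDiff_extendFn hCc hCt (hρi.mul hv.contDiffOn) hvC'),
    ⟨extendOneForm c ξ, isSmoothForm_extendOneForm hCc hCt hξs hξC⟩,
    fun x hx => extendOneForm_eq_zero hξC hx, fun x hx => ?_, fun x hx => ?_, ?_⟩
  · change constForm (extendFn c _ x) = 0
    rw [extendFn_eq_zero hvC' hx]
    rfl
  · have : extendFn c (fun y => (ρ y)⁻¹ * v y) x = 0 := by
      by_cases hxs : x ∈ φ.source
      · rw [extendFn_of_mem _ hxs, hvC _ fun h => hx ?_, mul_zero]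
        have := h.2
        rwa [Set.mem_preimage, φ.left_inv hxs] at this
      · exact if_neg hxs
    change constForm (extendFn c _ x) = 0
    rw [this]
    rfl
  · refine Subtype.ext (funext fun x => ?_)
    by_cases hx : x ∈ φ.source
    · have hy := φ.map_source hx
      rw [eq_pull_localRep c (δ ω 0 _).1 hx, localRep_δ_zero ω _ c hy]
      have e : Set.EqOn (fun z => starCov (localRep c ω.form.1 z) 1 (2 * n + 1)
          (localRep c (extendOneForm c ξ) z)) (fun z => starCov (localRep c ω.form.1 z) 1
          (2 * n + 1) (intProd ((ρ z)⁻¹ • Y z) (localRep c ω.form.1 z))) φ.target := by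
        intro z hz
        change starCov _ _ _ _ = starCov _ _ _ _
        rw [localRep_extendOneForm c ξ hz, intProd_two]
      rw [extDeriv_congr_of_eqOn φ.open_target e hy,
        hl.starCov_extDeriv_starCov_intProd hρ hY.contDiffOn hy, pull_constForm, ← hdiv,
        hwt _ hy, mul_sub, inv_mul_cancel_left₀ (hρ _ hy).1, localFn_eq, φ.left_inv hx]
      refine (eq_constForm_formFn (n := n + 1) _ x).trans (congrArg constForm ?_)
      change u.1 x ![] - extendFn c (fun y => (ρ y)⁻¹ * v y) x = _
      rw [extendFn_of_mem _ hx]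
    · have hxC : x ∉ φ.symm '' C := fun h => hx (chart_symm_image_subset hCt h)
      rw [δ_zero_congr ω (β := 0), map_zero]
      · refine (eq_constForm_formFn (n := n + 1) _ x).trans ((congrArg constForm ?_).trans
          (eq_constForm_formFn (0 : Form (n + 1) X 0) x).symm)
        change formFn u x - extendFn c (fun y => (ρ y)⁻¹ * v y) x = 0
        rw [hu x hxC, extendFn_eq_zero hvC' hxC, sub_zero]
      · filter_upwards [(isClosed_chart_symm_image hCc hCt).isOpen_compl.mem_nhds hxC] with z hz
        exact extendOneForm_eq_zero hξC hz

end Localization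

/-! ### Locally finite families of closed coordinate balls. -/

section Covering

variable {n : ℕ} {X : Type*} [TopologicalSpace X] [ChartedSpace (Model n) X] {ι : Type*}

/-- The closed coordinate ball belonging to a bump function. -/
def bumpBall (B : SmoothBumpCovering ι (𝓡 (2 * n)) X) (k : ι) : Set X :=
  (chartAt (Model n) (B.c k)).symm ''
    Metric.closedBall (chartAt (Model n) (B.c k) (B.c k)) (B k).rOut

theorem closedBall_subset_target (B : SmoothBumpCovering ι (𝓡 (2 * n)) X) (k : ι) :
    Metric.closedBall (chartAt (Model n) (B.c k) (B.c k)) (B k).rOut ⊆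
      (chartAt (Model n) (B.c k)).target := by
  have := (B k).closedBall_subset
  simpa using this

theorem support_subset_bumpBall (B : SmoothBumpCovering ι (𝓡 (2 * n)) X) (k : ι) :
    Function.support (B k) ⊆ bumpBall B k := by
  rw [(B k).support_eq_symm_image]
  rintro _ ⟨y, hy, rfl⟩
  exact ⟨y, Metric.ball_subset_closedBall hy.1, rfl⟩

/-- By continuity of the inverse chart, the closed ball lies in the closure of the image of the open
ball, which is the support of the bump function. Closures of a locally finite family are locally
finite. -/
theorem locallyFinite_bumpBall (B : SmoothBumpCovering ι (𝓡 (2 * n)) X) :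
    LocallyFinite (bumpBall B) := by
  refine B.locallyFinite.closure.subset fun k => ?_
  rw [(B k).support_eq_symm_image, bumpBall, ← closure_ball _ (B k).rOut_pos.ne']
  refine (ContinuousOn.image_closure ?_).trans (closure_mono ?_)
  · rw [closure_ball _ (B k).rOut_pos.ne']
    exact (chartAt (Model n) (B.c k)).continuousOn_symm.mono (closedBall_subset_target B k)
  · rintro _ ⟨y, hy, rfl⟩
    exact ⟨y, ⟨hy, by simp⟩, rfl⟩

theorem isCompact_bumpBall (B : SmoothBumpCovering ι (𝓡 (2 * n)) X) (k : ι) :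
    IsCompact (bumpBall B k) :=
  (isCompact_closedBall _ _).image_of_continuousOn
    ((chartAt (Model n) (B.c k)).continuousOn_symm.mono (closedBall_subset_target B k))

end Covering

/-! ### Moving the support of a function on the whole manifold. -/

section Moving

variable {n : ℕ} {X : Type*} [TopologicalSpace X] [ChartedSpace (Model (n + 1)) X]
  [IsManifold (𝓡 (2 * (n + 1))) ((⊤ : ℕ∞) : WithTop ℕ∞) X] [T2Space X]
  (ω : SymplecticForm (n + 1) X) {ι : Type*} (B : SmoothBumpCovering ι (𝓡 (2 * (n + 1))) X)

/-- Up to the image of the canonical homology operator, every function is supported in a given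
neighbourhood of a set that meets all the coordinate balls of a covering. -/
theorem exists_sub_eq_δ {p : ι → X} (hp : ∀ k, p k ∈ bumpBall B k) {U : Set X}
    (hU : IsOpen U) (hpU : ∀ k, p k ∈ U) (f : Form (n + 1) X 0) :
    ∃ (v : Form (n + 1) X 0) (α : Form (n + 1) X 1), (∀ x ∉ U, v.1 x = 0) ∧ f - v = δ ω 0 α := by
  have hS := locallyFinite_bumpBall B
  set R := B.toSmoothPartitionOfUnity
  -- Each piece of f cut off by the partition of unity is moved towards its own marked point inside
  -- its own ball. Both the moved pieces and the one-forms α_k stay in the balls, so their sums are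
  -- locally finite.
  set u : ι → Form (n + 1) X 0 := fun k => mulForm (ofFn (R k) (R k).contMDiff) f with hu
  have hux : ∀ k x, (u k).1 x = R k x • f.1 x := fun k x => rfl
  have hR : ∀ k, ∀ x ∉ bumpBall B k, R k x = 0 := fun k x hx =>
    Function.notMem_support.1 fun h =>
      hx (support_subset_bumpBall B k (B.support_toSmoothPartitionOfUnity_subset k h))
  have hu0 : ∀ k, ∀ x ∉ bumpBall B k, (u k).1 x = 0 := fun k x hx => by
    rw [hux, hR k x hx]
    exact zero_smul _ _
  have key : ∀ k, ∃ (v : Form (n + 1) X 0) (α : Form (n + 1) X 1),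
      (∀ x ∉ bumpBall B k, α.1 x = 0) ∧ (∀ x ∉ bumpBall B k, v.1 x = 0) ∧
      (∀ x ∉ U, v.1 x = 0) ∧ u k - v = δ ω 0 α := by
    intro k
    obtain ⟨q, hq, hqp⟩ := hp k
    refine exists_sub_eq_δ_of_chart ω (convex_closedBall _ _) (isCompact_closedBall _ _)
      (closedBall_subset_target B k) (u k) (fun x hx => ?_) hq (hU.mem_nhds (hqp ▸ hpU k))
    rw [formFn, hu0 k x hx]
    rfl
  choose v α hα hv hvU hδ using key
  refine ⟨sumForm hS v hv, sumForm hS α hα, fun x hx => ?_, ?_⟩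
  · change ∑ᶠ k, (v k).1 x = 0
    simp only [hvU _ x hx, finsum_zero]
  · refine Subtype.ext (funext fun x => ?_)
    rw [δ_sumForm]
    have hfin : ∀ {β : ι → Form (n + 1) X 0}, (∀ k, ∀ x ∉ bumpBall B k, (β k).1 x = 0) →
        (Function.support fun k => (β k).1 x).Finite := fun hβ =>
      (hS.point_finite x).subset fun k hk => by
        by_contra h
        exact hk (hβ k x h)
    have h₁ : ∀ k, (δ ω 0 (α k)).1 x = (u k).1 x - (v k).1 x := fun k => by
      rw [← hδ k]
      rfl
    rw [finsum_congr h₁, finsum_sub_distrib (hfin hu0) (hfin hv)]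
    have h₂ : ∑ᶠ k, (u k).1 x = f.1 x := by
      refine (finsum_congr (hux · x)).trans
        ((finsum_smul (fun k => R k x) (f.1 x : Cov (n + 1) 0)).symm.trans ?_)
      rw [R.sum_eq_one (Set.mem_univ x)]
      exact one_smul _ _
    rw [h₂]
    rfl

end Moving

/-! ### Generic injectivity: a dimension count and Baire's theorem. -/

section Transversality

/-- Adding a generic constant matrix to a `C¹` family of matrices parametrized by a
`D`-dimensional space makes all the columns linearly independent, if they have at least `2D`
entries. -/
theorem dense_forall_linearIndependent {D : ℕ} {E F : Type} [NormedAddCommGroup E]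
    [NormedSpace ℝ E] [FiniteDimensional ℝ E] [NormedAddCommGroup F] [NormedSpace ℝ F]
    [FiniteDimensional ℝ F] (hE : Module.finrank ℝ E = D) (hF : 2 * D ≤ Module.finrank ℝ F)
    {V : Set E} (hV : Convex ℝ V) {M : E → Fin D → F} (hM : ContDiffOn ℝ 1 M V) :
    Dense {C : Fin D → F | ∀ y ∈ V, ∀ v : Fin D → ℝ, ∑ a, v a • (M y a + C a) = 0 → v = 0} := by
  rcases Nat.eq_zero_or_pos D with rfl | hD
  · exact dense_univ.mono fun C _ y _ v _ => Subsingleton.elim _ _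
  -- If ∑ v_b (M_b + C_b) = 0 with v_a ≠ 0, then the column C_a is determined by y, the ratios v_b /
  -- v_a and the other columns. `Φ a` parametrizes the bad matrices in this way.
  set Φ : (a : Fin D) → E × ({b : Fin D // b ≠ a} → ℝ) × ({b : Fin D // b ≠ a} → F) →
      Fin D → F := fun a q b => if h : b = a then
        -(M q.1 a + ∑ b : {b : Fin D // b ≠ a}, q.2.1 b • (M q.1 b + q.2.2 b))
      else q.2.2 ⟨b, h⟩ with hΦ
  have hMc : ∀ a b, ContDiffOn ℝ 1 (fun q : E × ({b : Fin D // b ≠ a} → ℝ) ×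
      ({b : Fin D // b ≠ a} → F) => M q.1 b) (V ×ˢ Set.univ) := fun a b =>
    ((contDiff_apply ℝ F b).comp_contDiffOn hM).comp contDiff_fst.contDiffOn fun q hq => hq.1
  have hΦs : ∀ a, ContDiffOn ℝ 1 (Φ a) (V ×ˢ Set.univ) := by
    intro a
    refine contDiffOn_pi.2 fun b => ?_
    by_cases h : b = a
    · simp only [hΦ, dif_pos h]
      have hb : ∀ b : {b : Fin D // b ≠ a}, ContDiffOn ℝ 1 (fun q : E × ({b : Fin D // b ≠ a} → ℝ) ×
          ({b : Fin D // b ≠ a} → F) => q.2.1 b • (M q.1 b + q.2.2 b)) (V ×ˢ Set.univ) := by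
        intro b
        have h₁ : ContDiffOn ℝ 1 (fun q : E × ({b : Fin D // b ≠ a} → ℝ) ×
          ({b : Fin D // b ≠ a} → F) => q.2.1 b) (V ×ˢ Set.univ) := by fun_prop
        have h₂ : ContDiffOn ℝ 1 (fun q : E × ({b : Fin D // b ≠ a} → ℝ) ×
          ({b : Fin D // b ≠ a} → F) => q.2.2 b) (V ×ˢ Set.univ) := by fun_prop
        exact h₁.smul ((hMc a b).add h₂)
      exact ((hMc a a).add (ContDiffOn.sum fun b _ => hb b)).neg
    · simp only [hΦ, dif_neg h]
      fun_prop
  -- C¹ maps on convex sets do not raise the Hausdorff dimension, and D + (D - 1) + (D - 1) dim F <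
  -- D dim F because dim F > 2D - 1.
  have hdim : dimH (⋃ a, Φ a '' (V ×ˢ Set.univ)) < Module.finrank ℝ (Fin D → F) := by
    have hle : dimH (⋃ a, Φ a '' (V ×ˢ Set.univ)) ≤
        ((D + ((D - 1) + (D - 1) * Module.finrank ℝ F) : ℕ) : ENNReal) := by
      rw [dimH_iUnion]
      refine iSup_le fun a => ?_
      refine ((hΦs a).dimH_image_le (hV.prod convex_univ) subset_rfl).trans ?_
      refine (dimH_mono (Set.subset_univ _)).trans ?_
      rw [Real.dimH_univ_eq_finrank]
      have hc : Fintype.card {b : Fin D // b ≠ a} = D - 1 := by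
        rw [Fintype.card_subtype_compl, Fintype.card_fin, Fintype.card_subtype_eq]
      simp [Module.finrank_prod, Module.finrank_pi_fintype, hE, hc]
    refine hle.trans_lt (Nat.cast_lt.2 ?_)
    obtain ⟨D, rfl⟩ : ∃ D', D = D' + 1 := ⟨D - 1, by omega⟩
    simp only [Module.finrank_pi_fintype, Finset.sum_const, Finset.card_univ, Fintype.card_fin,
      smul_eq_mul, Nat.add_sub_cancel]
    nlinarith
  refine (dense_compl_of_dimH_lt_finrank hdim).mono fun C hC y hy v hv => ?_
  by_contra hv0
  obtain ⟨a, ha⟩ : ∃ a, v a ≠ 0 := by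
    by_contra! h
    exact hv0 (funext h)
  refine hC (Set.mem_iUnion.2 ⟨a, (y, fun b => v b / v a, fun b => C b), ⟨hy, trivial⟩, ?_⟩)
  funext b
  by_cases h : b = a
  · subst h
    simp only [hΦ, dif_pos]
    have h₁ : v b • (M y b + C b) + ∑ c : {c : Fin D // c ≠ b}, v c • (M y c + C c) = 0 := by
      rw [← hv, ← Finset.add_sum_erase _ _ (Finset.mem_univ b)]
      congr 1
      exact (Finset.sum_subtype (Finset.univ.erase b) (by simp)
        (fun c => v c • (M y c + C c))).symm
    have h₂ : ∑ c : {c : Fin D // c ≠ b}, (v c / v b) • (M y c + C c) = -(M y b + C b) := by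
      have : v b • ∑ c : {c : Fin D // c ≠ b}, (v c / v b) • (M y c + C c) =
          v b • -(M y b + C b) := by
        rw [Finset.smul_sum, smul_neg, eq_neg_iff_add_eq_zero, add_comm, ← h₁]
        congr 1
        refine Finset.sum_congr rfl fun c _ => ?_
        rw [smul_smul, mul_div_cancel₀ _ ha]
      exact smul_right_injective F ha this
    rw [h₂]
    abel
  · simp only [hΦ, dif_neg h]

variable {m : ℕ} {F G : Type} [NormedAddCommGroup F] [NormedSpace ℝ F] [NormedAddCommGroup G]
  [NormedSpace ℝ G] [FiniteDimensional ℝ G]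

/-- The perturbation is ∑ eᵃ ⊗ σ(C_a) with a small generic matrix C. Since σ is a section of π,
composing with π makes the C_a the added columns. -/
theorem exists_forall_injective_add (hG : 2 * (2 * m) ≤ Module.finrank ℝ G) (π : F →L[ℝ] G)
    (σ : G →L[ℝ] F) (hπσ : ∀ x, π (σ x) = x) {V : Set (Model m)} (hV : Convex ℝ V)
    {h : Model m → Model m →L[ℝ] F} (hh : ContDiffOn ℝ 1 h V) {W : Set (Model m →L[ℝ] F)}
    (hW : W ∈ 𝓝 0) :
    ∃ B ∈ W, ∀ y ∈ V, Function.Injective (π ∘L (B + h y)) := by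
  have hM : ContDiffOn ℝ 1 (fun y (a : Fin (2 * m)) => π (h y (stdVec a))) V :=
    contDiffOn_pi.2 fun a => π.contDiff.comp_contDiffOn (hh.clm_apply contDiffOn_const)
  have hdense := dense_forall_linearIndependent (by simp) hG hV hM
  set b : (Fin (2 * m) → G) → Model m →L[ℝ] F :=
    fun C => ∑ a, ContinuousLinearMap.smulRightL ℝ (Model m) F (coord a) (σ (C a)) with hb
  have hbc : Continuous b := by
    refine continuous_finsetSum _ fun a _ => ?_
    exact (ContinuousLinearMap.continuous _).comp (σ.continuous.comp (continuous_apply a))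
  have hb0 : b 0 = 0 := by simp [hb]
  obtain ⟨C, hCW, hC⟩ := hdense.inter_nhds_nonempty (hbc.continuousAt.preimage_mem_nhds (x := 0)
    (by rwa [hb0]))
  refine ⟨b C, hC, fun y hy => ?_⟩
  refine (injective_iff_map_eq_zero _).2 fun v hv => ?_
  have := hCW y hy (fun a => v a) ?_
  · ext a
    exact congrFun this a
  · rw [← hv]
    change _ = π (b C v + h y v)
    have h₁ : b C v = ∑ a, v a • σ (C a) := by
      simp [hb, coord_apply]
    have h₂ : h y v = ∑ a, v a • h y (stdVec a) := by
      conv_lhs => rw [eq_sum_stdVec v]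
      simp
    rw [h₁, h₂, map_add, map_sum, map_sum, ← Finset.sum_add_distrib]
    refine Finset.sum_congr rfl fun a _ => ?_
    rw [map_smul, map_smul, hπσ, smul_add, add_comm]

/-- A generic locally finite combination of linear maps satisfies countably many injectivity
conditions. -/
theorem exists_forall_injective {ι I : Type*} [Countable ι] [Countable I] [CompleteSpace F]
    (hG : 2 * (2 * m) ≤ Module.finrank ℝ G) (π : I → F →L[ℝ] G) (σ : I → G →L[ℝ] F)
    (hπσ : ∀ i x, π i (σ i x) = x) {V Q : ι → Set (Model m)} (hV : ∀ j, Convex ℝ (V j))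
    (hQ : ∀ j, IsCompact (Q j)) (hQV : ∀ j, Q j ⊆ V j) (s : ι → Finset ι) (hs : ∀ j, j ∉ s j)
    (M : ι → ι → Model m → Model m →L[ℝ] Model m)
    (hM : ∀ j k, ContDiffOn ℝ 1 (M j k) (V j)) :
    ∃ A : ι → Model m →L[ℝ] F, ∀ j i, ∀ y ∈ Q j,
      Function.Injective (π i ∘L (A j + ∑ k ∈ s j, A k ∘L M j k y)) := by
  classical
  set O : ι × I → Set (ι → Model m →L[ℝ] F) := fun q => {A | ∀ y ∈ Q q.1,
    Function.Injective (π q.2 ∘L (A q.1 + ∑ k ∈ s q.1, A k ∘L M q.1 k y))} with hO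
  -- The noninjective pairs form a closed set, and its projection along the compact factor `Q j` is
  -- closed.
  have hopen : ∀ q, IsOpen (O q) := by
    rintro ⟨j, i⟩
    have := isCompact_iff_compactSpace.1 (hQ j)
    have hc : Continuous fun z : (ι → Model m →L[ℝ] F) × Q j =>
        π i ∘L (z.1 j + ∑ k ∈ s j, z.1 k ∘L M j k z.2) := by
      have hMc : ∀ k, Continuous fun z : (ι → Model m →L[ℝ] F) × Q j => M j k z.2 := fun k =>
        (continuousOn_iff_continuous_domRestrict.1
          ((hM j k).continuousOn.mono (hQV j))).comp continuous_snd
      refine continuous_const.clm_comp ((by fun_prop : Continuous _).add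
        (continuous_finsetSum _ fun k _ => Continuous.clm_comp (by fun_prop) (hMc k)))
    have hcl : IsClosed {z : (ι → Model m →L[ℝ] F) × Q j |
        ¬ Function.Injective (π i ∘L (z.1 j + ∑ k ∈ s j, z.1 k ∘L M j k z.2))} := by
      have := (ContinuousLinearMap.isOpen_injective (𝕜 := ℝ) (E := Model m) (F := G)).preimage hc
      exact this.isClosed_compl
    have := (isClosedMap_fst_of_compactSpace _ hcl).isOpen_compl
    convert this using 1
    ext A
    simp [hO]
  -- Only the component A_j is perturbed. As j ∉ s j, the sum over k does not change, and
  -- `exists_forall_injective_add` applies.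
  have hdense : ∀ q, Dense (O q) := by
    rintro ⟨j, i⟩
    refine fun A => mem_closure_iff_nhds.2 fun W hW => ?_
    have hu : Continuous fun B : Model m →L[ℝ] F => Function.update A j (B + A j) :=
      continuous_const.update j (continuous_id.add continuous_const)
    have hu0 : Function.update A j (0 + A j) = A := by simp
    obtain ⟨B, hBW, hB⟩ := exists_forall_injective_add hG (π i) (σ i) (hπσ i) (hV j)
      (h := fun y => A j + ∑ k ∈ s j, A k ∘L M j k y)
      (contDiffOn_const.add (ContDiffOn.sum fun k _ => contDiffOn_const.clm_comp (hM j k)))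
      (hu.continuousAt.preimage_mem_nhds (x := 0) (by rwa [hu0]))
    refine ⟨_, hBW, fun y hy => ?_⟩
    have := hB y (hQV j hy)
    have e : (Function.update A j (B + A j)) j + ∑ k ∈ s j, (Function.update A j (B + A j)) k ∘L
        M j k y = B + (A j + ∑ k ∈ s j, A k ∘L M j k y) := by
      rw [Function.update_self, add_assoc]
      congr 2
      refine Finset.sum_congr rfl fun k hk => ?_
      rw [Function.update_of_ne]
      rintro rfl
      exact hs _ hk
    change Function.Injective (π i ∘L _)
    rw [e]
    exact this
  obtain ⟨A, hA⟩ := (dense_iInter_of_isOpen hopen hdense).nonempty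
  exact ⟨A, fun j i => Set.mem_iInter.1 hA (j, i)⟩

end Transversality

/-! ### Finitely many functions whose differentials separate tangent vectors. -/

section Generators

variable {m : ℕ} {X : Type*} [TopologicalSpace X] [ChartedSpace (Model m) X]

theorem oneForm_apply (ξ : Model m →L[ℝ] ℝ) (w : Fin 1 → Model m) : oneForm ξ w = ξ (w 0) := by
  rw [oneForm, covectorWedge_apply]
  simp [constForm_apply]

/-- The projection of `ℝᴺ⁺¹` that forgets one coordinate. -/
def forgetCoord {N : ℕ} (i₀ : Fin (N + 1)) : (Fin (N + 1) → ℝ) →L[ℝ] (Fin N → ℝ) :=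
  ContinuousLinearMap.pi fun i => ContinuousLinearMap.proj (i₀.succAbove i)

theorem exists_rightInverse_forgetCoord {N : ℕ} (i₀ : Fin (N + 1)) :
    ∃ σ : (Fin N → ℝ) →L[ℝ] (Fin (N + 1) → ℝ), ∀ x, forgetCoord i₀ (σ x) = x := by
  have hs : LinearMap.range (forgetCoord i₀).toLinearMap = ⊤ := by
    refine LinearMap.range_eq_top.2 fun b => ⟨Fin.insertNth i₀ (0 : ℝ) b, funext fun i => ?_⟩
    exact Fin.insertNth_apply_succAbove (α := fun _ => ℝ) i₀ 0 b i
  obtain ⟨σ, hσ⟩ := (forgetCoord i₀).toLinearMap.exists_rightInverse_of_surjective hs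
  exact ⟨LinearMap.toContinuousLinearMap σ, fun x => LinearMap.congr_fun hσ x⟩

variable [IsManifold (𝓡 (2 * m)) ((⊤ : ℕ∞) : WithTop ℕ∞) X] [T2Space X] [SigmaCompactSpace X]
  {ι : Type*}

/-- There are finitely many smooth functions whose differentials separate tangent vectors, even if
one of the functions is left out. -/
theorem exists_separating_functions (B : SmoothBumpCovering ι (𝓡 (2 * m)) X) {N : ℕ}
    (hN : 2 * (2 * m) ≤ N) :
    ∃ g : Fin (N + 1) → Form m X 0, ∀ (x : X) (i₀ : Fin (N + 1)) (v : Model m),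
      (∀ i, i ≠ i₀ → (d (g i)).1 x ![v] = 0) → v = 0 := by
  classical
  have hS := locallyFinite_bumpBall B
  have : Countable ι := Set.countable_univ_iff.1 (B.locallyFinite.countable_univ fun k =>
    (B k).nonempty_support)
  set φ := fun j => chartAt (Model m) (B.c j) with hφ
  set e : ι → X → Model m := fun k x => B k x • φ k x with he
  have hes : ∀ k, ContMDiff (𝓡 (2 * m)) 𝓘(ℝ, Model m) smoothExp (e k) := fun k =>
    (B k).contMDiff_smul contMDiffOn_chart
  have he0 : ∀ k, ∀ x ∉ bumpBall B k, e k x = 0 := fun k x hx => by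
    have : B k x = 0 := Function.notMem_support.1 fun h => hx (support_subset_bumpBall B k h)
    simp only [he, this, zero_smul]
  set V : ι → Set (Model m) := fun j => Metric.closedBall (φ j (B.c j)) (B j).rOut with hV
  have hVt : ∀ j, V j ⊆ (φ j).target := closedBall_subset_target B
  -- The part of the ball where the bump function is 1; the cut-off chart `e j` has derivative the
  -- identity wherever the bump function is locally 1, and every point of X has such a j.
  set Q : ι → Set (Model m) := fun j => V j ∩ (fun y => B j ((φ j).symm y)) ⁻¹' {1} with hQ
  have hQc : ∀ j, IsCompact (Q j) := fun j =>
    (isCompact_closedBall _ _).of_isClosed_subset (ContinuousOn.preimage_isClosed_of_isClosed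
      ((B j).continuous.comp_continuousOn ((φ j).continuousOn_symm.mono (hVt j)))
      Metric.isClosed_closedBall isClosed_singleton) Set.inter_subset_left
  have hfin : ∀ j, {k | (bumpBall B k ∩ bumpBall B j).Nonempty}.Finite := fun j =>
    hS.finite_nonempty_inter_compact (isCompact_bumpBall B j)
  -- The finitely many other balls meeting the j-th one: at points of this ball only they contribute
  -- derivatives besides j.
  set s : ι → Finset ι := fun j => (hfin j).toFinset.erase j with hs
  set M : ι → ι → Model m → Model m →L[ℝ] Model m :=
    fun j k y => fderiv ℝ (fun z => e k ((φ j).symm z)) y with hM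
  have hMs : ∀ j k, ContDiffOn ℝ 1 (M j k) (V j) := fun j k =>
    (((contDiffOn_comp_chart_symm (hes k) (B.c j)).fderiv_of_isOpen (φ j).open_target
      (m := smoothExp) (by simp)).mono (hVt j)).of_le
      (WithTop.coe_le_coe.2 (le_top : (1 : ℕ∞) ≤ ⊤))
  choose σ hσ using fun i₀ : Fin (N + 1) => exists_rightInverse_forgetCoord i₀
  obtain ⟨A, hA⟩ := exists_forall_injective (F := Fin (N + 1) → ℝ) (by simpa using hN)
    forgetCoord σ hσ (fun j => convex_closedBall _ _) hQc (fun j => Set.inter_subset_left) s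
    (fun j => Finset.notMem_erase _ _) M hMs
  -- In chart j, at the points used below, the derivative of this map is A_j + ∑ A_k ∘ M_{jk}, the
  -- expression made injective by the choice of A, even after a coordinate is forgotten.
  set G : X → Fin (N + 1) → ℝ := fun x => ∑ᶠ k, A k (e k x) with hG
  have hGs : ContMDiff (𝓡 (2 * m)) 𝓘(ℝ, Fin (N + 1) → ℝ) smoothExp G := by
    refine contMDiff_finsum (fun k => (A k).contMDiff.comp (hes k)) (hS.subset fun k x hx => ?_)
    by_contra h
    refine hx ?_
    change A k (e k x) = 0
    rw [he0 k x h, map_zero]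
  refine ⟨fun i => ofFn (fun x => G x i)
    ((ContinuousLinearMap.proj (R := ℝ) (φ := fun _ : Fin (N + 1) => ℝ) i).contMDiff.comp hGs),
    fun x i₀ v hv => ?_⟩
  set j := B.ind x (Set.mem_univ x) with hj
  have h1 : B j =ᶠ[𝓝 x] 1 := B.eventuallyEq_one x (Set.mem_univ x)
  have hxs : x ∈ (φ j).source := B.mem_chartAt_ind_source x (Set.mem_univ x)
  have hxS : x ∈ bumpBall B j :=
    support_subset_bumpBall B j (B.mem_support_ind x (Set.mem_univ x))
  set y := φ j x with hy
  have hyt : y ∈ (φ j).target := (φ j).map_source hxs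
  have hyx : (φ j).symm y = x := (φ j).left_inv hxs
  have hyQ : y ∈ Q j := by
    obtain ⟨z, hz, hzx⟩ := hxS
    have hzy : z = y := by rw [hy, ← hzx, (φ j).right_inv (hVt j hz)]
    refine ⟨hzy ▸ hz, ?_⟩
    change B j ((φ j).symm y) = 1
    rw [hyx]
    exact h1.eq_of_nhds
  have hev : ∀ {p : X → Prop}, (∀ᶠ z in 𝓝 x, p z) → ∀ᶠ z in 𝓝 y, p ((φ j).symm z) := fun hp =>
    ((φ j).continuousAt_symm hyt).eventually (by rwa [hyx])
  have hMjj : M j j y = ContinuousLinearMap.id ℝ (Model m) := by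
    have : (fun z => e j ((φ j).symm z)) =ᶠ[𝓝 y] id := by
      filter_upwards [hev h1, (φ j).open_target.mem_nhds hyt] with z hz hzt
      simp only [he, hz, Pi.one_apply, one_smul, (φ j).right_inv hzt, id]
    exact this.fderiv_eq.trans fderiv_id
  have hM0 : ∀ k, (∀ᶠ z in 𝓝 x, e k z = 0) → M j k y = 0 := fun k hk => by
    have : (fun z => e k ((φ j).symm z)) =ᶠ[𝓝 y] fun _ => 0 := hev hk
    exact this.fderiv_eq.trans (fderiv_const_apply _)
  -- All terms of G outside t vanish near x. The set is enlarged so that it contains the indices in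
  -- the formula for the derivative; its other elements have M_{jk}(y) = 0.
  obtain ⟨t, ht, hst⟩ : ∃ t : Finset ι, (∀ᶠ z in 𝓝 x, ∀ k ∉ t, e k z = 0) ∧
      insert j (s j) ⊆ t := by
    obtain ⟨U, hU, hUf⟩ := hS x
    refine ⟨hUf.toFinset ∪ insert j (s j), ?_, Finset.subset_union_right⟩
    filter_upwards [hU] with z hz k hk
    refine he0 k z fun hzk => hk (Finset.mem_union_left _ ?_)
    exact hUf.mem_toFinset.2 ⟨z, hzk, hz⟩
  have hder : HasFDerivAt (fun z => G ((φ j).symm z)) (A j + ∑ k ∈ s j, A k ∘L M j k y) y := by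
    have h₁ : HasFDerivAt (fun z => ∑ k ∈ t, A k (e k ((φ j).symm z)))
        (∑ k ∈ t, A k ∘L M j k y) y := by
      refine HasFDerivAt.fun_sum fun k _ => (A k).hasFDerivAt.comp y ?_
      exact (differentiableAt_of_contDiffOn (φ j).open_target
        (contDiffOn_comp_chart_symm (hes k) (B.c j)) hyt).hasFDerivAt
    have h₂ : A j + ∑ k ∈ s j, A k ∘L M j k y = ∑ k ∈ t, A k ∘L M j k y := by
      rw [← Finset.sum_subset hst fun k _ hk => ?_, Finset.sum_insert (Finset.notMem_erase _ _),
        hMjj, ContinuousLinearMap.comp_id]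
      rw [hM0 k, ContinuousLinearMap.comp_zero]
      have hxk : x ∉ bumpBall B k := fun hxk => hk <| by
        rw [Finset.mem_insert, or_iff_not_imp_left]
        exact fun hkj => Finset.mem_erase.2 ⟨hkj, (hfin j).mem_toFinset.2 ⟨x, hxk, hxS⟩⟩
      filter_upwards [(isCompact_bumpBall B k).isClosed.isOpen_compl.mem_nhds hxk] with z hz
        using he0 k z hz
    rw [h₂]
    refine h₁.congr_of_eventuallyEq ?_
    filter_upwards [hev ht] with z hz
    refine finsum_eq_sum_of_support_subset _ fun k hk => ?_
    by_contra hkt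
    refine hk ?_
    change A k (e k ((φ j).symm z)) = 0
    rw [hz k hkt, map_zero]
  have hw : chartDeriv (B.c j) x v = 0 := by
    refine (injective_iff_map_eq_zero _).1 (hA j i₀ y hyQ) _ (funext fun i => ?_)
    have := hv (i₀.succAbove i) (Fin.succAbove_ne _ _)
    rw [eq_pull_localRep (B.c j) (d _).1 hxs, localRep_d_zero _ (B.c j) hyt, pull_oneForm,
      oneForm_apply] at this
    have hd : HasFDerivAt (localFn (B.c j) (ofFn (fun x => G x (i₀.succAbove i))
        ((ContinuousLinearMap.proj (R := ℝ) (φ := fun _ : Fin (N + 1) => ℝ)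
          (i₀.succAbove i)).contMDiff.comp hGs)).1)
        (ContinuousLinearMap.proj (i₀.succAbove i) ∘L (A j + ∑ k ∈ s j, A k ∘L M j k y)) y := by
      refine HasFDerivAt.congr_of_eventuallyEq ((ContinuousLinearMap.proj (R := ℝ)
        (φ := fun _ : Fin (N + 1) => ℝ) (i₀.succAbove i)).hasFDerivAt.comp y hder)
        (Filter.Eventually.of_forall fun z => ?_)
      exact localFn_eq _ _ _
    rw [hd.fderiv] at this
    exact this
  have := congrArg (fun T : Model m →L[ℝ] Model m => T v) (chartSymmDeriv_comp (B.c j) hxs)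
  simpa [hw] using this.symm

end Generators

/-! ### Distinct marked points and disjoint neighbourhoods. -/

section Points

/-- A choice of distinct elements of a sequence of infinite sets. -/
def distinctChoice {X : Type*} (A : ℕ → Set X) (hA : ∀ j, (A j).Infinite) : ℕ → X
  | j => ((hA j).sdiff (Set.finite_range fun i : Fin j => distinctChoice A hA i.1)).nonempty.some
  decreasing_by exact i.2

theorem distinctChoice_mem {X : Type*} (A : ℕ → Set X) (hA : ∀ j, (A j).Infinite) (j : ℕ) :
    distinctChoice A hA j ∈ A j \ Set.range fun i : Fin j => distinctChoice A hA i.1 := by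
  rw [distinctChoice]
  exact ((hA j).sdiff (Set.finite_range fun i : Fin j => distinctChoice A hA i.1)).nonempty.some_mem

theorem exists_injective_choice {X J : Type*} [Countable J] (A : J → Set X)
    (hA : ∀ j, (A j).Infinite) : ∃ p : J → X, Function.Injective p ∧ ∀ j, p j ∈ A j := by
  rcases isEmpty_or_nonempty J with hJ | hJ
  · exact ⟨fun j => hJ.elim j, fun j => hJ.elim j, fun j => hJ.elim j⟩
  obtain ⟨f, hf⟩ := exists_surjective_nat J
  set q := distinctChoice (A ∘ f) fun j => hA _ with hq
  have hlt : ∀ i j, i < j → q i ≠ q j := fun i j hij h =>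
    (distinctChoice_mem (A ∘ f) (fun j => hA _) j).2 ⟨⟨i, hij⟩, h⟩
  have hqi : Function.Injective q := fun i j h => by
    rcases lt_trichotomy i j with h' | h' | h'
    · exact (hlt i j h' h).elim
    · exact h'
    · exact (hlt j i h' h.symm).elim
  refine ⟨fun j => q (Function.surjInv hf j),
    hqi.comp (Function.injective_surjInv hf), fun j => ?_⟩
  have := (distinctChoice_mem (A ∘ f) (fun j => hA _) (Function.surjInv hf j)).1
  rwa [Function.comp_apply, Function.surjInv_eq hf] at this

theorem isClosed_range_of_locallyFinite {X ι : Type*} [TopologicalSpace X] [T1Space X]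
    {S : ι → Set X} (hS : LocallyFinite S) {p : ι → X} (hp : ∀ k, p k ∈ S k) :
    IsClosed (Set.range p) := by
  rw [← Set.iUnion_singleton_eq_range]
  exact (hS.subset fun k => Set.singleton_subset_iff.2 (hp k)).isClosed_iUnion
    fun k => isClosed_singleton

/-- Finitely many pairwise disjoint closed subsets of a normal space have open neighbourhoods with
pairwise disjoint closures. -/
theorem exists_open_pairwise_disjoint_closure {X σ : Type*} [TopologicalSpace X] [NormalSpace X]
    [Finite σ] {P : σ → Set X} (hP : ∀ s, IsClosed (P s))
    (hd : Pairwise fun s t => Disjoint (P s) (P t)) :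
    ∃ V : σ → Set X, (∀ s, IsOpen (V s)) ∧ (∀ s, P s ⊆ V s) ∧
      Pairwise fun s t => Disjoint (closure (V s)) (closure (V t)) := by
  obtain ⟨W, hW, hWd⟩ := Pairwise.exists_mem_filter_of_disjoint (l := fun s => 𝓝ˢ (P s))
    fun s t hst => (SeparatedNhds.disjoint_nhdsSet (normal_separation (hP s) (hP t) (hd hst)))
  choose V hVo hPV hV using fun s => normal_exists_closure_subset (hP s) isOpen_interior
    (subset_interior_iff_mem_nhdsSet.2 (hW s))
  exact ⟨V, hVo, hPV, fun s t hst => (hWd hst).mono ((hV s).trans interior_subset)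
    ((hV t).trans interior_subset)⟩

variable {n : ℕ} {X : Type*} [TopologicalSpace X] [ChartedSpace (Model (n + 1)) X] {ι : Type*}

/-- Positive dimension is what provides room for many distinct marked points in each ball. -/
theorem infinite_bumpBall (B : SmoothBumpCovering ι (𝓡 (2 * (n + 1))) X) (k : ι) :
    (bumpBall B k).Infinite := by
  refine Set.Infinite.image ((chartAt (Model (n + 1)) (B.c k)).symm.injOn.mono
    (closedBall_subset_target B k)) ?_
  have : Nonempty (Fin (2 * (n + 1))) := ⟨⟨0, by omega⟩⟩
  have := Module.punctured_nhds_neBot ℝ (Model (n + 1))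
    (chartAt (Model (n + 1)) (B.c k) (B.c k))
  exact infinite_of_mem_nhds _ (Metric.closedBall_mem_nhds _ (B k).rOut_pos)

end Points

/-! ### One-forms as combinations of given differentials. -/

section Coefficients

variable {m : ℕ}

variable (m) in
/-- The identification of alternating one-forms with covectors. -/
def toCovector : Cov m 1 →L[ℝ] (Model m →L[ℝ] ℝ) :=
  (ContinuousAlternatingMap.ofSubsingletonLIE (𝕜 := ℝ) (E := Model m) (F := ℝ)
    (0 : Fin 1)).symm.toContinuousLinearEquiv.toContinuousLinearMap

theorem oneForm_toCovector (α : Cov m 1) : oneForm (toCovector m α) = α := by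
  ext w
  rw [oneForm_apply]
  change α _ = α w
  congr 1
  ext i
  fin_cases i
  rfl

/-- The symmetric operator `v ↦ ∑ᵢ ξᵢ(v) ξᵢ` of a family of covectors. -/
def gram {I : Type*} (s : Finset I) (ξ : I → Model m →L[ℝ] ℝ) : Model m →L[ℝ] Model m →L[ℝ] ℝ :=
  ∑ i ∈ s, ContinuousLinearMap.smulRightL ℝ (Model m) (Model m →L[ℝ] ℝ) (ξ i) (ξ i)

theorem gram_apply {I : Type*} (s : Finset I) (ξ : I → Model m →L[ℝ] ℝ) (v : Model m) :
    gram s ξ v = ∑ i ∈ s, ξ i v • ξ i := by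
  simp [gram]

theorem contDiffOn_gram {I : Type*} (s : Finset I) {ξ : I → Model m → Model m →L[ℝ] ℝ}
    {U : Set (Model m)} (hξ : ∀ i, ContDiffOn ℝ smoothExp (ξ i) U) :
    ContDiffOn ℝ smoothExp (fun y => gram s fun i => ξ i y) U := by
  unfold gram
  refine ContDiffOn.sum fun i _ => ?_
  exact (contDiffOn_smulRight (E := Model m) (hξ i)).clm_apply (hξ i)

/-- Γ(v)(v) = ∑ ξᵢ(v)², so Γ is injective as soon as the covectors separate vectors, and the
dimensions agree. -/
theorem exists_equiv_gram {I : Type*} (s : Finset I) (ξ : I → Model m →L[ℝ] ℝ)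
    (h : ∀ v, (∀ i ∈ s, ξ i v = 0) → v = 0) :
    ∃ e : Model m ≃L[ℝ] (Model m →L[ℝ] ℝ), (e : Model m →L[ℝ] (Model m →L[ℝ] ℝ)) = gram s ξ := by
  have hinj : Function.Injective (gram s ξ).toLinearMap := by
    refine (injective_iff_map_eq_zero _).2 fun v hv => h v fun i hi => ?_
    have h₁ : ∑ i ∈ s, ξ i v * ξ i v = 0 := by
      have := congrArg (fun T : Model m →L[ℝ] ℝ => T v) ((gram_apply s ξ v).symm.trans hv)
      simpa using this
    exact mul_self_eq_zero.1
      ((Finset.sum_eq_zero_iff_of_nonneg fun i _ => mul_self_nonneg _).1 h₁ i hi)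
  have hr : Module.finrank ℝ (Model m) = Module.finrank ℝ (Model m →L[ℝ] ℝ) :=
    Subspace.dual_finrank_eq.symm.trans
      (LinearMap.toContinuousLinearMap (𝕜 := ℝ) (E := Model m) (F' := ℝ)).finrank_eq
  exact ⟨((gram s ξ).toLinearMap.linearEquivOfInjective hinj hr).toContinuousLinearEquiv,
    ContinuousLinearMap.ext fun v => rfl⟩

variable {X : Type*} [TopologicalSpace X] [ChartedSpace (Model m) X]
  [IsManifold (𝓡 (2 * m)) ((⊤ : ℕ∞) : WithTop ℕ∞) X]

theorem d_eq_oneForm (g : Form m X 0) {c x : X} (hx : x ∈ (chartAt (Model m) c).source) :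
    (d g).1 x = oneForm (fderiv ℝ (localFn c g.1) (chartAt (Model m) c x) ∘L chartDeriv c x) := by
  rw [eq_pull_localRep c (d g).1 hx, localRep_d_zero g c ((chartAt (Model m) c).map_source hx),
    pull_oneForm]

/-- Locally, every one-form is a combination of the given differentials. -/
theorem exists_local_coefficients {I : Type} [Fintype I] [DecidableEq I] (g : I → Form m X 0)
    (i₀ : I) (hg : ∀ (x : X) (v : Model m), (∀ i, i ≠ i₀ → (d (g i)).1 x ![v] = 0) → v = 0)
    (α : Form m X 1) (c : X) :
    ∃ a : X → I → ℝ,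
      ContMDiffOn (𝓡 (2 * m)) 𝓘(ℝ, I → ℝ) smoothExp a (chartAt (Model m) c).source ∧
      ∀ x ∈ (chartAt (Model m) c).source, a x i₀ = 0 ∧ ∑ i, a x i • (d (g i)).1 x = α.1 x := by
  set φ := chartAt (Model m) c with hφ
  set ξ : I → Model m → Model m →L[ℝ] ℝ := fun i y => fderiv ℝ (localFn c (g i).1) y with hξ
  set η : Model m → Model m →L[ℝ] ℝ := fun y => toCovector m (localRep c α.1 y) with hη
  set Γ : Model m → Model m →L[ℝ] Model m →L[ℝ] ℝ :=
    fun y => gram (Finset.univ.erase i₀) (fun i => ξ i y) with hΓ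
  have hξs : ∀ i, ContDiffOn ℝ smoothExp (ξ i) φ.target := fun i =>
    (contDiffOn_localFn c (g i)).fderiv_of_isOpen φ.open_target (by simp)
  have hηs : ContDiffOn ℝ smoothExp η φ.target := (toCovector m).contDiff.comp_contDiffOn (α.2 c)
  have hΓs : ContDiffOn ℝ smoothExp Γ φ.target := contDiffOn_gram _ hξs
  have hsep : ∀ y ∈ φ.target, ∀ v, (∀ i ∈ Finset.univ.erase i₀, ξ i y v = 0) → v = 0 := by
    intro y hy v hv
    have h₁ : chartDeriv c (φ.symm y) (chartSymmDeriv c y v) = v :=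
      congrArg (fun T : Model m →L[ℝ] Model m => T v) (chartDeriv_comp c hy)
    have h₂ : chartSymmDeriv c y v = 0 := by
      refine hg (φ.symm y) _ fun i hi => ?_
      rw [d_eq_oneForm (g i) (φ.map_target hy), oneForm_apply, φ.right_inv hy]
      change ξ i y (chartDeriv c (φ.symm y) (chartSymmDeriv c y v)) = 0
      rw [h₁]
      exact hv i (Finset.mem_erase.2 ⟨hi, Finset.mem_univ i⟩)
    rw [← h₁, h₂, map_zero]
  -- From η = Γ(Γ⁻¹η) = ∑ ξᵢ(Γ⁻¹η) ξᵢ one reads off coefficients that depend smoothly on the point.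
  -- The index i₀ does not enter Γ and gets the coefficient 0.
  set b : Model m → I → ℝ := fun y i =>
    if i = i₀ then 0 else ξ i y (ContinuousLinearMap.inverse (Γ y) (η y)) with hb
  have hbs : ∀ y ∈ φ.target, ContDiffAt ℝ smoothExp b y := by
    intro y hy
    have hn := φ.open_target.mem_nhds hy
    refine contDiffAt_pi.2 fun i => ?_
    by_cases hi : i = i₀
    · simp only [hb, if_pos hi]
      exact contDiffAt_const
    · simp only [hb, if_neg hi]
      refine ((hξs i).contDiffAt hn).clm_apply (ContDiffAt.clm_apply ?_ (hηs.contDiffAt hn))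
      obtain ⟨e, he⟩ := exists_equiv_gram _ (fun i => ξ i y) (hsep y hy)
      have hinv : ContDiffAt ℝ smoothExp ContinuousLinearMap.inverse (Γ y) := by
        rw [show Γ y = e from he.symm]
        exact contDiffAt_map_inverse e
      exact hinv.comp y (hΓs.contDiffAt hn)
  refine ⟨fun x => b (φ x), fun x hx =>
    (contMDiffAt_comp_chart hx (hbs _ (φ.map_source hx))).contMDiffWithinAt, fun x hx =>
      ⟨if_pos rfl, ?_⟩⟩
  have hy := φ.map_source hx
  obtain ⟨e, he⟩ := exists_equiv_gram _ (fun i => ξ i (φ x)) (hsep _ hy)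
  have h₁ : ∑ i, b (φ x) i • ξ i (φ x) = η (φ x) := by
    rw [← Finset.add_sum_erase _ _ (Finset.mem_univ i₀)]
    have h0 : b (φ x) i₀ = 0 := if_pos rfl
    have h₂ : ∀ i ∈ Finset.univ.erase i₀, b (φ x) i • ξ i (φ x) =
        ξ i (φ x) (ContinuousLinearMap.inverse (Γ (φ x)) (η (φ x))) • ξ i (φ x) := fun i hi => by
      simp only [hb, if_neg (Finset.ne_of_mem_erase hi)]
    rw [h0, zero_smul, zero_add, Finset.sum_congr rfl h₂, ← gram_apply]
    change Γ (φ x) (ContinuousLinearMap.inverse (Γ (φ x)) (η (φ x))) = _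
    have : Γ (φ x) = e := he.symm
    rw [this, ContinuousLinearMap.inverse_equiv]
    exact e.apply_symm_apply _
  have h₂ : ∀ i, (d (g i)).1 x = pull (chartDeriv c x) (oneFormCLM m (ξ i (φ x))) := fun i => by
    rw [d_eq_oneForm (g i) hx, oneFormCLM_apply, pull_oneForm]
  have h₃ : α.1 x = pull (chartDeriv c x) (oneFormCLM m (η (φ x))) := by
    rw [oneFormCLM_apply, oneForm_toCovector, ← eq_pull_localRep c α.1 hx]
  rw [h₃, ← h₁, map_sum, pull_sum]
  refine Finset.sum_congr rfl fun i _ => ?_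
  rw [h₂, map_smul, pull_smul]

variable [T2Space X] [SigmaCompactSpace X]

/-- A one-form is a combination of the differentials of the given functions, with coefficients that
vanish on prescribed disjoint closed sets. -/
theorem exists_coefficients {I : Type} [Fintype I] [DecidableEq I] [Nonempty I]
    (g : I → Form m X 0)
    (hg : ∀ (x : X) (i₀ : I) (v : Model m), (∀ i, i ≠ i₀ → (d (g i)).1 x ![v] = 0) → v = 0)
    {W : I → Set X} (hW : ∀ i, IsClosed (W i)) (hd : Pairwise fun i j => Disjoint (W i) (W j))
    (α : Form m X 1) :
    ∃ f : I → Form m X 0, (∀ i, ∀ x ∈ W i, formFn (f i) x = 0) ∧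
      α = ∑ i, mulForm (f i) (d (g i)) := by
  -- All conditions on the coefficients at a point are affine, so local solutions can be averaged by
  -- a partition of unity.
  have hconv : ∀ x : X, Convex ℝ {a : I → ℝ | (∀ i, x ∈ W i → a i = 0) ∧
      ∑ i, a i • (d (g i)).1 x = α.1 x} := by
    intro x a ha b hb s t hs ht hst
    refine ⟨fun i hi => by simp [ha.1 i hi, hb.1 i hi], ?_⟩
    have : ∑ i, (s • a + t • b) i • (d (g i)).1 x =
        s • ∑ i, a i • (d (g i)).1 x + t • ∑ i, b i • (d (g i)).1 x := by
      rw [Finset.smul_sum, Finset.smul_sum, ← Finset.sum_add_distrib]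
      refine Finset.sum_congr rfl fun i _ => ?_
      rw [Pi.add_apply, Pi.smul_apply, Pi.smul_apply, add_smul, smul_eq_mul, smul_eq_mul,
        mul_smul, mul_smul]
    rw [this, ha.2, hb.2, ← add_smul, hst]
    exact one_smul _ _
  obtain ⟨a, ha⟩ := exists_contMDiffMap_forall_mem_convex_of_local (n := (⊤ : ℕ∞)) (𝓡 (2 * m))
      hconv fun x => by
    -- By disjointness x lies in at most one of the sets; i₀ is its index, or arbitrary if there is
    -- none. Dropping this one differential makes all vanishing conditions near x hold.
    obtain ⟨i₀, hi₀⟩ : ∃ i₀, ∀ i, i ≠ i₀ → x ∉ W i := by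
      by_cases h : ∃ i₀, x ∈ W i₀
      · obtain ⟨i₀, hi₀⟩ := h
        exact ⟨i₀, fun i hi hx => (hd hi).le_bot ⟨hx, hi₀⟩⟩
      · exact ⟨Classical.arbitrary I, fun i _ hx => h ⟨i, hx⟩⟩
    obtain ⟨a, has, ha⟩ := exists_local_coefficients g i₀ (fun x => hg x i₀) α x
    refine ⟨(chartAt (Model m) x).source ∩ {z | ∀ i, i ≠ i₀ → z ∉ W i}, Filter.inter_mem
      ((chartAt (Model m) x).open_source.mem_nhds (mem_chart_source _ x)) ?_, a,
      has.mono Set.inter_subset_left, fun z hz => ⟨fun i hi => ?_, (ha z hz.1).2⟩⟩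
    · refine Filter.eventually_all.2 fun i => ?_
      by_cases hi : i = i₀
      · exact Filter.Eventually.of_forall fun z h => (h hi).elim
      · filter_upwards [(hW i).isOpen_compl.mem_nhds (hi₀ i hi)] with z hz _ using hz
    · by_cases h : i = i₀
      · rw [h]
        exact (ha z hz.1).1
      · exact (hz.2 i h hi).elim
  have has : ∀ i, ContMDiff (𝓡 (2 * m)) 𝓘(ℝ, ℝ) smoothExp fun x => a x i := fun i =>
    (ContinuousLinearMap.proj (R := ℝ) (φ := fun _ : I => ℝ) i).contMDiff.comp a.contMDiff
  refine ⟨fun i => ofFn (fun x => a x i) (has i), fun i x hx => (ha x).1 i hx,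
    Subtype.ext (funext fun x => ?_)⟩
  rw [← (ha x).2]
  exact (map_sum (evalAt x) (fun i => mulForm (ofFn (fun x => a x i) (has i)) (d (g i)))
    Finset.univ).symm

end Coefficients

/-! ### A product f dg as a commutator. -/

section Perfect

variable {n : ℕ} {X : Type*} [TopologicalSpace X] [ChartedSpace (Model (n + 1)) X]
  [IsManifold (𝓡 (2 * (n + 1))) ((⊤ : ℕ∞) : WithTop ℕ∞) X] [T2Space X]
  (ω : SymplecticForm (n + 1) X) {ι : Type*} (B : SmoothBumpCovering ι (𝓡 (2 * (n + 1))) X)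

/-- The form `f dg` does not change if `f` and `g` are modified away from the support of `f`. -/
theorem exists_mulForm_d_eq [SigmaCompactSpace X] [NormalSpace X] {p q : ι → X}
    (hp : ∀ k, p k ∈ bumpBall B k)
    (hq : ∀ k, q k ∈ bumpBall B k) {V V' : Set X} (hV : IsOpen V) (hV' : IsOpen V')
    (hpV : ∀ k, p k ∈ V) (hqV : ∀ k, q k ∈ V') (hd : Disjoint V V') {f : Form (n + 1) X 0}
    (hf : ∀ x ∈ V, formFn f x = 0) (hf' : ∀ x ∈ V', formFn f x = 0) (g : Form (n + 1) X 0) :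
    ∃ α β : Form (n + 1) X 1, mulForm f (d g) = mulForm (δ ω 0 α) (d (δ ω 0 β)) := by
  -- χ vanishes near the points p_k and is 1 off V.
  obtain ⟨χ, hχ0, hχ1, -⟩ := exists_contMDiffMap_zero_one_nhds_of_isClosed (n := (⊤ : ℕ∞))
    (𝓡 (2 * (n + 1))) (isClosed_range_of_locallyFinite (locallyFinite_bumpBall B) hp)
    hV.isClosed_compl (Set.disjoint_compl_right_iff_subset.2 (by
      rintro _ ⟨k, rfl⟩
      exact hpV k))
  set U : Set X := interior {x | χ x = 0} with hU
  have hpU : ∀ k, p k ∈ U := fun k =>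
    subset_interior_iff_mem_nhdsSet.2 hχ0 ⟨k, rfl⟩
  have hχV : ∀ x ∉ V, χ x = 1 := fun x hx => hχ1.self_of_nhdsSet x hx
  have hUχ : ∀ x ∈ U, χ x = 0 := fun x hx =>
    interior_subset (s := {x | χ x = 0}) hx
  have hUV : U ⊆ V := fun x hx => by
    by_contra h
    exact zero_ne_one ((hUχ x hx).symm.trans (hχV x h))
  obtain ⟨v, α, hv, hα⟩ := exists_sub_eq_δ ω B hp isOpen_interior hpU f
  -- The correction of f will live where this function is zero, and its own correction w lives in
  -- V', where f is zero.
  set h : Form (n + 1) X 0 := mulForm (ofFn χ χ.contMDiff) g with hh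
  obtain ⟨w, β, hw, hβ⟩ := exists_sub_eq_δ ω B hq hV' hqV h
  refine ⟨α, β, ?_⟩
  rw [← hα, ← hβ]
  refine Subtype.ext (funext fun x => ?_)
  change formFn f x • (d g).1 x = (formFn f x - formFn v x) • (d (h - w)).1 x
  have hhw : ∀ z, (h - w).1 z = χ z • g.1 z - w.1 z := fun z => rfl
  -- On U the first factor is altered by v, but there χ = 0, and w = 0 since U ⊆ V is disjoint from
  -- V'. So the second factor vanishes, as does f.
  by_cases hx : x ∈ U
  · have h0 : (d (h - w)).1 x = 0 := by
      rw [d_congr (β := 0) (x := x), map_zero]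
      · rfl
      · filter_upwards [isOpen_interior.mem_nhds hx] with z hz
        rw [hhw, hUχ z hz, hw z fun hz' => hd.le_bot ⟨hUV hz, hz'⟩, sub_zero]
        exact zero_smul _ _
    rw [h0, hf x (hUV hx), zero_smul, smul_zero]
  · have hvx : formFn v x = 0 := by
      rw [formFn, hv x hx]
      rfl
    rw [hvx, sub_zero]
    by_cases hfx : formFn f x = 0
    · rw [hfx, zero_smul, zero_smul]
    · rw [d_congr (α := h - w) (β := g)]
      filter_upwards [(contMDiff_formFn f).continuous.continuousAt.eventually_ne hfx] with z hz
      rw [hhw, hχV z fun hzV => hz (hf z hzV), hw z fun hzV => hz (hf' z hzV), sub_zero]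
      exact one_smul _ _

end Perfect

/-! ### Every class is a sum of commutators. -/

section PerfectGlobal

variable {n : ℕ} {X : Type*} [TopologicalSpace X] [ChartedSpace (Model (n + 1)) X]
  [IsManifold (𝓡 (2 * (n + 1))) ((⊤ : ℕ∞) : WithTop ℕ∞) X] [T2Space X]
  [SecondCountableTopology X] (ω : SymplecticForm (n + 1) X)

/-- Every class of one-forms is a sum of `N + 1` brackets, if `N` is at least twice the
dimension. -/
theorem exists_cls_eq_sum_quotBracket {N : ℕ} (hN : 2 * (2 * (n + 1)) ≤ N)
    (a : CanonicalQuotient ω) :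
    ∃ b c : Fin (N + 1) → CanonicalQuotient ω, a = ∑ i, quotBracket ω (b i) (c i) := by
  have : LocallyCompactSpace X := ChartedSpace.locallyCompactSpace (Model (n + 1)) X
  obtain ⟨α, rfl⟩ := cls_surjective ω a
  obtain ⟨ι, B, -⟩ := SmoothBumpCovering.exists_isSubordinate (𝓡 (2 * (n + 1)))
    (isClosed_univ : IsClosed (Set.univ : Set X)) (U := fun _ => Set.univ)
    fun x _ => Filter.univ_mem
  have hS := locallyFinite_bumpBall B
  have : Countable ι := Set.countable_univ_iff.1 (B.locallyFinite.countable_univ fun k =>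
    (B k).nonempty_support)
  -- One marked point for each ball, each summand i and each Boolean: every product f_i dg_i uses
  -- two families, one for either factor of the commutator.
  obtain ⟨p, hpi, hp⟩ := exists_injective_choice
    (fun q : ι × (Fin (N + 1) × Bool) => bumpBall B q.1) fun q => infinite_bumpBall B q.1
  obtain ⟨V, hVo, hpV, hVd⟩ := exists_open_pairwise_disjoint_closure
    (P := fun s => Set.range fun k => p (k, s))
    (fun s => isClosed_range_of_locallyFinite hS fun k => hp (k, s)) fun s t hst => by
      refine Set.disjoint_left.2 ?_
      rintro _ ⟨k, rfl⟩ ⟨l, hl⟩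
      exact hst (congrArg Prod.snd (hpi hl)).symm
  obtain ⟨g, hg⟩ := exists_separating_functions B hN
  -- f_i has to vanish near both families with index i; the closed sets for different i are
  -- disjoint.
  obtain ⟨f, hf, hα⟩ := exists_coefficients g hg
    (W := fun i => closure (V (i, false)) ∪ closure (V (i, true)))
    (fun i => isClosed_closure.union isClosed_closure) (fun i j hij => by
      have h : ∀ s t : Bool, Disjoint (closure (V (i, s))) (closure (V (j, t))) := fun s t =>
        hVd fun h => hij (congrArg Prod.fst h)
      exact Set.disjoint_union_left.2 ⟨Set.disjoint_union_right.2 ⟨h _ _, h _ _⟩,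
        Set.disjoint_union_right.2 ⟨h _ _, h _ _⟩⟩) α
  have key : ∀ i, ∃ β γ : Form (n + 1) X 1,
      mulForm (f i) (d (g i)) = mulForm (δ ω 0 β) (d (δ ω 0 γ)) := by
    intro i
    have hne : ((i, false) : Fin (N + 1) × Bool) ≠ (i, true) := by simp
    have hV : Disjoint (closure (V (i, false))) (closure (V (i, true))) := hVd hne
    have hpV' : ∀ s k, p (k, s) ∈ V s := fun s k => hpV s ⟨k, rfl⟩
    exact exists_mulForm_d_eq ω B (fun k => hp (k, (i, false))) (fun k => hp (k, (i, true)))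
      (hVo _) (hVo _) (hpV' _) (hpV' _) (hV.mono subset_closure subset_closure)
      (fun x hx => hf i x (Or.inl (subset_closure hx)))
      (fun x hx => hf i x (Or.inr (subset_closure hx))) (g i)
  choose β γ hβγ using key
  refine ⟨fun i => cls ω (β i), fun i => cls ω (γ i), ?_⟩
  refine (congrArg (cls ω) hα).trans ((map_sum (cls ω) _ _).trans
    (Finset.sum_congr rfl fun i _ => ?_))
  exact congrArg (cls ω) (hβγ i)

end PerfectGlobal

/-! ### Commutator ideals and the case of dimension zero. -/

section Lie

theorem lie_top_eq_top {L : Type*} [LieRing L] [LieAlgebra ℝ L] {I : Type*} [Fintype I]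
    (h : ∀ a : L, ∃ b c : I → L, a = ∑ i, ⁅b i, c i⁆) :
    ⁅(⊤ : LieIdeal ℝ L), (⊤ : LieIdeal ℝ L)⁆ = ⊤ := by
  refine eq_top_iff.2 fun a _ => ?_
  obtain ⟨b, c, rfl⟩ := h a
  exact sum_mem fun i _ => LieSubmodule.lie_mem_lie (LieSubmodule.mem_top _)
    (LieSubmodule.mem_top _)

theorem subsingleton_form_of_zero {k : ℕ} {X : Type*} [TopologicalSpace X]
    [ChartedSpace (Model 0) X] : Subsingleton (Form 0 X (k + 1)) := by
  refine ⟨fun α β => Subtype.ext (funext fun x => ?_)⟩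
  have h : ∀ η : Cov 0 (k + 1), η = 0 := fun η => by
    ext v
    refine η.map_coord_zero 0 ?_
    ext i
    exact absurd i.2 (by simp)
  rw [h (α.1 x), h (β.1 x)]

end Lie

end CanonicalHomology

end

theorem mainTheorem9 (n : ℕ) (X : Type*) [TopologicalSpace X] [T2Space X]
    [SecondCountableTopology X] [ChartedSpace (CanonicalHomology.Model n) X]
    [IsManifold (𝓡 (2 * n)) ((⊤ : ℕ∞) : WithTop ℕ∞) X]
    (ω : CanonicalHomology.SymplecticForm n X) :
    ∃ (B : CanonicalHomology.CanonicalQuotient ω →ₗ[ℝ] CanonicalHomology.CanonicalQuotient ω →ₗ[ℝ]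
        CanonicalHomology.CanonicalQuotient ω)
      (hself : ∀ a, B a a = 0)
      (hjacobi : ∀ a b c, B a (B b c) = B (B a b) c + B b (B a c)),
      (∀ α β : CanonicalHomology.Form n X 1,
        B (CanonicalHomology.cls ω α) (CanonicalHomology.cls ω β) =
          CanonicalHomology.cls ω (CanonicalHomology.mulForm (CanonicalHomology.δ ω 0 α)
            (CanonicalHomology.d (CanonicalHomology.δ ω 0 β)))) ∧
      letI : LieRing (CanonicalHomology.CanonicalQuotient ω) :=
        CanonicalHomology.lieRingOfBracket B hself hjacobi
      letI : LieAlgebra ℝ (CanonicalHomology.CanonicalQuotient ω) :=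
        CanonicalHomology.lieAlgebraOfBracket B hself hjacobi
      ⁅(⊤ : LieIdeal ℝ (CanonicalHomology.CanonicalQuotient ω)),
          (⊤ : LieIdeal ℝ (CanonicalHomology.CanonicalQuotient ω))⁆ = ⊤ ∧
        ∀ a : CanonicalHomology.CanonicalQuotient ω,
          ∃ b c : Fin (2 * n * (2 * n + 1)) → CanonicalHomology.CanonicalQuotient ω,
            a = ∑ i, ⁅b i, c i⁆ := by
  rcases n with _ | n
  -- In dimension 0 there are no nonzero one-forms; the bound is then 0, and the empty sum suffices.
  · haveI : Subsingleton (CanonicalHomology.CanonicalQuotient ω) :=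
      have := CanonicalHomology.subsingleton_form_of_zero (k := 0) (X := X)
      (Submodule.mkQ_surjective _).subsingleton
    refine ⟨0, fun _ => rfl, fun _ _ _ => Subsingleton.elim _ _, fun _ _ => Subsingleton.elim _ _,
      ?_⟩
    have h : ∀ a : CanonicalHomology.CanonicalQuotient ω,
        ∃ b c : Fin (2 * 0 * (2 * 0 + 1)) → CanonicalHomology.CanonicalQuotient ω,
          a = ∑ i, (0 : CanonicalHomology.CanonicalQuotient ω →ₗ[ℝ]
            CanonicalHomology.CanonicalQuotient ω →ₗ[ℝ]
            CanonicalHomology.CanonicalQuotient ω) (b i) (c i) :=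
      fun a => ⟨0, 0, Subsingleton.elim _ _⟩
    let := CanonicalHomology.lieRingOfBracket (0 : CanonicalHomology.CanonicalQuotient ω →ₗ[ℝ]
      CanonicalHomology.CanonicalQuotient ω →ₗ[ℝ] CanonicalHomology.CanonicalQuotient ω)
      (fun _ => rfl) (fun _ _ _ => Subsingleton.elim _ _)
    let := CanonicalHomology.lieAlgebraOfBracket (0 : CanonicalHomology.CanonicalQuotient ω →ₗ[ℝ]
      CanonicalHomology.CanonicalQuotient ω →ₗ[ℝ] CanonicalHomology.CanonicalQuotient ω)
      (fun _ => rfl) (fun _ _ _ => Subsingleton.elim _ _)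
    exact ⟨CanonicalHomology.lie_top_eq_top h, h⟩
  · have h : ∀ a : CanonicalHomology.CanonicalQuotient ω,
        ∃ b c : Fin (2 * (n + 1) * (2 * (n + 1) + 1)) → CanonicalHomology.CanonicalQuotient ω,
          a = ∑ i, CanonicalHomology.quotBracket ω (b i) (c i) := by
      -- With D = 2(n + 1) the number of terms D(D + 1) is N + 1, and N ≥ 2D because D ≥ 2.
      obtain ⟨N, hN, hN'⟩ : ∃ N, 2 * (n + 1) * (2 * (n + 1) + 1) = N + 1 ∧
          2 * (2 * (n + 1)) ≤ N :=
        ⟨2 * (n + 1) * (2 * (n + 1) + 1) - 1, by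
          have : 0 < 2 * (n + 1) * (2 * (n + 1) + 1) := by positivity
          omega, by
          refine Nat.le_sub_one_of_lt ?_
          nlinarith⟩
      rw [hN]
      exact CanonicalHomology.exists_cls_eq_sum_quotBracket ω hN'
    refine ⟨CanonicalHomology.quotBracket ω, CanonicalHomology.quotBracket_self ω,
      CanonicalHomology.quotBracket_jacobi ω, CanonicalHomology.quotBracket_cls ω, ?_⟩
    let := CanonicalHomology.lieRingOfBracket (CanonicalHomology.quotBracket ω)
      (CanonicalHomology.quotBracket_self ω) (CanonicalHomology.quotBracket_jacobi ω)
    let := CanonicalHomology.lieAlgebraOfBracket (CanonicalHomology.quotBracket ω)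
      (CanonicalHomology.quotBracket_self ω) (CanonicalHomology.quotBracket_jacobi ω)
    exact ⟨CanonicalHomology.lie_top_eq_top h, h⟩
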